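/- Let $m>2$ and $n=2k$ with $k\ge 1$, put $l=\lfloor m/2\rfloor$, and let $q\in\mathbb C\setminus\{0\}$ not be a root of unity, with a fixed square root $q^{1/2}$. **Notation.** $V$ has basis $|a\rangle$, where $a$ runs over the even indices $i=1,\dots,m$ ($[i]=0$) and the odd indices $\mu=1,\dots,n$ ($[\mu]=1$); $E^a_b$ are the elementary matrices, of parity $[a]+[b]$. Put $\overline{i}=m+1-i$, $\overline{\mu}=n+1-\mu$, $\xi_i=1$, $\xi_\mu=(-1)^\mu$. The weight of $|a\rangle$ is denoted $\varepsilon_a$: $\varepsilon_i$ for $i\le l$ and $\varepsilon_\mu=\delta_\mu$ for $\mu\le k$ are linearly independent, and $\varepsilon_{\overline a}=-\varepsilon_a$ (so $\varepsilon_{l+1}=0$ if $m=2l+1$). The form is $(\varepsilon_i,\varepsilon_j)=\delta_{ij}$, $(\delta_\mu,\delta_\nu)=-\delta_{\mu\nu}$, $(\varepsilon_i,\delta_\mu)=0$ for $i,j\le l$, $\mu,\nu\le k$. The weights are ordered by $\delta_1>\dots>\delta_k>\varepsilon_1>\dots>\varepsilon_l\,(>0)>-\varepsilon_l>\dots>-\varepsilon_1>-\delta_k>\dots>-\delta_1$.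 The simple roots are $\alpha_i=\varepsilon_i-\varepsilon_{i+1}$ ($1\le i<l$); $\alpha_l=\varepsilon_{l-1}+\varepsilon_l$ if $m=2l$ and $\alpha_l=\varepsilon_l$ if $m=2l+1$; $\alpha_\mu=\delta_\mu-\delta_{\mu+1}$ ($1\le\mu<k$); and $\alpha_s=\delta_k-\varepsilon_1$, which is the only odd one. $U=U_q[osp(m|n)]$ is the associative superalgebra over $\mathbb C$ generated by $e_c,f_c$ ($c$ a simple root label, $[e_c]=[f_c]=[c]$) and even elements $q^{h_\lambda/2}$ ($\lambda$ in the lattice spanned by all $\varepsilon_a$), with $h_c=h_{\alpha_c}$ and relations $q^{h_0/2}=1$, $q^{h_\lambda/2}q^{h_\mu/2}=q^{h_{\lambda+\mu}/2}$, $q^{h_\lambda/2}e_c=q^{(\lambda,\alpha_c)/2}e_cq^{h_\lambda/2}$, $q^{h_\lambda/2}f_c=q^{-(\lambda,\alpha_c)/2}f_cq^{h_\lambda/2}$, $e_bf_c-(-1)^{[b][c]}f_ce_b=\delta_{bc}\frac{q^{h_c}-q^{-h_c}}{q-q^{-1}}$, $e_s^2=f_s^2=0$, the $q$-Serre relations $(\mathrm{ad}\,e_b)^{1-a_{bc}}e_c=0$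 for $b\ne c$, where $a_{bc}=2(\alpha_b,\alpha_c)/(\alpha_b,\alpha_b)$ if $(\alpha_b,\alpha_b)\neq0$ and $a_{bc}=-|(\alpha_b,\alpha_c)|$ if $b=s$, and the extra $q$-Serre relations $[e_s,[e_b,[e_s,e_c]_q]_q]_q=0$ for all $b,c$ with $(\alpha_s,\alpha_b)=-(\alpha_s,\alpha_c)\ne0$. Here $\mathrm{ad}\,e_b(x)=[e_b,x]_q$, $[x,y]_q=xy-(-1)^{[x][y]}q^{(\mathrm{wt}\,x,\mathrm{wt}\,y)}yx$, and the $f_c$ satisfy the same (extra) $q$-Serre relations with $q^{-1}$ in place of $q$. $U^+$ is the subalgebra generated by the $e_c$ and all $q^{h_\lambda/2}$. In the vector representation, $e_c$ acts on $V$ as $E^a_b-(-1)^{[a]([a]+[b])}\xi_a\xi_bE^{\overline b}_{\overline a}$ with $(a,b)=(i,i+1)$ for $\alpha_i$ ($i<l$), $(l-1,\overline l)$ resp. $(l,l+1)$ for $\alpha_l$ if $m=2l$ resp. $m=2l+1$, $(\mu,\mu+1)$ for $\alpha_\mu$, and $(\mu{=}k,\,i{=}1)$ for $\alpha_s$; and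 $h_\lambda|a\rangle=(\lambda,\varepsilon_a)|a\rangle$. In the graded tensor product $(\mathrm{End}\,V)\otimes U$, where $(x\otimes y)(z\otimes w)=(-1)^{[y][z]}xz\otimes yw$ and the first factor acts through the vector representation, put $$\Delta(e_c)=q^{\frac12h_c}\otimes e_c+e_c\otimes q^{-\frac12h_c},\qquad \Delta^T(e_c)=e_c\otimes q^{\frac12h_c}+q^{-\frac12h_c}\otimes e_c .$$ The operator $q^{\sum_ah_a\otimes h^a}$ (with $a$ over the basis $\varepsilon_i$, $i\le l$, $\delta_\mu$, $\mu\le k$, $h_a=h_{\varepsilon_a}$, $h^a=(-1)^{[a]}h_{\varepsilon_a}$) is $\sum_aE^a_a\otimes q^{h_{\varepsilon_a}}$, the last sum being over all indices $a$. **Claim.** There is a unique $R\in(\mathrm{End}\,V)\otimes U^+$ that is of the form $$R=q^{\sum_ah_a\otimes h^a}\Bigl[I\otimes I+(q-q^{-1})\sum_{\varepsilon_a<\varepsilon_b}(-1)^{[b]}E^a_b\otimes\hat\sigma_{ba}\Bigr],\qquad \hat\sigma_{ba}\in U,$$ and satisfies $R\,\Delta(e_c)=\Delta^T(e_c)\,R$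 for all simple root labels $c$. Its entries satisfy: * (fundamental values) $\hat\sigma_{i\,i+1}=-\hat\sigma_{\overline{i+1}\,\overline i}=q^{1/2}e_iq^{h_i/2}$ for $1\le i<l$; if $m=2l$: $\hat\sigma_{l-1\,\overline l}=-\hat\sigma_{l\,\overline{l-1}}=q^{1/2}e_lq^{h_l/2}$ and $\hat\sigma_{l\,\overline l}=0$; if $m=2l+1$: $\hat\sigma_{l\,l+1}=-q^{-1/2}\hat\sigma_{l+1\,\overline l}=e_lq^{h_l/2}$; $\hat\sigma_{\mu\,\mu+1}=\hat\sigma_{\overline{\mu+1}\,\overline\mu}=q^{-1/2}e_\mu q^{h_\mu/2}$ for $1\le\mu<k$; $\hat\sigma_{\mu=k\,i=1}=(-1)^kq\,\hat\sigma_{\overline{i}=\overline 1\,\overline\mu=\overline k}=q^{1/2}e_sq^{h_s/2}$; * (i) the $q$-commutation relations $$q^{(\alpha_c,\varepsilon_b)}\hat\sigma_{ba}e_cq^{\frac12h_c}-(-1)^{([a]+[b])[c]}q^{-(\alpha_c,\varepsilon_a)}e_cq^{\frac12h_c}\hat\sigma_{ba}=0,\qquad\varepsilon_b>\varepsilon_a,$$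 whenever neither $\varepsilon_a-\alpha_c$ nor $\varepsilon_b+\alpha_c$ equals any $\varepsilon_x$; * (ii) the induction relations $$\hat\sigma_{ba}=q^{-(\varepsilon_b,\varepsilon_a)}\hat\sigma_{bc}\hat\sigma_{ca}-q^{-(\varepsilon_c,\varepsilon_c)}(-1)^{([b]+[c])([a]+[c])}\hat\sigma_{ca}\hat\sigma_{bc},\qquad\varepsilon_b>\varepsilon_c>\varepsilon_a,\ c\ne\overline a,\overline b .$$ Moreover the fundamental values and (i), (ii) determine the remaining entries: every family $(\tau_{ba})_{\varepsilon_a<\varepsilon_b}$ in $U$ with these fundamental values that satisfies (i) and (ii) is equal to $(\hat\sigma_{ba})_{\varepsilon_a<\varepsilon_b}$. -/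

import Mathlib

open scoped TensorProduct

noncomputable section

namespace Osp

/-- The data of `osp(m|n)` with `m > 2` and `n = 2k` a positive even number. -/
structure Params where
  m : ℕ
  k : ℕ
  two_lt_m : 2 < m
  k_pos : 0 < k

/-- `n = 2k`. -/
abbrev Params.n (P : Params) : ℕ := 2 * P.k

/-- `l = ⌊m/2⌋`. -/
abbrev Params.l (P : Params) : ℕ := P.m / 2

/-- The sign `(-1)^x` of a parity `x`. -/
def sgn (x : ZMod 2) : ℂ := if x = 0 then 1 else -1

theorem sgn_add (x y : ZMod 2) : sgn (x + y) = sgn x * sgn y := by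
  have h : ∀ x : ZMod 2, x = 0 ∨ x = 1 := by decide
  have h11 : (1 : ZMod 2) + 1 = 0 := by decide
  rcases h x with rfl | rfl <;> rcases h y with rfl | rfl <;> simp [sgn, h11]

theorem sgn_mul_self (x : ZMod 2) : sgn x * sgn x = 1 := by
  unfold sgn
  split_ifs <;> norm_num

/-! ### Indices, weights and simple roots

Indices of the basis of `V` are numbered from `0`: the even index `i` (for `1 ≤ i ≤ m`) is
`Sum.inl ⟨i - 1, _⟩` and the odd index `μ` (for `1 ≤ μ ≤ n`) is `Sum.inr ⟨μ - 1, _⟩`. -/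

/-- The index set of the basis of the `(m+n)`-dimensional superspace `V`. -/
abbrev Idx (P : Params) : Type := Fin P.m ⊕ Fin P.n

variable (P : Params)

/-- The parity `[a]`. -/
def par : Idx P → ZMod 2
  | Sum.inl _ => 0
  | Sum.inr _ => 1

/-- The involution `a ↦ ā`, that is `ī = m + 1 - i` and `μ̄ = n + 1 - μ`. -/
def bar : Idx P → Idx P
  | Sum.inl i => Sum.inl i.rev
  | Sum.inr j => Sum.inr j.rev

/-- `ξ_i = 1` and `ξ_μ = (-1)^μ` (the index `μ` is counted from `1`). -/
def xi : Idx P → ℂ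
  | Sum.inl _ => 1
  | Sum.inr j => (-1) ^ (j.val + 1)

/-- The weight lattice `⨁ ℤ ε_i ⊕ ⨁ ℤ δ_μ` with `1 ≤ i ≤ l` and `1 ≤ μ ≤ k`. -/
abbrev Weight : Type := Fin P.l ⊕ Fin P.k → ℤ

/-- The basis vectors `ε_i`, `δ_μ` of the weight lattice. -/
def eps (x : Fin P.l ⊕ Fin P.k) : Weight P := Pi.single x 1

/-- The parity of a basis vector of the weight lattice. -/
def epsPar : Fin P.l ⊕ Fin P.k → ZMod 2
  | Sum.inl _ => 0
  | Sum.inr _ => 1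

/-- The bilinear form: `(ε_i, ε_j) = δ_ij`, `(δ_μ, δ_ν) = -δ_μν`, `(ε_i, δ_μ) = 0`. -/
def form (x y : Weight P) : ℤ :=
  ∑ i, x (Sum.inl i) * y (Sum.inl i) - ∑ j, x (Sum.inr j) * y (Sum.inr j)

/-- The weight `ε_a` of the index `a`, with `ε_ā = -ε_a`
(so that `ε_(l+1) = 0` when `m = 2l + 1`). -/
def wt : Idx P → Weight P
  | Sum.inl i =>
      if h : i.val < P.l then eps P (Sum.inl ⟨i.val, h⟩)
      else if h' : i.rev.val < P.l then -eps P (Sum.inl ⟨i.rev.val, h'⟩)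
      else 0
  | Sum.inr j =>
      if h : j.val < P.k then eps P (Sum.inr ⟨j.val, h⟩)
      else -eps P (Sum.inr ⟨j.rev.val, by
        have h2 : j.val < 2 * P.k := j.isLt
        have h3 : j.rev.val = 2 * P.k - (j.val + 1) := Fin.val_rev j
        omega⟩)

/-- The place of `ε_a` in the list
`δ_1 > ⋯ > δ_k > ε_1 > ⋯ > ε_l (> 0) > -ε_l > ⋯ > -ε_1 > -δ_k > ⋯ > -δ_1`. -/
def pos : Idx P → ℕ
  | Sum.inl i => P.k + i.val
  | Sum.inr j => if j.val < P.k then j.val else P.m + j.val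

/-- The total order on the weights of `V`: `WtLT P a b` means `ε_a < ε_b`. The differences
`ε_b - ε_a` for `ε_a < ε_b` are the positive roots together with the `2 ε_i`. -/
def WtLT (a b : Idx P) : Prop := pos P b < pos P a

instance instDecidableWtLT (a b : Idx P) : Decidable (WtLT P a b) := inferInstanceAs (Decidable (_ < _))

/-- Labels of the simple roots: `even i` is `α_(i+1) = ε_(i+1) - ε_(i+2)` (in `1`-based
numbering), `last` is `α_l`, `odd j` is `δ_(j+1) - δ_(j+2)`, and `s` is `α_s = δ_k - ε_1`. -/
inductive Simple : Type
  | even (i : Fin (P.l - 1))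
  | last
  | odd (j : Fin (P.k - 1))
  | s

/-- The even index with `0`-based number `i`. -/
def ev (i : ℕ) (h : i < P.m) : Idx P := Sum.inl ⟨i, h⟩

/-- The odd index with `0`-based number `j`. -/
def od (j : ℕ) (h : j < P.n) : Idx P := Sum.inr ⟨j, h⟩

variable {P}

theorem lt_m_of_le {i : ℕ} (h : i ≤ P.l) : i < P.m := by
  have := P.two_lt_m
  have : P.l = P.m / 2 := rfl
  omega

/-- The generator `e_c` is the Cartan-Weyl generator `σ^a_b` with `a = row c`, `b = col c`. -/
def row : Simple P → Idx P
  | Simple.even i => ev P i.val (lt_m_of_le (by omega))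
  | Simple.last =>
      if Even P.m then ev P (P.l - 2) (lt_m_of_le (by omega))
      else ev P (P.l - 1) (lt_m_of_le (by omega))
  | Simple.odd j => od P j.val (by have := j.isLt; change _ < 2 * P.k; omega)
  | Simple.s => od P (P.k - 1) (by have := P.k_pos; change _ < 2 * P.k; omega)

/-- See `row`. -/
def col : Simple P → Idx P
  | Simple.even i => ev P (i.val + 1) (lt_m_of_le (by omega))
  | Simple.last =>
      if Even P.m then bar P (ev P (P.l - 1) (lt_m_of_le (by omega)))
      else ev P P.l (lt_m_of_le le_rfl)
  | Simple.odd j => od P (j.val + 1) (by have := j.isLt; change _ < 2 * P.k; omega)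
  | Simple.s => ev P 0 (lt_m_of_le (by omega))

/-- The simple root `α_c = ε_a - ε_b` for `e_c = σ^a_b`. -/
def root (c : Simple P) : Weight P := wt P (row c) - wt P (col c)

/-- The parity `[c]` of `e_c` and `f_c`. -/
def spar (c : Simple P) : ZMod 2 := par P (row c) + par P (col c)

/-- The Cartan matrix: `2 (α_b, α_c) / (α_b, α_b)` if `(α_b, α_b) ≠ 0` (the division is exact),
and `-|(α_b, α_c)|` for the isotropic root. -/
def cartan (b c : Simple P) : ℤ :=
  if form P (root b) (root b) = 0 then -|form P (root b) (root c)|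
  else 2 * form P (root b) (root c) / form P (root b) (root b)

/-! ### The quantum superalgebra

The deformation parameter is `q = r ^ 2`, so that `r` is the chosen `q^(1/2)`. -/

variable (P) in
/-- Generators: `e_c`, `f_c`, and `K x = q^(h_x / 2)` for `x` in the weight lattice, where
`h_x` is the Cartan element with `[h_x, e_c] = (x, α_c) e_c`; in particular `h_c = h_(α_c)`. -/
inductive Gen : Type
  | e (c : Simple P)
  | f (c : Simple P)
  | K (x : Weight P)

/-- An element of the free algebra together with a weight and a parity. -/
structure HomElt (P : Params) where
  val : FreeAlgebra ℂ (Gen P)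
  wgt : Weight P
  prt : ZMod 2

/-- The `q`-bracket `x y - (-1)^([x][y]) q^((wt x, wt y)) y x`, where `q = r ^ 2`. -/
def qBracket (r : ℂ) (X Y : HomElt P) : HomElt P where
  val := X.val * Y.val -
    (sgn (X.prt * Y.prt) * r ^ (2 * form P X.wgt Y.wgt)) • (Y.val * X.val)
  wgt := X.wgt + Y.wgt
  prt := X.prt + Y.prt

/-- The free generator `e_c`. -/
def fe (c : Simple P) : FreeAlgebra ℂ (Gen P) := FreeAlgebra.ι ℂ (Gen.e c)

/-- The free generator `f_c`. -/
def ff (c : Simple P) : FreeAlgebra ℂ (Gen P) := FreeAlgebra.ι ℂ (Gen.f c)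

/-- The free generator `q^(h_x / 2)`. -/
def fK (x : Weight P) : FreeAlgebra ℂ (Gen P) := FreeAlgebra.ι ℂ (Gen.K x)

/-- `e_c` with its weight and parity. -/
def eElt (c : Simple P) : HomElt P := ⟨fe c, root c, spar c⟩

/-- `f_c` with its weight and parity. -/
def fElt (c : Simple P) : HomElt P := ⟨ff c, -root c, spar c⟩

/-- The defining relations of `U_q[osp(m|n)]`, `q = r ^ 2`. The (extra) `q`-Serre relations
involve the adjoint action `ad E_b ∘ y = E_b y - (-1)^([b][y]) q^((α_b, wt y)) y E_b` of
`E_b = e_b q^(h_b / 2)`. They are written with the `e_c` alone: a nested `q`-bracket of elements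
`E_c` is the same nested `q`-bracket of the `e_c` times an invertible Cartan element. For the
`f_c` one gets the same brackets with `q⁻¹` in place of `q`. -/
inductive Rel (r : ℂ) : FreeAlgebra ℂ (Gen P) → FreeAlgebra ℂ (Gen P) → Prop
  | K_zero : Rel r (fK 0) 1
  | K_add (x y : Weight P) : Rel r (fK (x + y)) (fK x * fK y)
  | K_e (x : Weight P) (c : Simple P) :
      Rel r (fK x * fe c) (r ^ form P x (root c) • (fe c * fK x))
  | K_f (x : Weight P) (c : Simple P) :
      Rel r (fK x * ff c) (r ^ (-form P x (root c)) • (ff c * fK x))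
  | e_f_self (c : Simple P) :
      Rel r (fe c * ff c - sgn (spar c * spar c) • (ff c * fe c))
        ((r ^ 2 - (r ^ 2)⁻¹)⁻¹ • (fK (2 • root c) - fK (-(2 • root c))))
  | e_f_ne (b c : Simple P) (h : b ≠ c) :
      Rel r (fe b * ff c - sgn (spar b * spar c) • (ff c * fe b)) 0
  | e_sq (c : Simple P) (h : form P (root c) (root c) = 0) : Rel r (fe c * fe c) 0
  | f_sq (c : Simple P) (h : form P (root c) (root c) = 0) : Rel r (ff c * ff c) 0
  | serre_e (b c : Simple P) (h : b ≠ c) :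
      Rel r ((qBracket r (eElt b))^[(1 - cartan b c).toNat] (eElt c)).val 0
  | serre_f (b c : Simple P) (h : b ≠ c) :
      Rel r ((qBracket r⁻¹ (fElt b))^[(1 - cartan b c).toNat] (fElt c)).val 0
  /-- Here `b` and `c` are neighbours of `s` on the two sides of the odd node. -/
  | extra_e (b c : Simple P) (hb : form P (root Simple.s) (root b) ≠ 0)
      (hc : form P (root Simple.s) (root c) = -form P (root Simple.s) (root b)) :
      Rel r (qBracket r (eElt Simple.s) (qBracket r (eElt b)
        (qBracket r (eElt Simple.s) (eElt c)))).val 0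
  | extra_f (b c : Simple P) (hb : form P (root Simple.s) (root b) ≠ 0)
      (hc : form P (root Simple.s) (root c) = -form P (root Simple.s) (root b)) :
      Rel r (qBracket r⁻¹ (fElt Simple.s) (qBracket r⁻¹ (fElt b)
        (qBracket r⁻¹ (fElt Simple.s) (fElt c)))).val 0

variable (P) in
/-- The quantum superalgebra `U_q[osp(m|n)]` with `q = r ^ 2`. -/
abbrev Uq (r : ℂ) : Type := RingQuot (Rel (P := P) r)

section Generators

variable (r : ℂ)

/-- The raising generator `e_c`. -/
def ue (c : Simple P) : Uq P r := RingQuot.mkAlgHom ℂ (Rel r) (fe c)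

/-- The lowering generator `f_c`. -/
def uf (c : Simple P) : Uq P r := RingQuot.mkAlgHom ℂ (Rel r) (ff c)

/-- The Cartan element `q^(h_x / 2)`. -/
def uK (x : Weight P) : Uq P r := RingQuot.mkAlgHom ℂ (Rel r) (fK x)

variable (P) in
/-- `U_q[osp(m|n)]^+`, generated by the raising generators and the Cartan elements. -/
def Uplus : Subalgebra ℂ (Uq P r) := Algebra.adjoin ℂ (Set.range (ue r) ∪ Set.range (uK r))

end Generators

/-! ### The `ℤ/2`-gradings -/

/-- Auxiliary: a family of two submodules with compatible projections is a grading. -/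
@[reducible] def gradedOfProj {A : Type*} [Ring A] [Algebra ℂ A] (S : ZMod 2 → Submodule ℂ A)
    (one_mem : (1 : A) ∈ S 0)
    (mul_mem : ∀ ⦃i j : ZMod 2⦄ ⦃x y : A⦄, x ∈ S i → y ∈ S j → x * y ∈ S (i + j))
    (p : ZMod 2 → A →ₗ[ℂ] A) (hp : ∀ i x, p i x ∈ S i)
    (hsum : ∀ x, p 0 x + p 1 x = x)
    (hid : ∀ i x, x ∈ S i → p i x = x) (hzero : ∀ i j x, x ∈ S i → j ≠ i → p j x = 0) :
    GradedAlgebra S :=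
  { one_mem := one_mem
    mul_mem := mul_mem
    toDecomposition := DirectSum.Decomposition.ofAddHom S
      ((DirectSum.of (fun i => S i) 0).comp
          ((p 0).codRestrict (S 0) (hp 0)).toAddMonoidHom +
        (DirectSum.of (fun i => S i) 1).comp
          ((p 1).codRestrict (S 1) (hp 1)).toAddMonoidHom)
      (by
        ext x
        simp [hsum])
      (by
        ext i x : 2
        have h01 : (0 : ZMod 2) ≠ 1 := by decide
        have hx := x.2
        obtain rfl | rfl : i = 0 ∨ i = 1 :=
          (by decide : ∀ i : ZMod 2, i = 0 ∨ i = 1) i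
        · have h1 : (p 0).codRestrict (S 0) (hp 0) x = x := Subtype.ext (hid 0 x hx)
          have h2 : (p 1).codRestrict (S 1) (hp 1) x = 0 :=
            Subtype.ext (hzero 0 1 x hx h01.symm)
          simp [h1, h2]
        · have h1 : (p 1).codRestrict (S 1) (hp 1) x = x := Subtype.ext (hid 1 x hx)
          have h2 : (p 0).codRestrict (S 0) (hp 0) x = 0 :=
            Subtype.ext (hzero 1 0 x hx h01)
          simp [h1, h2]) }

variable (P) in
/-- `End V`, as matrices indexed by the basis of `V`. -/
abbrev EndV : Type := Matrix (Idx P) (Idx P) ℂ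

variable (P) in
/-- The grading of `End V`: the elementary matrix `E^a_b` has parity `[a] + [b]`. -/
def endGrading (i : ZMod 2) : Submodule ℂ (EndV P) where
  carrier := {M | ∀ a b, par P a + par P b ≠ i → M a b = 0}
  add_mem' := by
    intro M N hM hN a b h
    simp [hM a b h, hN a b h]
  zero_mem' := by
    intro a b _
    rfl
  smul_mem' := by
    intro c M hM a b h
    simp [hM a b h]

variable (P) in
/-- The projection of `End V` to its part of parity `i`. -/
def endProj (i : ZMod 2) : EndV P →ₗ[ℂ] EndV P where
  toFun M := Matrix.of fun a b => if par P a + par P b = i then M a b else 0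
  map_add' := by
    intro M N
    ext a b
    by_cases h : par P a + par P b = i <;> simp [h]
  map_smul' := by
    intro c M
    ext a b
    by_cases h : par P a + par P b = i <;> simp [h]

instance instGradedEnd : GradedAlgebra (endGrading P) :=
  gradedOfProj (endGrading P)
    (by
      intro a b h
      refine Matrix.one_apply_ne ?_
      rintro rfl
      apply h
      generalize par P a = x
      revert x
      decide)
    (by
      intro i j M N hM hN a b h
      rw [Matrix.mul_apply]
      refine Finset.sum_eq_zero fun c _ => ?_
      by_cases h1 : par P a + par P c = i
      · by_cases h2 : par P c + par P b = j
        · exfalso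
          apply h
          rw [← h1, ← h2]
          generalize par P a = x, par P b = y, par P c = z
          revert x y z
          decide
        · rw [hN c b h2, mul_zero]
      · rw [hM a c h1, zero_mul])
    (endProj P)
    (by
      intro i M a b h
      simp [endProj, h])
    (by
      intro M
      ext a b
      have h : ∀ x : ZMod 2, x = 0 ∨ x = 1 := by decide
      have h01 : (1 : ZMod 2) ≠ 0 := by decide
      rcases h (par P a + par P b) with h | h <;> simp [endProj, h])
    (by
      intro i M hM
      ext a b
      by_cases h : par P a + par P b = i
      · simp [endProj, h]
      · simp [endProj, h, hM a b h])
    (by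
      intro i j M hM hij
      ext a b
      by_cases h : par P a + par P b = j
      · have h' : par P a + par P b ≠ i := by rw [h]; exact hij
        simp [endProj, h, hM a b h']
      · simp [endProj, h])

/-- The parity of a generator: the Cartan elements are even. -/
def Gen.prt : Gen P → ZMod 2
  | Gen.e c => spar c
  | Gen.f c => spar c
  | Gen.K _ => 0

variable (P) in
/-- The automorphism `x ↦ (-1)^[x] x` of the free algebra. -/
def freeParity : FreeAlgebra ℂ (Gen P) →ₐ[ℂ] FreeAlgebra ℂ (Gen P) :=
  FreeAlgebra.lift ℂ fun g => sgn g.prt • FreeAlgebra.ι ℂ g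

theorem freeParity_e (c : Simple P) : freeParity P (fe c) = sgn (spar c) • fe c := by
  simp [freeParity, fe, Gen.prt]

theorem freeParity_f (c : Simple P) : freeParity P (ff c) = sgn (spar c) • ff c := by
  simp [freeParity, ff, Gen.prt]

theorem freeParity_K (x : Weight P) : freeParity P (fK x) = fK x := by
  simp [freeParity, fK, Gen.prt, sgn]

theorem freeParity_qBracket (r : ℂ) (X Y : HomElt P)
    (hX : freeParity P X.val = sgn X.prt • X.val) (hY : freeParity P Y.val = sgn Y.prt • Y.val) :
    freeParity P (qBracket r X Y).val = sgn (qBracket r X Y).prt • (qBracket r X Y).val := by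
  simp only [qBracket, map_sub, map_mul, map_smul, hX, hY, sgn_add, smul_sub, smul_mul_assoc,
    mul_smul_comm, smul_smul]
  congr 2 <;> ring

theorem freeParity_iterate (r : ℂ) (X Y : HomElt P) (hX : freeParity P X.val = sgn X.prt • X.val)
    (hY : freeParity P Y.val = sgn Y.prt • Y.val) (N : ℕ) :
    freeParity P ((qBracket r X)^[N] Y).val =
      sgn ((qBracket r X)^[N] Y).prt • ((qBracket r X)^[N] Y).val := by
  induction N with
  | zero => exact hY
  | succ N ih =>
    rw [Function.iterate_succ_apply']
    exact freeParity_qBracket r X _ hX ih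

theorem mk_eq_of_rel {r : ℂ} {x y : FreeAlgebra ℂ (Gen P)} (h : Rel r x y) :
    RingQuot.mkAlgHom ℂ (Rel r) x = RingQuot.mkAlgHom ℂ (Rel r) y :=
  RingQuot.mkAlgHom_rel ℂ h

theorem mk_parity_rel {r : ℂ} {x y : FreeAlgebra ℂ (Gen P)} (h : Rel r x y) :
    RingQuot.mkAlgHom ℂ (Rel r) (freeParity P x) =
      RingQuot.mkAlgHom ℂ (Rel r) (freeParity P y) := by
  have key : ∀ (z : FreeAlgebra ℂ (Gen P)) (t : ℂ), freeParity P z = t • z → Rel r z 0 →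
      RingQuot.mkAlgHom ℂ (Rel r) (freeParity P z) =
        RingQuot.mkAlgHom ℂ (Rel r) (freeParity P 0) := by
    intro z t hz h0
    rw [hz, map_smul, mk_eq_of_rel h0, map_zero, map_zero, map_zero, smul_zero]
  have he : ∀ c : Simple P, freeParity P (eElt c).val = sgn (eElt c).prt • (eElt c).val :=
    freeParity_e
  have hf : ∀ c : Simple P, freeParity P (fElt c).val = sgn (fElt c).prt • (fElt c).val :=
    freeParity_f
  cases h with
  | K_zero => rw [freeParity_K, map_one, mk_eq_of_rel Rel.K_zero]
  | K_add x y => rw [map_mul, freeParity_K, freeParity_K, freeParity_K,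
      mk_eq_of_rel (Rel.K_add x y)]
  | K_e x c =>
    have h1 : freeParity P (fK x * fe c) = sgn (spar c) • (fK x * fe c) := by
      rw [map_mul, freeParity_K, freeParity_e, mul_smul_comm]
    have h2 : freeParity P (fe c * fK x) = sgn (spar c) • (fe c * fK x) := by
      rw [map_mul, freeParity_K, freeParity_e, smul_mul_assoc]
    rw [h1, map_smul, mk_eq_of_rel (Rel.K_e x c), ← map_smul, map_smul (freeParity P), h2,
      smul_comm]
  | K_f x c =>
    have h1 : freeParity P (fK x * ff c) = sgn (spar c) • (fK x * ff c) := by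
      rw [map_mul, freeParity_K, freeParity_f, mul_smul_comm]
    have h2 : freeParity P (ff c * fK x) = sgn (spar c) • (ff c * fK x) := by
      rw [map_mul, freeParity_K, freeParity_f, smul_mul_assoc]
    rw [h1, map_smul, mk_eq_of_rel (Rel.K_f x c), ← map_smul, map_smul (freeParity P), h2,
      smul_comm]
  | e_f_self c =>
    have h1 : freeParity P (fe c * ff c - sgn (spar c * spar c) • (ff c * fe c)) =
        fe c * ff c - sgn (spar c * spar c) • (ff c * fe c) := by
      simp only [map_sub, map_mul, map_smul, freeParity_e, freeParity_f, smul_mul_assoc,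
        mul_smul_comm, smul_smul, sgn_mul_self, one_smul]
    rw [h1, map_smul (freeParity P), map_sub (freeParity P), freeParity_K, freeParity_K,
      mk_eq_of_rel (Rel.e_f_self c)]
  | e_f_ne b c hne =>
    refine key _ (sgn (spar b) * sgn (spar c)) ?_ (Rel.e_f_ne b c hne)
    simp only [map_sub, map_mul, map_smul, freeParity_e, freeParity_f, smul_mul_assoc,
      mul_smul_comm, smul_smul, smul_sub]
    congr 2 <;> ring
  | e_sq c hc =>
    refine key _ (sgn (spar c) * sgn (spar c)) ?_ (Rel.e_sq c hc)
    simp only [map_mul, freeParity_e, smul_mul_assoc, mul_smul_comm, smul_smul]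
  | f_sq c hc =>
    refine key _ (sgn (spar c) * sgn (spar c)) ?_ (Rel.f_sq c hc)
    simp only [map_mul, freeParity_f, smul_mul_assoc, mul_smul_comm, smul_smul]
  | serre_e b c hbc =>
    exact key _ _ (freeParity_iterate r _ _ (he b) (he c) _) (Rel.serre_e b c hbc)
  | serre_f b c hbc =>
    exact key _ _ (freeParity_iterate r⁻¹ _ _ (hf b) (hf c) _) (Rel.serre_f b c hbc)
  | extra_e b c hb hc =>
    exact key _ _ (freeParity_qBracket r _ _ (he _) (freeParity_qBracket r _ _ (he _)
      (freeParity_qBracket r _ _ (he _) (he _)))) (Rel.extra_e b c hb hc)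
  | extra_f b c hb hc =>
    exact key _ _ (freeParity_qBracket r⁻¹ _ _ (hf _) (freeParity_qBracket r⁻¹ _ _ (hf _)
      (freeParity_qBracket r⁻¹ _ _ (hf _) (hf _)))) (Rel.extra_f b c hb hc)

variable (P) in
/-- The automorphism `x ↦ (-1)^[x] x` of `U_q[osp(m|n)]`. -/
def parity (r : ℂ) : Uq P r →ₐ[ℂ] Uq P r :=
  RingQuot.liftAlgHom ℂ
    ⟨(RingQuot.mkAlgHom ℂ (Rel r)).comp (freeParity P), fun _ _ h => mk_parity_rel h⟩

theorem parity_mk (r : ℂ) (x : FreeAlgebra ℂ (Gen P)) :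
    parity P r (RingQuot.mkAlgHom ℂ (Rel r) x) =
      RingQuot.mkAlgHom ℂ (Rel r) (freeParity P x) :=
  RingQuot.liftAlgHom_mkAlgHom_apply ℂ _ _ x

theorem parity_parity (r : ℂ) (x : Uq P r) : parity P r (parity P r x) = x := by
  have h : (freeParity P).comp (freeParity P) = AlgHom.id ℂ _ := by
    ext g
    simp [freeParity, smul_smul, sgn_mul_self]
  obtain ⟨y, rfl⟩ := RingQuot.mkAlgHom_surjective ℂ (Rel r) x
  rw [parity_mk, parity_mk]
  exact congrArg _ (DFunLike.congr_fun h y)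

variable (P) in
/-- The grading of `U_q[osp(m|n)]`: the part of parity `i` is the eigenspace of the
automorphism `parity` for the eigenvalue `(-1)^i`. -/
def uqGrading (r : ℂ) (i : ZMod 2) : Submodule ℂ (Uq P r) where
  carrier := {x | parity P r x = sgn i • x}
  add_mem' := by
    intro x y hx hy
    simp only [Set.mem_ofPred_eq] at hx hy ⊢
    rw [map_add, hx, hy, smul_add]
  zero_mem' := by simp
  smul_mem' := by
    intro c x hx
    simp only [Set.mem_ofPred_eq] at hx ⊢
    rw [map_smul, hx, smul_comm]

variable (P) in
/-- The projection of `U_q[osp(m|n)]` to its part of parity `i`. -/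
def uqProj (r : ℂ) (i : ZMod 2) : Uq P r →ₗ[ℂ] Uq P r :=
  (2⁻¹ : ℂ) • (LinearMap.id + sgn i • (parity P r).toLinearMap)

theorem uqProj_apply (r : ℂ) (i : ZMod 2) (x : Uq P r) :
    uqProj P r i x = (2⁻¹ : ℂ) • (x + sgn i • parity P r x) := rfl

instance instGradedUq (r : ℂ) : GradedAlgebra (uqGrading P r) :=
  gradedOfProj (uqGrading P r)
    (by
      change parity P r 1 = sgn 0 • 1
      simp [sgn])
    (by
      intro i j x y hx hy
      change parity P r (x * y) = sgn (i + j) • (x * y)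
      have hx' : parity P r x = sgn i • x := hx
      have hy' : parity P r y = sgn j • y := hy
      rw [map_mul, hx', hy', smul_mul_smul_comm, sgn_add])
    (uqProj P r)
    (by
      intro i x
      change parity P r (uqProj P r i x) = sgn i • uqProj P r i x
      rw [uqProj_apply, map_smul, map_add, map_smul, parity_parity, smul_comm (sgn i),
        smul_add (sgn i), smul_smul (sgn i), sgn_mul_self, one_smul, add_comm])
    (by
      intro x
      rw [uqProj_apply, uqProj_apply, ← smul_add]
      have h0 : sgn 0 = 1 := by simp [sgn]
      have h1 : sgn 1 = -1 := by simp [sgn]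
      rw [h0, h1]
      module)
    (by
      intro i x hx
      have hx' : parity P r x = sgn i • x := hx
      rw [uqProj_apply, hx', smul_smul, sgn_mul_self]
      module)
    (by
      intro i j x hx hij
      have hx' : parity P r x = sgn i • x := hx
      have h : sgn j * sgn i = -1 := by
        have h2 : j + i = 1 := (by decide : ∀ i j : ZMod 2, j ≠ i → j + i = 1) i j hij
        rw [← sgn_add, h2]
        simp [sgn]
      rw [uqProj_apply, hx', smul_smul, h]
      module)

variable (P) in
/-- The graded tensor product `(End V) ⊗ U_q[osp(m|n)]`, with
`(a ⊗ b)(c ⊗ d) = (-1)^([b][c]) ac ⊗ bd`. -/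
abbrev LaxAlg (r : ℂ) : Type := endGrading P ᵍ⊗[ℂ] uqGrading P r

/-! ### The vector representation, the coproduct and the ansatz -/

/-- The elementary matrix `E^a_b`. -/
def elem (a b : Idx P) : EndV P := Matrix.single a b 1

/-- The image of the Cartan-Weyl generator `σ^a_b` in the vector representation. -/
def cartanWeyl (a b : Idx P) : EndV P :=
  elem a b - (sgn (par P a * (par P a + par P b)) * xi P a * xi P b) • elem (bar P b) (bar P a)

/-- The matrix `π(e_c)`. -/
def piE (c : Simple P) : EndV P := cartanWeyl (row c) (col c)

/-- The matrix `π(q^(h_x / 2))`: `h_x` acts on the basis vector `|a⟩` by `(x, ε_a)`. -/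
def piK (r : ℂ) (x : Weight P) : EndV P := Matrix.diagonal fun a => r ^ form P x (wt P a)

variable (r : ℂ)

/-- The coproduct `Δ(e_c) = q^(h_c/2) ⊗ e_c + e_c ⊗ q^(-h_c/2)`, with the vector representation
applied to the first tensor factor. -/
def deltaE (c : Simple P) : LaxAlg P r :=
  piK r (root c) ᵍ⊗ₜ[ℂ] ue r c + piE c ᵍ⊗ₜ[ℂ] uK r (-root c)

/-- The opposite coproduct `Δ^T(e_c) = e_c ⊗ q^(h_c/2) + q^(-h_c/2) ⊗ e_c`, with the vector
representation applied to the first tensor factor (the Cartan elements are even, so that the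
graded twist map introduces no sign). -/
def deltaTE (c : Simple P) : LaxAlg P r :=
  piE c ᵍ⊗ₜ[ℂ] uK r (root c) + piK r (-root c) ᵍ⊗ₜ[ℂ] ue r c

variable (P) in
/-- The operator `q^(∑ h_b ⊗ h^b)`. Here `b` runs over the basis `ε_i`, `δ_μ`, `h_b = h_(ε_b)` and
`h^b = (-1)^[b] h_(ε_b)`; as `h_b` acts on the basis vector `|a⟩` by the scalar `(ε_a, ε_b)`, the
operator acts on `|a⟩` as `q^h` with `h = ∑_b (ε_a, ε_b) h^b`. -/
def cartanFactor : LaxAlg P r :=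
  ∑ a : Idx P, elem a a ᵍ⊗ₜ[ℂ]
    uK r (2 • ∑ b, (form P (wt P a) (eps P b) * (if epsPar P b = 0 then 1 else -1)) • eps P b)

/-- The ansatz
`q^(∑ h_b ⊗ h^b) [I ⊗ I + (q - q⁻¹) ∑_{ε_a < ε_b} (-1)^[b] E^a_b ⊗ σ̂_ba]`; the entry
`σ̂_ba` is `σ b a`, and the values `σ b a` with `ε_a ≥ ε_b` are not used. -/
def lax (σ : Idx P → Idx P → Uq P r) : LaxAlg P r :=
  cartanFactor P r * (1 + (r ^ 2 - (r ^ 2)⁻¹) • ∑ a : Idx P, ∑ b : Idx P,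
    if WtLT P a b then sgn (par P b) • (elem a b ᵍ⊗ₜ[ℂ] σ b a) else 0)

variable (P) in
/-- The subspace `(End V) ⊗ U_q[osp(m|n)]^+`. -/
def endTensorUplus : Submodule ℂ (LaxAlg P r) :=
  Submodule.span ℂ {x | ∃ (M : EndV P) (u : Uq P r), u ∈ Uplus P r ∧ x = M ᵍ⊗ₜ[ℂ] u}

variable {r}

/-- The intertwining property `R Δ(e_c) = Δ^T(e_c) R` for all raising generators. -/
def Intertwines (R : LaxAlg P r) : Prop :=
  ∀ c : Simple P, R * deltaE r c = deltaTE r c * R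

variable (r) in
/-- The element `e_c q^(h_c / 2)`. -/
def eK (c : Simple P) : Uq P r := ue r c * uK r (root c)

/-- The fundamental values. If `e_c = σ^a_b` then these are the values of `σ̂_ab` and of
`σ̂_{b̄ ā}`, and, for `m = 2l`, of `σ̂_{l l̄}`. -/
structure FundamentalValues (σ : Idx P → Idx P → Uq P r) : Prop where
  /-- `σ̂_{i,i+1} = -σ̂_{\bar{i+1} \bar i} = q^(1/2) e_i q^(h_i/2)`, `1 ≤ i < l`. -/
  even (i : Fin (P.l - 1)) :
    σ (row (Simple.even i)) (col (Simple.even i)) = r • eK r (Simple.even i) ∧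
    -σ (bar P (col (Simple.even i))) (bar P (row (Simple.even i))) = r • eK r (Simple.even i)
  /-- `σ̂_{l-1, \bar l} = -σ̂_{l, \bar{l-1}} = q^(1/2) e_l q^(h_l/2)`, `m = 2l`. -/
  last_of_even (hm : Even P.m) :
    σ (row Simple.last) (col Simple.last) = r • eK r Simple.last ∧
    -σ (bar P (col Simple.last)) (bar P (row Simple.last)) = r • eK r Simple.last
  /-- `σ̂_{l, \bar l} = 0`, `m = 2l`. -/
  zero_of_even (hm : Even P.m) :
    σ (ev P (P.l - 1) (lt_m_of_le (by omega)))
      (bar P (ev P (P.l - 1) (lt_m_of_le (by omega)))) = 0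
  /-- `σ̂_{l, l+1} = -q^(-1/2) σ̂_{l+1, \bar l} = e_l q^(h_l/2)`, `m = 2l + 1`. -/
  last_of_odd (hm : ¬ Even P.m) :
    σ (row Simple.last) (col Simple.last) = eK r Simple.last ∧
    -(r⁻¹ • σ (bar P (col Simple.last)) (bar P (row Simple.last))) = eK r Simple.last
  /-- `σ̂_{μ,μ+1} = σ̂_{\bar{μ+1} \bar μ} = q^(-1/2) e_μ q^(h_μ/2)`, `1 ≤ μ < k`. -/
  odd (j : Fin (P.k - 1)) :
    σ (row (Simple.odd j)) (col (Simple.odd j)) = r⁻¹ • eK r (Simple.odd j) ∧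
    σ (bar P (col (Simple.odd j))) (bar P (row (Simple.odd j))) = r⁻¹ • eK r (Simple.odd j)
  /-- `σ̂_{μ=k, i=1} = (-1)^k q σ̂_{\bar{i=1} \bar{μ=k}} = q^(1/2) e_s q^(h_s/2)`. -/
  s :
    σ (row Simple.s) (col Simple.s) = r • eK r Simple.s ∧
    ((-1) ^ P.k * r ^ 2) • σ (bar P (col Simple.s)) (bar P (row Simple.s)) = r • eK r Simple.s

/-- The `q`-commutation relations. -/
def QCommutation (σ : Idx P → Idx P → Uq P r) : Prop :=
  ∀ (c : Simple P) (a b : Idx P), WtLT P a b →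
    (∀ x, wt P a - root c ≠ wt P x) → (∀ x, wt P b + root c ≠ wt P x) →
    (r ^ 2) ^ form P (root c) (wt P b) • (σ b a * eK r c) -
      (sgn ((par P a + par P b) * spar c) * (r ^ 2) ^ (-form P (root c) (wt P a))) •
        (eK r c * σ b a) = 0

/-- The induction relations. -/
def Induction (σ : Idx P → Idx P → Uq P r) : Prop :=
  ∀ a b c : Idx P, WtLT P c b → WtLT P a c → c ≠ bar P b → c ≠ bar P a →
    σ b a = (r ^ 2) ^ (-form P (wt P b) (wt P a)) • (σ b c * σ c a) -
      ((r ^ 2) ^ (-form P (wt P c) (wt P c)) *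
        sgn ((par P b + par P c) * (par P a + par P c))) • (σ c a * σ b c)

end Osp

end

/-! Write R as the diagonal Cartan factor times a matrix t over U that is 1 on the diagonal and
vanishes unless the row weight is at most the column weight. After the Cartan factor is removed, the
equation for e_c says how t behaves column by column. Columns carry a twisted adjoint action of e_c
(`adOp`): left multiplication, plus the action of the vector representation, minus twisted right
multiplication. The intertwining property says that this action permutes the columns of t up to
scalars, along the edges of the crystal graph of V. So t amounts to a copy of the (rescaled) vector
representation inside the space of columns.

Uniqueness: triangularity forces the lowest weight column to be a unit vector, and each edge of the
graph expresses a column through a lower one (`Intertwines.unique`).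

Existence: the unit vector has to generate a copy of V. The three parts of `adOp` each satisfy the
q-Serre relations and q-commute with one another, so their sum satisfies them too
(`SerreFamily.add`, `adOp_serre`); this is the mechanism that makes the coproduct compatible with
the Serre relations. The unit vector is killed by every generator except the first and satisfies one
short relation for that one (`isLowest_adOp`). From this the Serre relations alone imply, by walking
up the crystal graph, that every generator without an outgoing edge kills the vector reached
(`SerreFamily.chain_odd`, `SerreFamily.chain_even`). With q = r ^ 2, the hypothesis on q enters
through q + q⁻¹, q + 1 + q⁻¹ and q - q⁻¹ being nonzero.

Relations: an off-diagonal entry of the equation, divided by q - q⁻¹, is a commutation rule for an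
entry with e_c (`IsLaxMatrix.star`). If label c has neither an edge into a nor an edge out of b,
this rule is (i). Diagonal entries of the equation give the entries along the edges, hence the
fundamental values (`IsLaxMatrix.edge`). With exactly one such edge the rule is (ii) for a c joined
by an edge to b or to a. The general case of (ii) follows by induction on the distance from a to b:
a q-Jacobi identity moves an end of the interval along an edge (`IsLaxMatrix.induction_up`,
`IsLaxMatrix.induction_down`), and a separate identity handles the fold, where the moved end meets
the opposite of the other end (`IsLaxMatrix.induction_fold_up`, `IsLaxMatrix.induction_fold_down`).

Determination: unless (b, a) is an edge or, for m even, the middle pair, there is an admissible c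
strictly between b and a, so (ii) reduces each entry to shorter ones and finally to fundamental
values.

Indices, edges and nodes are encoded by natural numbers (`pos`, `node`), so the case distinctions
become linear arithmetic. -/

noncomputable section

namespace Osp

/-! ### Positions of the indices, nodes of the Dynkin diagram -/

section Positions

variable {P : Params}

/-- The number of a simple root in the Dynkin diagram, read from the odd end. -/
def node : Simple P → ℕ
  | Simple.even i => P.k + i.val
  | Simple.last => P.k + P.l - 1
  | Simple.odd j => j.val
  | Simple.s => P.k - 1

theorem m_eq : P.m = 2 * P.l + P.m % 2 := by
  have : P.l = P.m / 2 := rfl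
  omega

theorem one_le_l : 1 ≤ P.l := by
  have := P.two_lt_m
  have : P.l = P.m / 2 := rfl
  omega

theorem two_le_l (h : P.m % 2 = 0) : 2 ≤ P.l := by
  have := P.two_lt_m
  have : P.l = P.m / 2 := rfl
  omega

theorem pos_lt (a : Idx P) : pos P a < P.m + 2 * P.k := by
  rcases a with i | j
  · have := i.isLt
    simp only [pos]; omega
  · have : j.val < 2 * P.k := j.isLt
    simp only [pos]; split_ifs <;> omega

theorem pos_inj {a b : Idx P} : pos P a = pos P b ↔ a = b := by
  refine ⟨fun h => ?_, fun h => h ▸ rfl⟩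
  rcases a with i | i <;> rcases b with j | j <;> simp only [pos] at h
  · congr 1; ext; omega
  · have := i.isLt
    exfalso; split_ifs at h <;> omega
  · have := j.isLt
    exfalso; split_ifs at h <;> omega
  · congr 1; ext; split_ifs at h <;> omega

theorem exists_pos {p : ℕ} (h : p < P.m + 2 * P.k) : ∃ a : Idx P, pos P a = p := by
  by_cases h1 : p < P.k
  · exact ⟨Sum.inr ⟨p, by change p < 2 * P.k; omega⟩, by simp [pos, h1]⟩
  · by_cases h2 : p < P.k + P.m
    · exact ⟨Sum.inl ⟨p - P.k, by omega⟩, by simp only [pos]; omega⟩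
    · refine ⟨Sum.inr ⟨p - P.m, by change _ < 2 * P.k; omega⟩, ?_⟩
      simp only [pos]
      rw [if_neg (by omega)]; omega

theorem pos_bar (a : Idx P) : pos P (bar P a) + pos P a + 1 = P.m + 2 * P.k := by
  rcases a with i | j
  · have := i.isLt
    simp only [pos, bar, Fin.val_rev]; omega
  · have : j.val < 2 * P.k := j.isLt
    have h : j.rev.val = 2 * P.k - (j.val + 1) := Fin.val_rev j
    simp only [pos, bar, h]; split_ifs <;> omega

theorem par_eq (a : Idx P) : par P a = if P.k ≤ pos P a ∧ pos P a < P.k + P.m then 0 else 1 := by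
  rcases a with i | j
  · have := i.isLt
    simp [par, pos]
  · have : j.val < 2 * P.k := j.isLt
    have h : ¬(P.k ≤ pos P (Sum.inr j) ∧ pos P (Sum.inr j) < P.k + P.m) := by
      simp only [pos]; split_ifs <;> omega
    simp only [par, if_neg h]

theorem bar_bar (a : Idx P) : bar P (bar P a) = a := by
  have h1 := pos_bar a
  have h2 := pos_bar (bar P a)
  exact pos_inj.1 (by omega)

theorem eq_bar_iff {a b : Idx P} : a = bar P b ↔ pos P a + pos P b + 1 = P.m + 2 * P.k := by
  have := pos_bar b
  rw [← pos_inj]; omega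

theorem par_bar (a : Idx P) : par P (bar P a) = par P a := by
  rcases a with i | j <;> rfl

theorem wt_bar (a : Idx P) : wt P (bar P a) = -wt P a := by
  have hm := m_eq (P := P)
  have hm2 : P.m % 2 < 2 := Nat.mod_lt _ (by norm_num)
  rcases a with i | j
  · have := i.isLt
    have h : i.rev.val = P.m - (i.val + 1) := Fin.val_rev i
    simp only [bar, wt, Fin.rev_rev]
    by_cases h1 : i.val < P.l
    · rw [dif_neg (by omega), dif_pos h1, dif_pos h1]
    · by_cases h2 : i.rev.val < P.l
      · rw [dif_pos h2, dif_neg h1, dif_pos h2, neg_neg]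
      · rw [dif_neg h2, dif_neg h1, dif_neg h1, dif_neg h2, neg_zero]
  · have : j.val < 2 * P.k := j.isLt
    have h : j.rev.val = 2 * P.k - (j.val + 1) := Fin.val_rev j
    simp only [bar, wt, Fin.rev_rev]
    by_cases h1 : j.val < P.k
    · rw [dif_neg (by omega), dif_pos h1]
    · rw [dif_pos (by omega), dif_neg h1, neg_neg]

/-! ### The bilinear form on the weights -/

theorem form_add_left (x y z : Weight P) : form P (x + y) z = form P x z + form P y z := by
  simp only [form, Pi.add_apply, add_mul, Finset.sum_add_distrib]; ring

theorem form_comm (x y : Weight P) : form P x y = form P y x := by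
  simp only [form, mul_comm]

theorem form_add_right (x y z : Weight P) : form P x (y + z) = form P x y + form P x z := by
  rw [form_comm, form_add_left, form_comm y, form_comm z]

theorem form_neg_left (x y : Weight P) : form P (-x) y = -form P x y := by
  simp only [form, Pi.neg_apply, neg_mul, Finset.sum_neg_distrib]; ring

theorem form_neg_right (x y : Weight P) : form P x (-y) = -form P x y := by
  rw [form_comm, form_neg_left, form_comm]

theorem form_sub_left (x y z : Weight P) : form P (x - y) z = form P x z - form P y z := by
  rw [sub_eq_add_neg, form_add_left, form_neg_left]; ring

theorem form_sub_right (x y z : Weight P) : form P x (y - z) = form P x y - form P x z := by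
  rw [sub_eq_add_neg, form_add_right, form_neg_right]; ring

theorem form_zero_left (x : Weight P) : form P 0 x = 0 := by simp [form]

theorem form_zero_right (x : Weight P) : form P x 0 = 0 := by simp [form]

/-- The integer sign `(-1)^[a]`. -/
def isgn (x : ZMod 2) : ℤ := if x = 0 then 1 else -1

theorem form_eps_left (x : Fin P.l ⊕ Fin P.k) (y : Weight P) :
    form P (eps P x) y = isgn (epsPar P x) * y x := by
  rcases x with i | j <;> simp [form, eps, epsPar, isgn, Pi.single_apply]

theorem form_eps_eps (x y : Fin P.l ⊕ Fin P.k) :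
    form P (eps P x) (eps P y) = if x = y then isgn (epsPar P x) else 0 := by
  rw [form_eps_left]
  simp [eps, Pi.single_apply]

/-- Every weight is a signed basis vector or zero, according to the position. -/
theorem wt_cases (a : Idx P) :
    (∃ x, wt P a = eps P x ∧ epsPar P x = par P a ∧
      pos P a = Sum.elim (fun i => P.k + i.val) (fun j => j.val) x) ∨
    (∃ x, wt P a = -eps P x ∧ epsPar P x = par P a ∧
      pos P a + Sum.elim (fun i => P.k + i.val) (fun j => j.val) x + 1 = P.m + 2 * P.k) ∨
    (wt P a = 0 ∧ par P a = 0 ∧ P.m % 2 = 1 ∧ pos P a = P.k + P.l) := by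
  have hm := m_eq (P := P)
  have hm2 : P.m % 2 < 2 := Nat.mod_lt _ (by norm_num)
  rcases a with i | j
  · have := i.isLt
    have h : i.rev.val = P.m - (i.val + 1) := Fin.val_rev i
    by_cases h1 : i.val < P.l
    · left
      exact ⟨Sum.inl ⟨i.val, h1⟩, by simp [wt, h1], rfl, by simp [pos]⟩
    · right
      by_cases h2 : i.rev.val < P.l
      · left
        refine ⟨Sum.inl ⟨i.rev.val, h2⟩, by simp only [wt]; rw [dif_neg h1, dif_pos h2], rfl, ?_⟩
        simp only [pos, Sum.elim_inl]; omega
      · right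
        refine ⟨by simp only [wt]; rw [dif_neg h1, dif_neg h2], rfl, by omega, ?_⟩
        simp only [pos]; omega
  · have : j.val < 2 * P.k := j.isLt
    have h : j.rev.val = 2 * P.k - (j.val + 1) := Fin.val_rev j
    by_cases h1 : j.val < P.k
    · left
      exact ⟨Sum.inr ⟨j.val, h1⟩, by simp [wt, h1], rfl, by simp [pos, h1]⟩
    · right; left
      refine ⟨Sum.inr ⟨j.rev.val, by omega⟩, by simp only [wt]; rw [dif_neg h1], rfl, ?_⟩
      simp only [pos, Sum.elim_inr, if_neg h1]; omega

/-- Weights of distinct, non-opposite indices are orthogonal. For the zero weight (m odd) the index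
equals its own opposite and the two indicator terms cancel. -/
theorem form_wt_wt (a b : Idx P) :
    form P (wt P a) (wt P b) =
      isgn (par P a) * ((if a = b then 1 else 0) - (if a = bar P b then 1 else 0)) := by
  have hm := m_eq (P := P)
  have hb := pos_bar b
  have key : ∀ x y : Fin P.l ⊕ Fin P.k, x = y ↔
      Sum.elim (fun i => P.k + i.val) (fun j => j.val) x =
      Sum.elim (fun i => P.k + i.val) (fun j => j.val) y := by
    intro x y
    rcases x with x | x <;> rcases y with y | y <;> simp [Fin.ext_iff] <;> omega
  have bd : ∀ x : Fin P.l ⊕ Fin P.k,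
      Sum.elim (fun i => P.k + i.val) (fun j => j.val) x < P.k + P.l := by
    intro x
    rcases x with x | x <;> simp <;> omega
  simp only [← pos_inj (a := a)]
  rcases wt_cases a with ⟨x, hx, hxp, hxx⟩ | ⟨x, hx, hxp, hxx⟩ | ⟨hx, hxp, hodd, hxx⟩ <;>
  rcases wt_cases b with ⟨y, hy, hyp, hyy⟩ | ⟨y, hy, hyp, hyy⟩ | ⟨hy, hyp, hodd', hyy⟩ <;>
  simp only [hx, hy, form_neg_left, form_neg_right, form_eps_eps, key, hxp, form_zero_left,
    form_zero_right]
  · have := bd x; have := bd y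
    split_ifs <;> first | (exfalso; omega) | simp
  · have := bd x; have := bd y
    split_ifs <;> first | (exfalso; omega) | simp
  · have := bd x
    split_ifs <;> first | (exfalso; omega) | simp
  · have := bd x; have := bd y
    split_ifs <;> first | (exfalso; omega) | simp
  · have := bd x; have := bd y
    split_ifs <;> first | (exfalso; omega) | simp
  · have := bd x
    split_ifs <;> first | (exfalso; omega) | simp
  · have := bd y
    split_ifs <;> first | (exfalso; omega) | simp
  · have := bd y
    split_ifs <;> first | (exfalso; omega) | simp
  · split_ifs <;> first | (exfalso; omega) | simp

/-! ### Simple roots -/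

theorem node_lt (c : Simple P) : node c < P.k + P.l := by
  have := one_le_l (P := P)
  have := P.k_pos
  cases c with
  | even i => have := i.isLt; simp only [node]; omega
  | last => simp only [node]; omega
  | odd j => have := j.isLt; simp only [node]; omega
  | s => simp only [node]; omega

theorem node_inj {b c : Simple P} (h : node b = node c) : b = c := by
  have := one_le_l (P := P)
  have := P.k_pos
  cases b <;> cases c <;> simp only [node] at h <;> first
    | rfl
    | (congr 1; ext; omega)
    | (exfalso; rename_i x y; have := x.isLt; have := y.isLt; omega)
    | (exfalso; rename_i x; have := x.isLt; omega)
    | (exfalso; omega)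

theorem exists_node {p : ℕ} (h : p < P.k + P.l) : ∃ c : Simple P, node c = p := by
  have := one_le_l (P := P)
  have := P.k_pos
  by_cases h1 : p < P.k - 1
  · exact ⟨Simple.odd ⟨p, h1⟩, rfl⟩
  · by_cases h2 : p = P.k - 1
    · exact ⟨Simple.s, h2.symm⟩
    · by_cases h3 : p < P.k + P.l - 1
      · exact ⟨Simple.even ⟨p - P.k, by omega⟩, by simp only [node]; omega⟩
      · exact ⟨Simple.last, by simp only [node]; omega⟩

/-- The positions of `row c` and `col c`. -/
theorem pos_row_col (c : Simple P) :
    (pos P (row c) = node c ∧ pos P (col c) = node c + 1 ∧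
      (P.m % 2 = 0 → node c + 1 < P.k + P.l)) ∨
    (P.m % 2 = 0 ∧ c = Simple.last ∧ pos P (row c) + 2 = P.k + P.l ∧ pos P (col c) = P.k + P.l) := by
  have hl := one_le_l (P := P)
  have hk := P.k_pos
  have hm := m_eq (P := P)
  cases c with
  | even i =>
    have := i.isLt
    left
    simp only [row, col, ev, pos, node]
    refine ⟨trivial, by omega, fun _ => by omega⟩
  | last =>
    rcases Nat.mod_two_eq_zero_or_one P.m with h | h
    · right
      have := two_le_l h
      have he : Even P.m := Nat.even_iff.2 h
      have hb := pos_bar (ev P (P.l - 1) (lt_m_of_le (by omega)))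
      refine ⟨h, rfl, ?_, ?_⟩
      · simp only [row, if_pos he, ev, pos]; omega
      · simp only [col, if_pos he]
        simp only [ev, pos] at hb ⊢
        omega
    · left
      have he : ¬ Even P.m := by rw [Nat.even_iff]; omega
      simp only [row, col, if_neg he, ev, pos, node]
      omega
  | odd j =>
    have := j.isLt
    left
    simp only [row, col, od, pos, node]
    rw [if_pos (by omega), if_pos (by omega)]
    omega
  | s =>
    left
    simp only [row, col, ev, od, pos, node]
    rw [if_pos (by omega)]
    omega

theorem node_last : node (Simple.last : Simple P) + 1 = P.k + P.l := by
  have := P.k_pos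
  simp only [node]; omega

theorem node_s : node (Simple.s : Simple P) + 1 = P.k := by
  have := P.k_pos
  simp only [node]; omega

end Positions

/-! ### The crystal graph of the vector representation -/

section Arrows

variable {P : Params}

/-- `Arr c d b`: the generator `e_c` maps the basis vector `|d⟩` to a nonzero multiple of `|b⟩`. -/
def Arr (c : Simple P) (d b : Idx P) : Prop :=
  (b = row c ∧ d = col c) ∨ (b = bar P (col c) ∧ d = bar P (row c))

/-- This turns the crystal graph into linear arithmetic. For m odd it is a chain through consecutive
positions. For m even the middle edge is missing: with K = k + l, the positions K + 1, K, K - 1, K -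
2 form a diamond whose edges labelled by the last root skip one position. -/
theorem arr_iff (c : Simple P) (d b : Idx P) : Arr c d b ↔
    (pos P d = pos P b + 1 ∧ (pos P b = node c ∨ pos P b + node c + 2 = P.m + 2 * P.k) ∧
      (P.m % 2 = 0 → node c + 1 < P.k + P.l)) ∨
    (P.m % 2 = 0 ∧ node c + 1 = P.k + P.l ∧
      ((pos P d = P.k + P.l ∧ pos P b + 2 = P.k + P.l) ∨
       (pos P d = P.k + P.l + 1 ∧ pos P b + 1 = P.k + P.l))) := by
  have h1 := pos_bar (row c)
  have h2 := pos_bar (col c)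
  have hm := m_eq (P := P)
  have hl := node_last (P := P)
  simp only [Arr, ← pos_inj]
  rcases pos_row_col c with h | ⟨h, rfl, h'⟩
  · omega
  · omega

theorem Arr.bar {c : Simple P} {d b : Idx P} (h : Arr c d b) : Arr c (bar P b) (bar P d) := by
  rcases h with ⟨rfl, rfl⟩ | ⟨rfl, rfl⟩
  · exact Or.inr ⟨rfl, rfl⟩
  · exact Or.inl ⟨bar_bar _, bar_bar _⟩

theorem Arr.pos_lt {c : Simple P} {d b : Idx P} (h : Arr c d b) : pos P b < pos P d := by
  rw [arr_iff] at h; omega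

theorem Arr.target_unique {c : Simple P} {d b b' : Idx P} (h : Arr c d b) (h' : Arr c d b') :
    b = b' := by
  have hm := m_eq (P := P)
  rw [← pos_inj]
  rw [arr_iff] at h h'; omega

theorem Arr.source_unique {c : Simple P} {d d' b : Idx P} (h : Arr c d b) (h' : Arr c d' b) :
    d = d' := by
  have hm := m_eq (P := P)
  rw [← pos_inj]
  rw [arr_iff] at h h'; omega

/-- In particular the two elementary matrices in π(e_c) never sit at the same place, so no
coefficient cancels. -/
theorem Arr.ne_bar {c : Simple P} {d b : Idx P} (h : Arr c d b) : b ≠ Osp.bar P d := by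
  have hm := m_eq (P := P)
  rw [Ne, eq_bar_iff]
  rw [arr_iff] at h; omega

theorem Arr.ne {c : Simple P} {d b : Idx P} (h : Arr c d b) : b ≠ d := by
  rintro rfl
  exact lt_irrefl _ h.pos_lt

/-- Every index can thus be reached from the lowest weight index by going up the graph, which drives
all recursions over columns. -/
theorem exists_arr_into {b : Idx P} (h : pos P b + 1 < P.m + 2 * P.k) :
    ∃ c d, Arr c d b := by
  have hm := m_eq (P := P)
  have hl := one_le_l (P := P)
  have hk := P.k_pos
  by_cases h1 : P.m % 2 = 0 ∧ pos P b + 1 = P.k + P.l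
  · obtain ⟨c, hc⟩ := exists_node (P := P) (p := P.k + P.l - 1) (by omega)
    obtain ⟨d, hd⟩ := exists_pos (P := P) (p := P.k + P.l + 1) (by omega)
    exact ⟨c, d, by rw [arr_iff]; omega⟩
  · obtain ⟨d, hd⟩ := exists_pos (P := P) h
    by_cases h2 : pos P b < P.k + P.l
    · obtain ⟨c, hc⟩ := exists_node (P := P) h2
      exact ⟨c, d, by rw [arr_iff]; omega⟩
    · obtain ⟨c, hc⟩ := exists_node (P := P) (p := P.m + 2 * P.k - 2 - pos P b) (by omega)
      exact ⟨c, d, by rw [arr_iff]; omega⟩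

theorem Arr.wt_eq {c : Simple P} {d b : Idx P} (h : Arr c d b) :
    wt P b = wt P d + root c := by
  rcases h with ⟨rfl, rfl⟩ | ⟨rfl, rfl⟩
  · simp [root]
  · simp only [root, wt_bar]; abel

theorem Arr.par_add {c : Simple P} {d b : Idx P} (h : Arr c d b) :
    par P b + par P d = spar c := by
  rcases h with ⟨rfl, rfl⟩ | ⟨rfl, rfl⟩
  · rfl
  · rw [par_bar, par_bar, add_comm]; rfl

theorem Arr.par_eq {c : Simple P} {d b : Idx P} (h : Arr c d b) :
    spar c = par P b + par P d := h.par_add.symm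

theorem sgn_ne_zero (x : ZMod 2) : sgn x ≠ 0 := by
  unfold sgn; split_ifs <;> norm_num

theorem xi_ne_zero (a : Idx P) : xi P a ≠ 0 := by
  rcases a with i | j <;> simp [xi]

theorem piE_row_col (c : Simple P) : piE c (row c) (col c) = 1 := by
  have h : ¬ (bar P (col c) = row c ∧ bar P (row c) = col c) := by
    rintro ⟨h, -⟩
    exact Arr.ne_bar (c := c) (Or.inl ⟨rfl, rfl⟩) h.symm
  simp [piE, cartanWeyl, elem, h]

theorem piE_bar (c : Simple P) : piE c (bar P (col c)) (bar P (row c)) =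
    -(sgn (par P (row c) * (par P (row c) + par P (col c))) * xi P (row c) * xi P (col c)) := by
  have h : ¬ (row c = bar P (col c) ∧ col c = bar P (row c)) := by
    rintro ⟨h, -⟩
    exact Arr.ne_bar (c := c) (Or.inl ⟨rfl, rfl⟩) h
  simp [piE, cartanWeyl, elem, h]

theorem Arr.piE_ne_zero {c : Simple P} {d b : Idx P} (h : Arr c d b) : piE c b d ≠ 0 := by
  rcases h with ⟨rfl, rfl⟩ | ⟨rfl, rfl⟩
  · rw [piE_row_col]; exact one_ne_zero
  · rw [piE_bar]
    exact neg_ne_zero.2 (mul_ne_zero (mul_ne_zero (sgn_ne_zero _) (xi_ne_zero _)) (xi_ne_zero _))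

theorem piE_eq_zero {c : Simple P} {d b : Idx P} (h : ¬ Arr c d b) : piE c b d = 0 := by
  have h1 : ¬ (row c = b ∧ col c = d) := fun h' => h (Or.inl ⟨h'.1.symm, h'.2.symm⟩)
  have h2 : ¬ (bar P (col c) = b ∧ bar P (row c) = d) :=
    fun h' => h (Or.inr ⟨h'.1.symm, h'.2.symm⟩)
  simp [piE, cartanWeyl, elem, h1, h2]

/-- A label has at most one edge out of, and one into, a given index, so sums against π(e_c) have at
most one term. -/
theorem sum_piE_col {M : Type*} [AddCommGroup M] [Module ℂ M] {c : Simple P} {d b : Idx P}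
    (h : Arr c d b) (f : Idx P → M) : ∑ x, piE c x d • f x = piE c b d • f b :=
  Finset.sum_eq_single b (fun x _ hx => by
    rw [piE_eq_zero fun h' => hx (h'.target_unique h), zero_smul]) (by simp)

theorem sum_piE_row {M : Type*} [AddCommGroup M] [Module ℂ M] {c : Simple P} {d b : Idx P}
    (h : Arr c d b) (f : Idx P → M) : ∑ x, piE c b x • f x = piE c b d • f d :=
  Finset.sum_eq_single d (fun x _ hx => by
    rw [piE_eq_zero fun h' => hx (h'.source_unique h), zero_smul]) (by simp)

theorem sum_piE_col_zero {M : Type*} [AddCommGroup M] [Module ℂ M] {c : Simple P} {d : Idx P}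
    (h : ∀ b, ¬ Arr c d b) (f : Idx P → M) : ∑ x, piE c x d • f x = 0 :=
  Finset.sum_eq_zero fun x _ => by rw [piE_eq_zero (h x), zero_smul]

theorem sum_piE_row_zero {M : Type*} [AddCommGroup M] [Module ℂ M] {c : Simple P} {b : Idx P}
    (h : ∀ d, ¬ Arr c d b) (f : Idx P → M) : ∑ x, piE c b x • f x = 0 :=
  Finset.sum_eq_zero fun x _ => by rw [piE_eq_zero (h x), zero_smul]

/-! ### Scalar products of the simple roots -/

/-- The sign `(-1)^[a]` in terms of the position of `a`. -/
def posSign (P : Params) (p : ℕ) : ℤ := if P.k ≤ p ∧ p < P.k + P.m then 1 else -1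

theorem form_wt_pos (a b : Idx P) : form P (wt P a) (wt P b) = posSign P (pos P a) *
    ((if pos P a = pos P b then 1 else 0) -
      (if pos P a + pos P b + 1 = P.m + 2 * P.k then 1 else 0)) := by
  rw [form_wt_wt]
  simp only [pos_inj, eq_bar_iff, isgn, posSign, par_eq]
  congr 1
  split_ifs <;> simp_all

/-- Adjacency of nodes in the Dynkin diagram. -/
def Adj (b c : Simple P) : Prop :=
  (P.m % 2 = 1 ∧ (node b + 1 = node c ∨ node c + 1 = node b)) ∨
  (P.m % 2 = 0 ∧ ((node b + 1 = node c ∧ node c + 1 < P.k + P.l) ∨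
    (node c + 1 = node b ∧ node b + 1 < P.k + P.l) ∨
    (node b + 1 = P.k + P.l ∧ node c + 3 = P.k + P.l) ∨
    (node c + 1 = P.k + P.l ∧ node b + 3 = P.k + P.l)))

theorem form_root_root (b c : Simple P) : form P (root b) (root c) =
    form P (wt P (row b)) (wt P (row c)) - form P (wt P (row b)) (wt P (col c)) -
    form P (wt P (col b)) (wt P (row c)) + form P (wt P (col b)) (wt P (col c)) := by
  simp only [root, form_sub_left, form_sub_right]; ring

theorem spar_eq (c : Simple P) : spar c = if node c + 1 = P.k then 1 else 0 := by
  have hl := one_le_l (P := P)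
  have hk := P.k_pos
  have h11 : (1 : ZMod 2) + 1 = 0 := by decide
  cases c with
  | even i =>
    rw [if_neg (show ¬ (node (Simple.even i) + 1 = P.k) by simp only [node]; omega)]
    simp [spar, row, col, ev, par]
  | last =>
    rw [if_neg (show ¬ (node Simple.last + 1 = P.k) by simp only [node]; omega)]
    simp only [spar, row, col]
    split_ifs <;> simp [ev, par, bar]
  | odd j =>
    have hj := j.isLt
    rw [if_neg (show ¬ (node (Simple.odd j) + 1 = P.k) by simp only [node]; omega)]
    simp [spar, row, col, od, par, h11]
  | s =>
    rw [if_pos (node_s (P := P))]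
    simp [spar, row, col, od, ev, par]

theorem spar_s : spar (Simple.s : Simple P) = 1 := by rw [spar_eq, if_pos node_s]

theorem spar_of_ne {c : Simple P} (h : c ≠ Simple.s) : spar c = 0 := by
  have := node_s (P := P)
  rw [spar_eq, if_neg]
  exact fun h' => h (node_inj (by omega))

theorem form_wt_of_ne {a b : Idx P} (h : pos P a ≠ pos P b)
    (h' : pos P a + pos P b + 1 ≠ P.m + 2 * P.k) : form P (wt P a) (wt P b) = 0 := by
  rw [form_wt_pos, if_neg h, if_neg h']; simp

theorem form_wt_of_eq {a b : Idx P} (h : pos P a = pos P b)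
    (h' : pos P a + pos P b + 1 ≠ P.m + 2 * P.k) :
    form P (wt P a) (wt P b) = posSign P (pos P a) := by
  rw [form_wt_pos, if_pos h, if_neg h']; simp

theorem form_wt_of_bar {a b : Idx P} (h : pos P a ≠ pos P b)
    (h' : pos P a + pos P b + 1 = P.m + 2 * P.k) :
    form P (wt P a) (wt P b) = -posSign P (pos P a) := by
  rw [form_wt_pos, if_neg h, if_pos h']; simp

theorem form_wt_of_mid {a b : Idx P} (h : pos P a = pos P b)
    (h' : pos P a + pos P b + 1 = P.m + 2 * P.k) :
    form P (wt P a) (wt P b) = 0 := by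
  rw [form_wt_pos, if_pos h, if_pos h']; simp

theorem posSign_even {p : ℕ} (h : P.k ≤ p) (h' : p < P.k + P.m) : posSign P p = 1 :=
  if_pos ⟨h, h'⟩

theorem posSign_odd {p : ℕ} (h : p < P.k) : posSign P p = -1 :=
  if_neg (by omega)

theorem form_root_of_not_adj {b c : Simple P} (h : ¬ Adj b c) (hbc : b ≠ c) :
    form P (root b) (root c) = 0 := by
  have hm := m_eq (P := P)
  have hl := one_le_l (P := P)
  have hk := P.k_pos
  have hb := node_lt b
  have hc := node_lt c
  have hn : node b ≠ node c := fun h => hbc (node_inj h)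
  have hs := node_last (P := P)
  have h2 : P.m % 2 = 0 → 2 ≤ P.l := two_le_l
  rw [form_root_root]
  unfold Adj at h
  rcases pos_row_col b with ⟨h1, h2, h3⟩ | ⟨he, rfl, h1, h2⟩ <;>
  rcases pos_row_col c with ⟨h1', h2', h3'⟩ | ⟨he', rfl, h1', h2'⟩
  · rw [form_wt_of_ne (by omega) (by omega), form_wt_of_ne (by omega) (by omega),
      form_wt_of_ne (by omega) (by omega), form_wt_of_ne (by omega) (by omega)]; simp
  -- The two end nodes of the fork share both of their weights; the contributions 1 and -1 cancel.
  · by_cases hq : node b + 2 = P.k + P.l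
    · rw [form_wt_of_eq (by omega) (by omega), form_wt_of_ne (by omega) (by omega),
        form_wt_of_ne (by omega) (by omega), form_wt_of_bar (by omega) (by omega),
        posSign_even (by omega) (by omega), posSign_even (by omega) (by omega)]; simp
    · rw [form_wt_of_ne (by omega) (by omega), form_wt_of_ne (by omega) (by omega),
        form_wt_of_ne (by omega) (by omega), form_wt_of_ne (by omega) (by omega)]; simp
  · by_cases hq : node c + 2 = P.k + P.l
    · rw [form_wt_of_eq (by omega) (by omega), form_wt_of_ne (by omega) (by omega),
        form_wt_of_ne (by omega) (by omega), form_wt_of_bar (by omega) (by omega),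
        posSign_even (by omega) (by omega), posSign_even (by omega) (by omega)]; simp
    · rw [form_wt_of_ne (by omega) (by omega), form_wt_of_ne (by omega) (by omega),
        form_wt_of_ne (by omega) (by omega), form_wt_of_ne (by omega) (by omega)]; simp
  · exact absurd rfl hbc

theorem form_root_self {b : Simple P} (hb : P.m % 2 = 1 → b ≠ Simple.last) :
    form P (root b) (root b) = posSign P (pos P (row b)) + posSign P (pos P (col b)) := by
  have hm := m_eq (P := P)
  have hl := one_le_l (P := P)
  have hk := P.k_pos
  have hb' := node_lt b
  have hs := node_last (P := P)
  have hn : P.m % 2 = 1 → node b ≠ node Simple.last := fun h h' => hb h (node_inj h')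
  rw [form_root_root]
  rcases pos_row_col b with ⟨h1, h2, h3⟩ | ⟨he, rfl, h1, h2⟩ <;>
  · rw [form_wt_of_eq rfl (by omega), form_wt_of_ne (by omega) (by omega),
      form_wt_of_ne (by omega) (by omega), form_wt_of_eq rfl (by omega)]; simp

theorem form_root_last_self (h : P.m % 2 = 1) :
    form P (root (Simple.last : Simple P)) (root Simple.last) = 1 := by
  have hm := m_eq (P := P)
  have hl := one_le_l (P := P)
  have hs := node_last (P := P)
  rw [form_root_root]
  rcases pos_row_col (Simple.last : Simple P) with ⟨h1, h2, h3⟩ | ⟨he, _, h1, h2⟩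
  · rw [form_wt_of_eq rfl (by omega), form_wt_of_ne (by omega) (by omega),
      form_wt_of_ne (by omega) (by omega), form_wt_of_mid rfl (by omega),
      posSign_even (by omega) (by omega)]; simp
  · omega

theorem form_s_s : form P (root (Simple.s : Simple P)) (root Simple.s) = 0 := by
  have hm := m_eq (P := P)
  have hl := one_le_l (P := P)
  have hs := node_s (P := P)
  rcases pos_row_col (Simple.s : Simple P) with ⟨h1, h2, h3⟩ | ⟨he, h, h1, h2⟩
  · rw [form_root_self (by simp), posSign_odd (by omega), posSign_even (by omega) (by omega)]
    simp
  · exact absurd h (by simp)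

/-- Scalar products of neighbouring simple roots. -/
theorem form_root_adj {b c : Simple P} (h : Adj b c) :
    form P (root b) (root c) = if node b + 1 < P.k ∨ node c + 1 < P.k then 1 else -1 := by
  have hm := m_eq (P := P)
  have hl := one_le_l (P := P)
  have hk := P.k_pos
  have hb := node_lt b
  have hc := node_lt c
  have hs := node_last (P := P)
  have h2 : P.m % 2 = 0 → 2 ≤ P.l := two_le_l
  -- Neighbouring roots share one weight, with opposite signs; `p` is its position.
  have key : ∀ p : ℕ, (p < P.k ↔ node b + 1 < P.k ∨ node c + 1 < P.k) → p < P.k + P.l →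
      -posSign P p = if node b + 1 < P.k ∨ node c + 1 < P.k then 1 else -1 := by
    intro p hp hp'
    by_cases hq : p < P.k
    · rw [posSign_odd hq, if_pos (hp.1 hq)]; simp
    · rw [posSign_even (by omega) (by omega), if_neg fun h => hq (hp.2 h)]
  rw [form_root_root]
  unfold Adj at h
  rcases pos_row_col b with ⟨h1, h2, h3⟩ | ⟨he, rfl, h1, h2⟩ <;>
  rcases pos_row_col c with ⟨h1', h2', h3'⟩ | ⟨he', rfl, h1', h2'⟩
  · rcases (show node b + 1 = node c ∨ node c + 1 = node b by omega) with hq | hq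
    · rw [form_wt_of_ne (by omega) (by omega), form_wt_of_ne (by omega) (by omega),
        form_wt_of_eq (a := col b) (by omega) (by omega), form_wt_of_ne (by omega) (by omega),
        ← key (pos P (col b)) (by omega) (by omega)]; simp
    · rw [form_wt_of_ne (by omega) (by omega), form_wt_of_eq (a := row b) (by omega) (by omega),
        form_wt_of_ne (by omega) (by omega), form_wt_of_ne (by omega) (by omega),
        ← key (pos P (row b)) (by omega) (by omega)]; simp
  · rw [form_wt_of_ne (by omega) (by omega), form_wt_of_ne (by omega) (by omega),
      form_wt_of_eq (a := col b) (by omega) (by omega), form_wt_of_ne (by omega) (by omega),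
      ← key (pos P (col b)) (by omega) (by omega)]; simp
  · rw [form_wt_of_ne (by omega) (by omega), form_wt_of_eq (a := row Simple.last) (by omega) (by omega),
      form_wt_of_ne (by omega) (by omega), form_wt_of_ne (by omega) (by omega),
      ← key (pos P (row Simple.last)) (by omega) (by omega)]; simp
  · omega

end Arrows

/-! ### Families of elements with the `q`-Serre relations -/

section SerreRelations

variable {A : Type*} [Ring A] [Algebra ℂ A]

theorem mul_left_rule {x y z w : A} {c : ℂ} (h : x * y = c • (z * w)) (t : A) :
    x * (y * t) = c • (z * (w * t)) := by
  rw [← mul_assoc, h, smul_mul_assoc, mul_assoc]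

/-- Once all primed letters are moved to the right, the mixed terms cancel by the choice of the
coefficient v + v⁻¹, and what is left is the sum of the two given relations. The quartic and extra
versions work in the same way. -/
theorem serre_cubic_add {x y x' y' : A} {v : ℂ} (hv : v ≠ 0)
    (h1 : x' * x = (v⁻¹ * v⁻¹) • (x * x')) (h2 : x' * y = v • (y * x'))
    (h3 : y' * x = v • (x * y'))
    (hx : x * (x * y) - (v + v⁻¹) • (x * (y * x)) + y * (x * x) = 0)
    (hx' : x' * (x' * y') - (v + v⁻¹) • (x' * (y' * x')) + y' * (x' * x') = 0) :
    (x + x') * ((x + x') * (y + y')) - (v + v⁻¹) • ((x + x') * ((y + y') * (x + x'))) +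
      (y + y') * ((x + x') * (x + x')) = 0 := by
  have h1' := mul_left_rule h1
  have h2' := mul_left_rule h2
  have h3' := mul_left_rule h3
  simp only [mul_add, add_mul, mul_assoc, mul_smul_comm, h1, h2, h3, h1', h2', h3',
    smul_smul, smul_add]
  linear_combination (norm := skip) hx + hx'
  match_scalars <;> field_simp <;> ring

theorem serre_quartic_add {x y x' y' : A} {v w : ℂ} (hv : v ≠ 0) (hw : w = v + 1 + v⁻¹)
    (h1 : x' * x = v • (x * x')) (h2 : x' * y = v⁻¹ • (y * x'))
    (h3 : y' * x = v⁻¹ • (x * y'))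
    (hx : x * (x * (x * y)) - w • (x * (x * (y * x))) + w • (x * (y * (x * x))) -
      y * (x * (x * x)) = 0)
    (hx' : x' * (x' * (x' * y')) - w • (x' * (x' * (y' * x'))) + w • (x' * (y' * (x' * x'))) -
      y' * (x' * (x' * x')) = 0) :
    (x + x') * ((x + x') * ((x + x') * (y + y'))) -
      w • ((x + x') * ((x + x') * ((y + y') * (x + x')))) +
      w • ((x + x') * ((y + y') * ((x + x') * (x + x')))) -
      (y + y') * ((x + x') * ((x + x') * (x + x'))) = 0 := by
  have h1' := mul_left_rule h1
  have h2' := mul_left_rule h2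
  have h3' := mul_left_rule h3
  simp only [mul_add, add_mul, mul_assoc, mul_smul_comm, h1, h2, h3, h1', h2', h3',
    smul_smul, smul_add]
  linear_combination (norm := skip) hx + hx'
  subst hw
  match_scalars <;> field_simp <;> ring

/-- Besides the exchange rules this needs s ^ 2 = 0 and bc = cb in both families: they remove the
mixed terms in which two equal odd letters become adjacent and identify those that differ by the
order of b and c. -/
theorem serre_extra_add {s b c s' b' c' : A} {v : ℂ} (hv : v ≠ 0)
    (h1 : s' * s = (-1 : ℂ) • (s * s')) (h2 : s' * b = v • (b * s')) (h3 : s' * c = v⁻¹ • (c * s'))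
    (h4 : b' * s = v • (s * b')) (h5 : c' * s = v⁻¹ • (s * c'))
    (h6 : b' * c = (1 : ℂ) • (c * b')) (h7 : c' * b = (1 : ℂ) • (b * c'))
    (hs : s * s = (0 : ℂ) • (s * s)) (hs' : s' * s' = (0 : ℂ) • (s' * s'))
    (hbc : c * b = (1 : ℂ) • (b * c)) (hbc' : c' * b' = (1 : ℂ) • (b' * c'))
    (hx : s * (b * (s * c)) + s * (c * (s * b)) + b * (s * (c * s)) + c * (s * (b * s)) -
      (v + v⁻¹) • (s * (b * (c * s))) = 0)
    (hx' : s' * (b' * (s' * c')) + s' * (c' * (s' * b')) + b' * (s' * (c' * s')) +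
      c' * (s' * (b' * s')) - (v + v⁻¹) • (s' * (b' * (c' * s'))) = 0) :
    (s + s') * ((b + b') * ((s + s') * (c + c'))) + (s + s') * ((c + c') * ((s + s') * (b + b'))) +
      (b + b') * ((s + s') * ((c + c') * (s + s'))) +
      (c + c') * ((s + s') * ((b + b') * (s + s'))) -
      (v + v⁻¹) • ((s + s') * ((b + b') * ((c + c') * (s + s')))) = 0 := by
  have h1' := mul_left_rule h1
  have h2' := mul_left_rule h2
  have h3' := mul_left_rule h3
  have h4' := mul_left_rule h4
  have h5' := mul_left_rule h5
  have h6' := mul_left_rule h6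
  have h7' := mul_left_rule h7
  have hc' := mul_left_rule hbc
  have hcc' := mul_left_rule hbc'
  have hss : ∀ t, s * (s * t) = 0 := fun t => by rw [mul_left_rule hs, zero_smul]
  have hss' : ∀ t, s' * (s' * t) = 0 := fun t => by rw [mul_left_rule hs', zero_smul]
  rw [zero_smul] at hs hs'
  simp only [one_smul] at h6 h7 h6' h7' hbc hbc' hc' hcc'
  simp only [mul_add, add_mul, mul_assoc, mul_smul_comm, smul_mul_assoc, h1, h2, h3, h4, h5, h6, h7,
    h1', h2', h3', h4', h5', h6', h7', hs, hs', hss, hss', hbc, hbc', hc', hcc',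
    smul_smul, smul_add, smul_zero, mul_zero]
  linear_combination (norm := skip) hx + hx'
  match_scalars <;> field_simp <;> ring

end SerreRelations

/-! ### Sums of q-commuting Serre families -/

section SerreFamily

variable {P : Params} {A : Type*} [Ring A] [Algebra ℂ A]

/-- The (extra) `q`-Serre relations, `q = r ^ 2`. -/
structure SerreFamily (r : ℂ) (E : Simple P → A) : Prop where
  comm (b c : Simple P) (h : ¬ Adj b c) (hbc : b ≠ c) : E b * E c = E c * E b
  cubic (b c : Simple P) (h : Adj b c) (hs : b ≠ Simple.s) (hl : P.m % 2 = 1 → b ≠ Simple.last) :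
    E b * (E b * E c) - (r ^ 2 + (r ^ 2)⁻¹) • (E b * (E c * E b)) + E c * (E b * E b) = 0
  quartic (b c : Simple P) (h : Adj b c) (hm : P.m % 2 = 1) (hb : b = Simple.last) :
    E b * (E b * (E b * E c)) - (r ^ 2 + 1 + (r ^ 2)⁻¹) • (E b * (E b * (E c * E b))) +
      (r ^ 2 + 1 + (r ^ 2)⁻¹) • (E b * (E c * (E b * E b))) - E c * (E b * (E b * E b)) = 0
  sq : E Simple.s * E Simple.s = 0
  extra (s b c : Simple P) (hs : s = Simple.s) (hb : Adj s b) (hc : Adj s c)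
    (hb' : node b < node s) (hc' : node s < node c) :
    E s * (E b * (E s * E c)) + E s * (E c * (E s * E b)) + E b * (E s * (E c * E s)) +
      E c * (E s * (E b * E s)) - (r ^ 2 + (r ^ 2)⁻¹) • (E s * (E b * (E c * E s))) = 0

/-- The scalar `(-1)^([b][c]) q^((α_b, α_c))`. -/
def braid (r : ℂ) (b c : Simple P) : ℂ :=
  sgn (spar b * spar c) * r ^ (2 * form P (root b) (root c))

theorem braid_comm (r : ℂ) (b c : Simple P) : braid r b c = braid r c b := by
  rw [braid, braid, mul_comm (spar b), form_comm]

theorem braid_of_not_adj (r : ℂ) {b c : Simple P} (h : ¬ Adj b c) (hbc : b ≠ c) :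
    braid r b c = 1 := by
  rw [braid, form_root_of_not_adj h hbc]
  have : spar b * spar c = 0 := by
    by_cases hb : b = Simple.s
    · rw [spar_of_ne (c := c) (by rintro rfl; exact hbc hb), mul_zero]
    · rw [spar_of_ne hb, zero_mul]
  simp [this, sgn]

theorem Adj.ne {b c : Simple P} (h : Adj b c) : b ≠ c := by
  rintro rfl
  unfold Adj at h; omega

theorem Adj.symm {b c : Simple P} (h : Adj b c) : Adj c b := by
  unfold Adj at h ⊢; omega

theorem Adj.spar_mul {b c : Simple P} (h : Adj b c) : spar b * spar c = 0 := by
  by_cases hb : b = Simple.s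
  · rw [spar_of_ne (c := c) (by rintro rfl; exact h.ne hb), mul_zero]
  · rw [spar_of_ne hb, zero_mul]

theorem braid_of_adj (r : ℂ) {b c : Simple P} (h : Adj b c) :
    braid r b c = if node b + 1 < P.k ∨ node c + 1 < P.k then r ^ 2 else (r ^ 2)⁻¹ := by
  rw [braid, h.spar_mul, form_root_adj h]
  split_ifs
  · simp [sgn]
  · simp [sgn]

/-- For a long even simple root, `q^((α_b, α_b)) = q^(-2 (α_b, α_c))` for a neighbour `c`. -/
theorem braid_self {r : ℂ} {b c : Simple P} (h : Adj b c) (hs : b ≠ Simple.s)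
    (hl : P.m % 2 = 1 → b ≠ Simple.last) :
    braid r b b = (braid r b c)⁻¹ * (braid r b c)⁻¹ := by
  have hm := m_eq (P := P)
  have hk := P.k_pos
  have hl' := one_le_l (P := P)
  have hb := node_lt b
  have hn : node b ≠ node Simple.s := fun h => hs (node_inj h)
  have hs := node_s (P := P)
  have hlst := node_last (P := P)
  have h2 : P.m % 2 = 0 → 2 ≤ P.l := two_le_l
  have hnl : P.m % 2 = 1 → node b ≠ node Simple.last := fun h h' => hl h (node_inj h')
  rw [braid_of_adj r h, braid, spar_of_ne (by assumption), form_root_self hl]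
  unfold Adj at h
  by_cases hq : node b + 1 < P.k
  · rw [if_pos (Or.inl hq)]
    rcases pos_row_col b with ⟨h1, h2, h3⟩ | ⟨he, rfl, h1, h2⟩
    · rw [posSign_odd (by omega), posSign_odd (by omega)]
      have : (2 * (-1 + -1) : ℤ) = -(4 : ℕ) := by norm_num
      rw [this, zpow_neg, zpow_natCast]
      simp only [mul_zero, sgn, if_true, one_mul, ← mul_inv]; congr 1; ring
    · omega
  · rw [if_neg (by omega)]
    have : posSign P (pos P (row b)) = 1 ∧ posSign P (pos P (col b)) = 1 := by
      rcases pos_row_col b with ⟨h1, h2, h3⟩ | ⟨he, rfl, h1, h2⟩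
      · exact ⟨posSign_even (by omega) (by omega), posSign_even (by omega) (by omega)⟩
      · exact ⟨posSign_even (by omega) (by omega), posSign_even (by omega) (by omega)⟩
    rw [this.1, this.2]
    have : (2 * (1 + 1) : ℤ) = (4 : ℕ) := by norm_num
    rw [this, zpow_natCast]
    simp only [mul_zero, sgn, if_true, one_mul, inv_inv]; ring

theorem braid_s_s (r : ℂ) : braid r (Simple.s : Simple P) Simple.s = -1 := by
  rw [braid, spar_s, form_s_s]; simp [sgn]

theorem braid_last_last (r : ℂ) (h : P.m % 2 = 1) :
    braid r (Simple.last : Simple P) Simple.last = r ^ 2 := by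
  rw [braid, spar_of_ne (by simp), form_root_last_self h]
  simp [sgn]

/-- The two families exchange like the two summands of a coproduct, with the factor `braid`. No
grading or tensor product is needed, so the lemma can be applied twice to the three parts of the
adjoint action. -/
theorem SerreFamily.add {r : ℂ} (hr : r ≠ 0) {X Y : Simple P → A} (hX : SerreFamily r X)
    (hY : SerreFamily r Y) (h : ∀ b c, Y b * X c = braid r b c • (X c * Y b)) :
    SerreFamily r (X + Y) where
  comm b c hbc hne := by
    have h1 := h b c
    have h2 := h c b
    rw [braid_of_not_adj r hbc hne, one_smul] at h1
    rw [braid_comm, braid_of_not_adj r hbc hne, one_smul] at h2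
    simp only [Pi.add_apply, add_mul, mul_add, hX.comm b c hbc hne, hY.comm b c hbc hne, h1, h2]
    abel
  cubic b c hbc hs hl := by
    have h1 := h b c
    have h2 := h c b
    have h3 := h b b
    rw [braid_self hbc hs hl] at h3
    rw [braid_comm] at h2
    -- The cubic relation is symmetric under q ↔ q⁻¹, so one identity with v = q^((α_b, α_c)) serves
    -- both the δ side and the ε side of the diagram.
    have hv : r ^ 2 + (r ^ 2)⁻¹ = braid r b c + (braid r b c)⁻¹ := by
      rw [braid_of_adj r hbc]; split_ifs
      · rfl
      · rw [inv_inv, add_comm]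
    have hv0 : braid r b c ≠ 0 := by
      rw [braid_of_adj r hbc]; split_ifs <;> simp [hr]
    have hx := hX.cubic b c hbc hs hl
    have hy := hY.cubic b c hbc hs hl
    rw [hv] at hx hy ⊢
    exact serre_cubic_add hv0 h3 h1 h2 hx hy
  quartic b c hbc hm hb := by
    have h1 := h b c
    have h2 := h c b
    have h3 := h b b
    have hk : braid r b c = (r ^ 2)⁻¹ := by
      have := one_le_l (P := P)
      have := node_last (P := P)
      rw [braid_of_adj r hbc, if_neg]
      subst hb
      unfold Adj at hbc
      omega
    rw [hk] at h1
    rw [braid_comm, hk] at h2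
    rw [hb, braid_last_last r hm, ← hb] at h3
    exact serre_quartic_add (pow_ne_zero 2 hr) rfl h3 h1 h2 (hX.quartic b c hbc hm hb)
      (hY.quartic b c hbc hm hb)
  sq := by
    have h1 := h Simple.s Simple.s
    rw [braid_s_s] at h1
    simp [add_mul, mul_add, hX.sq, hY.sq, h1]
  extra s b c hs hb hc hb' hc' := by
    have hns := node_s (P := P)
    rw [← hs] at hns
    have h2l : P.m % 2 = 0 → 2 ≤ P.l := two_le_l
    have hbc : ¬ Adj b c := by unfold Adj; omega
    have hne : c ≠ b := by rintro rfl; omega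
    have e1 := h s s
    have e2 := h s b
    have e3 := h s c
    have e4 := h b s
    have e5 := h c s
    have e6 := h b c
    have e7 := h c b
    have k1 : braid r s b = r ^ 2 := by rw [braid_of_adj r hb, if_pos (by omega)]
    have k2 : braid r s c = (r ^ 2)⁻¹ := by rw [braid_of_adj r hc, if_neg (by omega)]
    rw [hs, braid_s_s, ← hs] at e1
    rw [k1] at e2
    rw [k2] at e3
    rw [braid_comm, k1] at e4
    rw [braid_comm, k2] at e5
    rw [braid_of_not_adj r hbc hne.symm] at e6
    rw [braid_comm, braid_of_not_adj r hbc hne.symm] at e7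
    have c1 := hX.comm b c hbc hne.symm
    have c2 := hY.comm b c hbc hne.symm
    have sx := hX.sq
    have sy := hY.sq
    rw [← hs] at sx sy
    exact serre_extra_add (pow_ne_zero 2 hr) e1 e2 e3 e4 e5 e6 e7 (by rw [zero_smul, sx])
      (by rw [zero_smul, sy]) (by rw [one_smul, c1]) (by rw [one_smul, c2])
      (hX.extra s b c hs hb hc hb' hc') (hY.extra s b c hs hb hc hb' hc')

end SerreFamily

/-! ### Serre families under homomorphisms, reversal and Cartan twists -/

section SerreConstructions

variable {P : Params} {A B : Type*} [Ring A] [Algebra ℂ A] [Ring B] [Algebra ℂ B]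

theorem SerreFamily.map {r : ℂ} {E : Simple P → A} (hE : SerreFamily r E) (f : A →ₐ[ℂ] B) :
    SerreFamily r fun c => f (E c) where
  comm b c h hbc := by simpa using congrArg f (hE.comm b c h hbc)
  cubic b c h hs hl := by simpa using congrArg f (hE.cubic b c h hs hl)
  quartic b c h hm hb := by simpa using congrArg f (hE.quartic b c h hm hb)
  sq := by simpa using congrArg f hE.sq
  extra s b c hs hb hc hb' hc' := by simpa using congrArg f (hE.extra s b c hs hb hc hb' hc')

theorem not_adj_of_sides {s b c : Simple P} (hs : s = Simple.s) (hb : node b < node s)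
    (hc : node s < node c) : ¬ Adj b c ∧ b ≠ c := by
  have h2l : P.m % 2 = 0 → 2 ≤ P.l := two_le_l
  have hns := node_s (P := P)
  rw [← hs] at hns
  refine ⟨by unfold Adj; omega, ?_⟩
  rintro rfl; omega

/-- Reversing words fixes the cubic relation, changes the sign of the quartic one, and permutes the
terms of the extra relation once b and c commute. This is what makes right multiplication
admissible. -/
theorem SerreFamily.op {r : ℂ} {E : Simple P → A} (hE : SerreFamily r E) :
    SerreFamily r fun c => MulOpposite.op (E c) where
  comm b c h hbc := by
    rw [← MulOpposite.op_mul, ← MulOpposite.op_mul, hE.comm b c h hbc]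
  cubic b c h hs hl := by
    apply MulOpposite.unop_injective
    have := hE.cubic b c h hs hl
    simp only [MulOpposite.unop_add, MulOpposite.unop_sub, MulOpposite.unop_smul,
      MulOpposite.unop_mul, MulOpposite.unop_op, MulOpposite.unop_zero, mul_assoc]
    linear_combination (norm := module) this
  quartic b c h hm hb := by
    apply MulOpposite.unop_injective
    have := hE.quartic b c h hm hb
    simp only [MulOpposite.unop_add, MulOpposite.unop_sub, MulOpposite.unop_smul,
      MulOpposite.unop_mul, MulOpposite.unop_op, MulOpposite.unop_zero, mul_assoc]
    linear_combination (norm := module) (-1 : ℂ) • this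
  sq := by rw [← MulOpposite.op_mul, hE.sq, MulOpposite.op_zero]
  extra s b c hs hb hc hb' hc' := by
    apply MulOpposite.unop_injective
    have := hE.extra s b c hs hb hc hb' hc'
    obtain ⟨h1, h2⟩ := not_adj_of_sides hs hb' hc'
    have h3 : E s * (E c * (E b * E s)) = E s * (E b * (E c * E s)) := by
      rw [← mul_assoc (E c), ← hE.comm b c h1 h2, mul_assoc]
    simp only [MulOpposite.unop_add, MulOpposite.unop_sub, MulOpposite.unop_smul,
      MulOpposite.unop_mul, MulOpposite.unop_op, MulOpposite.unop_zero, mul_assoc, h3]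
    linear_combination (norm := module) this

/-- All words of a relation have the same letters. As κ is symmetric and the T commute, moving the T
to the right produces the same scalar and the same product of T for each word, so the relation is
only multiplied by them. -/
theorem SerreFamily.twist {r : ℂ} {E T : Simple P → A} (hE : SerreFamily r E)
    (κ : Simple P → Simple P → ℂ) (hκ : ∀ b c, κ b c = κ c b)
    (hT : ∀ b c, T b * T c = T c * T b) (h : ∀ b c, T b * E c = κ b c • (E c * T b)) :
    SerreFamily r fun c => E c * T c where
  comm b c hbc hne := by
    have key : ∀ b c, E b * T b * (E c * T c) = κ b c • (E b * E c * (T b * T c)) := fun b c => by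
      rw [mul_assoc, mul_left_rule (h b c), mul_smul_comm, mul_assoc]
    rw [key, key, hE.comm b c hbc hne, hκ b c, hT b c]
  cubic b c hbc hs hl := by
    have h1 := mul_left_rule (h b c)
    have h2 := mul_left_rule (h c b)
    have h3 := mul_left_rule (h b b)
    have h4 := mul_left_rule ((hT c b).trans (one_smul ℂ _).symm)
    simp only [one_smul] at h4
    have := congrArg (fun x => (κ b b * κ b c * κ b c) • (x * (T b * (T b * T c))))
      (hE.cubic b c hbc hs hl)
    simp only [sub_mul, add_mul, smul_mul_assoc, mul_assoc, zero_mul, smul_zero] at this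
    simp only [mul_assoc, h1, h2, h3, h4, hκ c b, mul_smul_comm, hT c b, smul_smul]
    linear_combination (norm := module) this
  quartic b c hbc hm hb := by
    have h1 := mul_left_rule (h b c)
    have h2 := mul_left_rule (h c b)
    have h3 := mul_left_rule (h b b)
    have h4 := mul_left_rule ((hT c b).trans (one_smul ℂ _).symm)
    simp only [one_smul] at h4
    have := congrArg (fun x => (κ b b * κ b b * κ b b * κ b c * κ b c * κ b c) •
      (x * (T b * (T b * (T b * T c))))) (hE.quartic b c hbc hm hb)
    simp only [sub_mul, add_mul, smul_mul_assoc, mul_assoc, zero_mul, smul_zero] at this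
    simp only [mul_assoc, h1, h2, h3, h4, hκ c b, mul_smul_comm, hT c b, smul_smul]
    linear_combination (norm := module) this
  sq := by
    have h1 := mul_left_rule (h Simple.s Simple.s)
    simp only [mul_assoc, h1, mul_smul_comm, ← mul_assoc (E _) (E _), hE.sq, zero_mul, smul_zero]
  extra s b c hs hb hc hb' hc' := by
    have h1 := mul_left_rule (h s b)
    have h2 := mul_left_rule (h b s)
    have h3 := mul_left_rule (h s c)
    have h4 := mul_left_rule (h c s)
    have h5 := mul_left_rule (h b c)
    have h6 := mul_left_rule (h c b)
    have h7 := mul_left_rule (h s s)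
    have t1 := mul_left_rule ((hT b s).trans (one_smul ℂ _).symm)
    have t2 := mul_left_rule ((hT c s).trans (one_smul ℂ _).symm)
    simp only [one_smul] at t1 t2
    have := congrArg (fun x => (κ s b * κ s b * κ s s * κ s c * κ s c * κ b c) •
      (x * (T s * (T s * (T b * T c))))) (hE.extra s b c hs hb hc hb' hc')
    simp only [sub_mul, add_mul, smul_mul_assoc, mul_assoc, zero_mul, smul_zero] at this
    simp only [mul_assoc, h1, h2, h3, h4, h5, h6, h7, t1, t2, hT b s, hT c s, hT c b,
      hκ b s, hκ c s, hκ c b, mul_smul_comm, smul_smul]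
    linear_combination (norm := module) this

end SerreConstructions

/-! ### The relations of the raising generators -/

section Raising

variable {P : Params}

theorem cartan_of_form_zero {b c : Simple P} (h : form P (root b) (root c) = 0) :
    cartan b c = 0 := by
  simp [cartan, h]

theorem sgn_zero : sgn 0 = 1 := by simp [sgn]

theorem sgn_one : sgn 1 = -1 := by simp [sgn]

theorem form_ge_cases {b c : Simple P} (h : Adj b c) (hs : b ≠ Simple.s)
    (hl : P.m % 2 = 1 → b ≠ Simple.last) :
    form P (root b) (root b) = -2 * form P (root b) (root c) ∧
    (form P (root b) (root c) = 1 ∨ form P (root b) (root c) = -1) := by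
  have hm := m_eq (P := P)
  have hk := P.k_pos
  have hl' := one_le_l (P := P)
  have hb := node_lt b
  have hn : node b ≠ node Simple.s := fun h => hs (node_inj h)
  have hs := node_s (P := P)
  have hlst := node_last (P := P)
  have h2 : P.m % 2 = 0 → 2 ≤ P.l := two_le_l
  have hnl : P.m % 2 = 1 → node b ≠ node Simple.last := fun h h' => hl h (node_inj h')
  rw [form_root_adj h, form_root_self hl]
  unfold Adj at h
  by_cases hq : node b + 1 < P.k
  · rw [if_pos (Or.inl hq)]
    rcases pos_row_col b with ⟨h1, h2, h3⟩ | ⟨he, rfl, h1, h2⟩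
    · rw [posSign_odd (by omega), posSign_odd (by omega)]; simp
    · omega
  · rw [if_neg (by omega)]
    rcases pos_row_col b with ⟨h1, h2, h3⟩ | ⟨he, rfl, h1, h2⟩
    · rw [posSign_even (by omega) (by omega), posSign_even (by omega) (by omega)]; simp
    · rw [posSign_even (by omega) (by omega), posSign_even (by omega) (by omega)]; simp

theorem form_last_adj {c : Simple P} (hm : P.m % 2 = 1) (h : Adj Simple.last c) :
    form P (root Simple.last) (root c) = -1 := by
  have := one_le_l (P := P)
  have := node_last (P := P)
  rw [form_root_adj h, if_neg]
  unfold Adj at h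
  omega

theorem ue_comm (r : ℂ) {b c : Simple P} (h : ¬ Adj b c) (hbc : b ≠ c) :
    ue r b * ue r c = ue r c * ue r b := by
  have h1 := form_root_of_not_adj h hbc
  have h2 : spar b * spar c = 0 := by
    by_cases hb : b = Simple.s
    · rw [spar_of_ne (c := c) (by rintro rfl; exact hbc hb), mul_zero]
    · rw [spar_of_ne hb, zero_mul]
  have := mk_eq_of_rel (Rel.serre_e (r := r) b c hbc)
  rw [cartan_of_form_zero h1] at this
  simp only [sub_zero, Int.toNat_one, Function.iterate_one, qBracket, eElt, h1, h2, sgn_zero,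
    map_sub, map_mul, map_zero, mul_zero, zpow_zero, one_smul, mul_one] at this
  exact sub_eq_zero.1 this

theorem ue_s_sq (r : ℂ) : ue r (Simple.s : Simple P) * ue r Simple.s = 0 := by
  have := mk_eq_of_rel (Rel.e_sq (r := r) (Simple.s : Simple P) form_s_s)
  rwa [map_mul, map_zero] at this

/-- The nested q-brackets are expanded with the known scalar products. The extra relation takes its
five-term form after using e_s ^ 2 = 0 and the commutation of the two neighbours of the odd node. -/
theorem ue_serre {r : ℂ} (hr : r ≠ 0) : SerreFamily r (ue r : Simple P → Uq P r) where
  comm b c h hbc := ue_comm r h hbc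
  cubic b c h hs hl := by
    obtain ⟨h1, h2⟩ := form_ge_cases h hs hl
    have hc : cartan b c = -1 := by
      rw [cartan, h1]; rcases h2 with h2 | h2 <;> rw [h2] <;> norm_num
    have := mk_eq_of_rel (Rel.serre_e (r := r) b c h.ne)
    rw [hc] at this
    simp only [show (1 - (-1 : ℤ)).toNat = 2 from rfl, Function.iterate_succ,
      Function.iterate_zero, Function.comp_apply, id_eq, qBracket, eElt, spar_of_ne hs, h1,
      form_add_right, zero_mul, sgn_zero,
      map_sub, map_mul, map_smul, map_zero, one_mul] at this
    change ue r b * (ue r b * ue r c - _ • (ue r c * ue r b)) -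
      _ • ((ue r b * ue r c - _ • (ue r c * ue r b)) * ue r b) = 0 at this
    simp only [mul_sub, sub_mul, smul_sub, mul_smul_comm, smul_mul_assoc, smul_smul, mul_assoc]
      at this
    rcases h2 with h2 | h2 <;> rw [h2] at this <;> norm_num [zpow_neg] at this <;>
    · linear_combination (norm := skip) this
      match_scalars <;> field_simp <;> ring
  quartic b c h hm hb := by
    subst hb
    have h1 := form_last_adj hm h
    have h2 := form_root_last_self hm
    have hc : cartan Simple.last c = -2 := by
      rw [cartan, h1, h2]; norm_num
    have := mk_eq_of_rel (Rel.serre_e (r := r) Simple.last c h.ne)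
    rw [hc] at this
    simp only [show (1 - (-2 : ℤ)).toNat = 3 from rfl, Function.iterate_succ,
      Function.iterate_zero, Function.comp_apply, id_eq, qBracket, eElt,
      spar_of_ne (c := Simple.last) (by simp), h1, h2, form_add_right, zero_mul, sgn_zero,
      map_sub, map_mul, map_smul, map_zero, one_mul] at this
    change ue r Simple.last * (ue r Simple.last * (ue r Simple.last * ue r c -
      _ • (ue r c * ue r Simple.last)) - _ • ((ue r Simple.last * ue r c -
      _ • (ue r c * ue r Simple.last)) * ue r Simple.last)) -
      _ • ((ue r Simple.last * (ue r Simple.last * ue r c -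
      _ • (ue r c * ue r Simple.last)) - _ • ((ue r Simple.last * ue r c -
      _ • (ue r c * ue r Simple.last)) * ue r Simple.last)) * ue r Simple.last) = 0 at this
    simp only [mul_sub, sub_mul, smul_sub, mul_smul_comm, smul_mul_assoc, smul_smul, mul_assoc]
      at this
    norm_num [zpow_neg] at this
    linear_combination (norm := skip) this
    match_scalars <;> field_simp <;> ring
  sq := ue_s_sq r
  extra s b c hs hb hc hb' hc' := by
    subst hs
    have hns := node_s (P := P)
    have k1 : form P (root Simple.s) (root b) = 1 := by rw [form_root_adj hb, if_pos (by omega)]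
    have k2 : form P (root Simple.s) (root c) = -1 := by rw [form_root_adj hc, if_neg (by omega)]
    obtain ⟨h1, h2⟩ := not_adj_of_sides rfl hb' hc'
    have k3 := form_root_of_not_adj h1 h2
    have k4 := form_s_s (P := P)
    have k5 : form P (root b) (root Simple.s) = 1 := by rw [form_comm, k1]
    have := mk_eq_of_rel (Rel.extra_e (r := r) b c (by rw [k1]; norm_num) (by rw [k1, k2]))
    simp only [qBracket, eElt, spar_s, spar_of_ne hb.ne.symm, spar_of_ne hc.ne.symm, k1, k2, k3, k4,
      k5, form_add_right, mul_zero, add_zero, mul_one, zero_add, sgn_zero, sgn_one,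
      map_sub, map_mul, map_smul, map_zero, one_mul] at this
    have hsq := ue_s_sq (P := P) r
    have hbc := ue_comm r h1 h2
    change ue r Simple.s * (ue r b * (ue r Simple.s * ue r c - _ • (ue r c * ue r Simple.s)) -
      _ • ((ue r Simple.s * ue r c - _ • (ue r c * ue r Simple.s)) * ue r b)) -
      _ • ((ue r b * (ue r Simple.s * ue r c - _ • (ue r c * ue r Simple.s)) -
      _ • ((ue r Simple.s * ue r c - _ • (ue r c * ue r Simple.s)) * ue r b)) * ue r Simple.s) = 0
      at this
    have hsq' : ∀ t, ue r (Simple.s : Simple P) * (ue r Simple.s * t) = 0 := fun t => by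
      rw [← mul_assoc, hsq, zero_mul]
    simp only [mul_sub, sub_mul, smul_sub, mul_smul_comm, smul_mul_assoc, smul_smul, mul_assoc,
      hsq, hsq', mul_zero, smul_zero] at this
    have hcb : ∀ t, ue r c * (ue r b * t) = ue r b * (ue r c * t) := fun t => by
      rw [← mul_assoc, ← hbc, mul_assoc]
    norm_num [zpow_neg, hcb] at this
    linear_combination (norm := skip) this
    match_scalars <;> field_simp <;> ring

end Raising

/-! ### Cartan elements and powers of the parity automorphism -/

section UqRelations

variable {P : Params} (r : ℂ)

theorem uK_zero : uK r (0 : Weight P) = 1 := by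
  have := mk_eq_of_rel (Rel.K_zero (P := P) (r := r))
  rwa [map_one] at this

theorem uK_add (x y : Weight P) : uK r (x + y) = uK r x * uK r y := by
  have := mk_eq_of_rel (Rel.K_add (r := r) x y)
  rwa [map_mul] at this

theorem uK_mul_neg (x : Weight P) : uK r x * uK r (-x) = 1 := by
  rw [← uK_add, add_neg_cancel, uK_zero]

theorem uK_neg_mul (x : Weight P) : uK r (-x) * uK r x = 1 := by
  rw [← uK_add, neg_add_cancel, uK_zero]

theorem uK_mul_comm (x y : Weight P) : uK r x * uK r y = uK r y * uK r x := by
  rw [← uK_add, add_comm, uK_add]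

theorem uK_mul_ue (x : Weight P) (c : Simple P) :
    uK r x * ue r c = r ^ form P x (root c) • (ue r c * uK r x) := by
  have := mk_eq_of_rel (Rel.K_e (r := r) x c)
  rwa [map_mul, map_smul, map_mul] at this

theorem ue_mul_uK {r : ℂ} (hr : r ≠ 0) (x : Weight P) (c : Simple P) :
    ue r c * uK r x = r ^ (-form P x (root c)) • (uK r x * ue r c) := by
  rw [uK_mul_ue, smul_smul, ← zpow_add₀ hr, neg_add_cancel, zpow_zero, one_smul]

theorem parity_ue (c : Simple P) : parity P r (ue r c) = sgn (spar c) • ue r c := by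
  rw [ue, parity_mk, freeParity_e, map_smul]

theorem parity_uK (x : Weight P) : parity P r (uK r x) = uK r x := by
  rw [uK, parity_mk, freeParity_K]

variable (P) in
/-- The automorphism `x ↦ (-1)^(i [x]) x`. -/
def parityPow (i : ZMod 2) : Uq P r →ₐ[ℂ] Uq P r :=
  if i = 0 then AlgHom.id ℂ _ else parity P r

theorem parityPow_zero (x : Uq P r) : parityPow P r 0 x = x := by simp [parityPow]

theorem parityPow_one (x : Uq P r) : parityPow P r 1 x = parity P r x := by simp [parityPow]

theorem zmod_two_cases (x : ZMod 2) : x = 0 ∨ x = 1 := by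
  revert x; decide

theorem parityPow_comm (i j : ZMod 2) (x : Uq P r) :
    parityPow P r i (parityPow P r j x) = parityPow P r j (parityPow P r i x) := by
  rcases zmod_two_cases i with rfl | rfl <;> rcases zmod_two_cases j with rfl | rfl <;>
    simp [parityPow]

theorem parityPow_self (i : ZMod 2) (x : Uq P r) :
    parityPow P r i (parityPow P r i x) = x := by
  rcases zmod_two_cases i with rfl | rfl <;> simp [parityPow, parity_parity]

theorem parityPow_ue (i : ZMod 2) (c : Simple P) :
    parityPow P r i (ue r c) = sgn (i * spar c) • ue r c := by
  rcases zmod_two_cases i with rfl | rfl <;> simp [parityPow, parity_ue, sgn_zero]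

theorem parityPow_uK (i : ZMod 2) (x : Weight P) :
    parityPow P r i (uK r x) = uK r x := by
  rcases zmod_two_cases i with rfl | rfl <;> simp [parityPow, parity_uK]

end UqRelations

/-! ### The twisted adjoint action on columns -/

section Columns

variable {P : Params} (r : ℂ)

variable (P) in
/-- Columns with entries in `U_q[osp(m|n)]`. -/
abbrev Col : Type := Idx P → Uq P r

/-- The Cartan part of left multiplication by `e_c q^(h_c/2)`. -/
def lamCartan (c : Simple P) : Module.End ℂ (Col P r) where
  toFun u a := r ^ (-(2 * form P (root c) (wt P a))) • (uK r (root c) * u a)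
  map_add' u v := by ext a; simp [mul_add]
  map_smul' t u := by ext a; simp [smul_comm t]

/-- The Cartan part of twisted right multiplication by `e_c q^(h_c/2)`, with a minus sign. -/
def rhoCartan (c : Simple P) : Module.End ℂ (Col P r) where
  toFun u a := (-(r ^ (-form P (root c) (root c)) * r ^ (2 * form P (root c) (wt P a)))) •
    (uK r (root c + root c) * parityPow P r (spar c) (u a) * uK r (-root c))
  map_add' u v := by ext a; simp only [Pi.add_apply, map_add, mul_add, add_mul, smul_add]
  map_smul' t u := by ext a; simp only [Pi.smul_apply, map_smul, mul_smul_comm, smul_mul_assoc,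
    RingHom.id_apply]; rw [smul_comm]

variable (P) in
/-- Left multiplication on columns. -/
def lmulCol : Uq P r →ₐ[ℂ] Module.End ℂ (Col P r) := Algebra.lsmul ℂ ℂ (Col P r)

variable (P) in
/-- Right multiplication on columns. -/
def rmulCol : (Uq P r)ᵐᵒᵖ →ₐ[ℂ] Module.End ℂ (Col P r) := Algebra.lsmul ℂ ℂ (Col P r)

theorem lmulCol_apply (x : Uq P r) (u : Col P r) (a : Idx P) : lmulCol P r x u a = x * u a := rfl

theorem rmulCol_apply (x : Uq P r) (u : Col P r) (a : Idx P) :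
    rmulCol P r (MulOpposite.op x) u a = u a * x := rfl

/-- Left multiplication by `e_c q^(h_c/2)`. -/
def lamOp (c : Simple P) : Module.End ℂ (Col P r) := lmulCol P r (ue r c) * lamCartan r c

/-- The negative of twisted right multiplication by `e_c q^(h_c/2)`. -/
def rhoOp (c : Simple P) : Module.End ℂ (Col P r) :=
  rmulCol P r (MulOpposite.op (ue r c)) * rhoCartan r c

/-- The structure constants of the action on columns. -/
def mu (c : Simple P) (b d : Idx P) : ℂ :=
  sgn (spar c) * r ^ form P (root c) (wt P d) * piE c b d

/-- The action of the vector representation on columns. -/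
def vecOp (c : Simple P) : Module.End ℂ (Col P r) where
  toFun u a := ∑ d, piE c a d •
    ((sgn (spar c) * r ^ form P (root c) (wt P d)) • parityPow P r (spar c) (u d))
  map_add' u v := by ext a; simp [Finset.sum_add_distrib]
  map_smul' t u := by
    ext a
    simp only [Pi.smul_apply, map_smul, RingHom.id_apply, Finset.smul_sum]
    exact Finset.sum_congr rfl fun d _ => by rw [smul_comm t, smul_comm t]

/-- The twisted adjoint action of `e_c`. -/
def adOp (c : Simple P) : Module.End ℂ (Col P r) := lamOp r c + vecOp r c + rhoOp r c

variable {r}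

theorem lamCartan_apply (c : Simple P) (u : Col P r) (a : Idx P) : lamCartan r c u a =
    r ^ (-(2 * form P (root c) (wt P a))) • (uK r (root c) * u a) := rfl

theorem rhoCartan_apply (c : Simple P) (u : Col P r) (a : Idx P) : rhoCartan r c u a =
    (-(r ^ (-form P (root c) (root c)) * r ^ (2 * form P (root c) (wt P a)))) •
    (uK r (root c + root c) * parityPow P r (spar c) (u a) * uK r (-root c)) := rfl

theorem lamOp_apply (c : Simple P) (u : Col P r) (a : Idx P) :
    lamOp r c u a = r ^ (-(2 * form P (root c) (wt P a))) • (eK r c * u a) := by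
  rw [lamOp, Module.End.mul_apply, lmulCol_apply, lamCartan_apply, mul_smul_comm, eK, mul_assoc]

/-- The definition keeps the bare e_c apart from a Cartan operator, as `SerreFamily.twist` requires.
In this form the operator is conjugation by q^(h_c) and a parity twist, followed by right
multiplication by e_c q^(h_c/2). -/
theorem rhoOp_apply (hr : r ≠ 0) (c : Simple P) (u : Col P r) (a : Idx P) :
    rhoOp r c u a = -(r ^ (2 * form P (root c) (wt P a)) •
      (uK r (root c + root c) * parityPow P r (spar c) (u a) * uK r (-(root c + root c)) *
        eK r c)) := by
  have h : uK r (-(root c + root c)) * eK r c =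
      r ^ (-form P (root c) (root c)) • (uK r (-root c) * ue r c) := by
    rw [eK, ← mul_assoc, uK_mul_ue, uK_mul_ue, smul_mul_assoc, mul_assoc, ← uK_add, smul_smul,
      ← zpow_add₀ hr, form_neg_left, form_neg_left, form_add_left, neg_add]
    congr 3
    abel
  rw [rhoOp, Module.End.mul_apply, rmulCol_apply, rhoCartan_apply, smul_mul_assoc,
    mul_assoc _ _ (eK r c), h, mul_smul_comm, smul_smul, mul_assoc, ← neg_smul]
  congr 1
  ring

theorem vecOp_apply_arr {c : Simple P} {d a : Idx P} (h : Arr c d a) (u : Col P r) :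
    vecOp r c u a = mu r c a d • parityPow P r (spar c) (u d) := by
  refine (sum_piE_row h _).trans ?_
  rw [smul_smul, mu, mul_comm]

theorem vecOp_apply_zero {c : Simple P} {a : Idx P} (h : ∀ d, ¬ Arr c d a) (u : Col P r) :
    vecOp r c u a = 0 :=
  sum_piE_row_zero h _

/-- Left multiplication is an algebra homomorphism, and the Cartan part q-commutes with it by a
symmetric scalar. -/
theorem lamOp_serre (hr : r ≠ 0) : SerreFamily r (lamOp r : Simple P → Module.End ℂ (Col P r)) :=
  (SerreFamily.map (A := Uq P r) (B := Module.End ℂ (Col P r)) (ue_serre hr) (lmulCol P r)).twist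
    (T := lamCartan r)
    (fun b c => r ^ form P (root b) (root c))
    (fun b c => by rw [form_comm])
    (fun b c => LinearMap.ext fun u => funext fun a => by
      simp only [Module.End.mul_apply, lamCartan_apply]
      rw [mul_smul_comm, mul_smul_comm, smul_comm, ← mul_assoc, ← mul_assoc, uK_mul_comm])
    (fun b c => LinearMap.ext fun u => funext fun a => by
      simp only [Module.End.mul_apply, lamCartan_apply, lmulCol_apply, LinearMap.smul_apply,
        Pi.smul_apply]
      rw [← mul_assoc, uK_mul_ue, mul_smul_comm, smul_mul_assoc, mul_assoc, smul_comm])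

/-- Right multiplication is a homomorphism from the opposite algebra, hence the use of
`SerreFamily.op`; the parity signs only enter the symmetric twisting scalar. -/
theorem rhoOp_serre (hr : r ≠ 0) : SerreFamily r (rhoOp r : Simple P → Module.End ℂ (Col P r)) :=
  (SerreFamily.map (A := (Uq P r)ᵐᵒᵖ) (B := Module.End ℂ (Col P r)) (ue_serre hr).op
    (rmulCol P r)).twist (T := rhoCartan r)
    (fun b c => sgn (spar b * spar c) * r ^ form P (root b) (root c))
    (fun b c => by rw [form_comm, mul_comm (spar b)])
    (fun b c => LinearMap.ext fun u => funext fun a => by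
      simp only [Module.End.mul_apply, rhoCartan_apply]
      simp only [map_smul, map_mul, parityPow_uK, mul_smul_comm, smul_mul_assoc]
      rw [smul_comm, parityPow_comm]
      congr 2
      simp only [mul_assoc]
      rw [uK_mul_comm r (-root c), ← mul_assoc, uK_mul_comm, mul_assoc])
    (fun b c => LinearMap.ext fun u => funext fun a => by
      simp only [Module.End.mul_apply, rhoCartan_apply, rmulCol_apply, LinearMap.smul_apply,
        Pi.smul_apply]
      rw [map_mul, parityPow_ue, mul_smul_comm, mul_smul_comm, smul_mul_assoc, smul_mul_assoc,
        mul_assoc (uK r (root b + root b)), mul_assoc _ (ue r c), ue_mul_uK hr, form_neg_left,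
        neg_neg, mul_smul_comm, mul_smul_comm]
      simp only [smul_smul, mul_assoc]
      congr 1
      ring)

/-! ### Commutation of the three parts -/

/-- This and the next two lemmas supply the exchange rule of `SerreFamily.add`. The powers of r in
the three operators were chosen so that each pair gives exactly the factor `braid`; here it comes
from an edge shifting the weight by α_b, together with the parity twist of e_c. -/
theorem vecOp_lamOp (hr : r ≠ 0) (b c : Simple P) : vecOp r b * lamOp r c =
    braid r b c • (lamOp r c * vecOp r b) := LinearMap.ext fun u => funext fun a => by
  simp only [Module.End.mul_apply, LinearMap.smul_apply, Pi.smul_apply, lamOp_apply]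
  by_cases h : ∃ d, Arr b d a
  · obtain ⟨d, h⟩ := h
    rw [vecOp_apply_arr h, vecOp_apply_arr h, lamOp_apply, eK]
    simp only [map_smul, map_mul, parityPow_ue, parityPow_uK, mul_smul_comm, smul_mul_assoc,
      smul_smul, braid]
    congr 1
    have : r ^ (-(2 * form P (root c) (wt P d))) = r ^ (2 * form P (root b) (root c)) *
        r ^ (-(2 * form P (root c) (wt P a))) := by
      rw [← zpow_add₀ hr, h.wt_eq, form_add_right, form_comm (root b)]; congr 1; ring
    rw [this]; ring
  · push Not at h
    rw [vecOp_apply_zero h, vecOp_apply_zero h, mul_zero, smul_zero, smul_zero]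

theorem rhoOp_vecOp (hr : r ≠ 0) (b c : Simple P) : rhoOp r b * vecOp r c =
    braid r b c • (vecOp r c * rhoOp r b) := LinearMap.ext fun u => funext fun a => by
  simp only [Module.End.mul_apply, LinearMap.smul_apply, Pi.smul_apply, rhoOp_apply hr]
  by_cases h : ∃ d, Arr c d a
  · obtain ⟨d, h⟩ := h
    rw [vecOp_apply_arr h, vecOp_apply_arr h, rhoOp_apply hr, eK]
    simp only [map_smul, map_mul, map_neg, parityPow_ue, parityPow_uK, mul_smul_comm,
      smul_mul_assoc, smul_smul, braid, smul_neg, parityPow_comm r (spar c)]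
    congr 2
    have : r ^ (2 * form P (root b) (wt P a)) = r ^ (2 * form P (root b) (root c)) *
        r ^ (2 * form P (root b) (wt P d)) := by
      rw [← zpow_add₀ hr, h.wt_eq, form_add_right]; congr 1; ring
    rw [this, mul_comm (spar c)]
    linear_combination (-(r ^ (2 * form P (root b) (root c)) *
      r ^ (2 * form P (root b) (wt P d)) * mu r c a d)) * sgn_mul_self (spar b * spar c)
  · push Not at h
    rw [vecOp_apply_zero h, vecOp_apply_zero h]; simp

theorem rhoOp_lamOp (hr : r ≠ 0) (b c : Simple P) : rhoOp r b * lamOp r c =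
    braid r b c • (lamOp r c * rhoOp r b) := LinearMap.ext fun u => funext fun a => by
  simp only [Module.End.mul_apply, LinearMap.smul_apply, Pi.smul_apply, rhoOp_apply hr,
    lamOp_apply]
  have h : uK r (root b + root b) * eK r c =
      r ^ (2 * form P (root b) (root c)) • (eK r c * uK r (root b + root b)) := by
    rw [eK, ← mul_assoc, uK_mul_ue, smul_mul_assoc, mul_assoc, mul_assoc, uK_mul_comm,
      form_add_left, two_mul]
  have h' : parityPow P r (spar b) (eK r c) = sgn (spar b * spar c) • eK r c := by
    rw [eK, map_mul, parityPow_ue, parityPow_uK, smul_mul_assoc]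
  simp only [map_smul, map_mul, h', mul_smul_comm, smul_mul_assoc, ← mul_assoc, h, smul_smul, braid]
  have hneg : ∀ x y : Uq P r, x * -y = -(x * y) := fun x y => mul_neg x y
  rw [hneg, smul_neg, mul_smul_comm, smul_smul]
  simp only [← mul_assoc]
  congr 2
  ring

end Columns

/-! ### Short paths in the crystal graph -/

section Paths

variable {P : Params}

theorem Arr.self_comp {b : Simple P} {d e a : Idx P} (h1 : Arr b d e) (h2 : Arr b e a) :
    P.m % 2 = 1 ∧ b = Simple.last := by
  have hm := m_eq (P := P)
  have hb := node_lt b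
  have hl := node_last (P := P)
  suffices P.m % 2 = 1 ∧ node b + 1 = P.k + P.l from ⟨this.1, node_inj (by omega)⟩
  rw [arr_iff] at h1 h2
  omega

theorem Arr.not_sandwich {b c : Simple P} (h : Adj b c) {d e f a : Idx P} (h1 : Arr b d e)
    (h2 : Arr c e f) (h3 : Arr b f a) : False := by
  have hm := m_eq (P := P)
  have hb := node_lt b
  have hc := node_lt c
  rw [arr_iff] at h1 h2 h3
  unfold Adj at h
  rcases h with ⟨hp, h⟩ | ⟨hp, h⟩ <;> omega

/-- Consecutive edges carry adjacent or equal labels everywhere except on the diamond of the case m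
even, which this lemma locates. -/
theorem Arr.fork {b c : Simple P} (h : ¬ Adj b c) (hbc : b ≠ c) {d e a : Idx P} (h1 : Arr c d e)
    (h2 : Arr b e a) : P.m % 2 = 0 ∧ pos P d = P.k + P.l + 1 ∧ pos P a + 2 = P.k + P.l ∧
      ((node b + 1 = P.k + P.l ∧ node c + 2 = P.k + P.l ∧ pos P e = P.k + P.l) ∨
        (node c + 1 = P.k + P.l ∧ node b + 2 = P.k + P.l ∧ pos P e + 1 = P.k + P.l)) := by
  have hm := m_eq (P := P)
  have hb := node_lt b
  have hc := node_lt c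
  have hn : node b ≠ node c := fun h => hbc (node_inj h)
  rw [arr_iff] at h1 h2
  have hp := Nat.mod_two_eq_zero_or_one P.m
  rcases hp with hp | hp
  · have h3 : ¬ (node b + 1 = node c ∧ node c + 1 < P.k + P.l) := fun h' => h (Or.inr ⟨hp, Or.inl h'⟩)
    have h4 : ¬ (node c + 1 = node b ∧ node b + 1 < P.k + P.l) := fun h' => h (Or.inr ⟨hp, Or.inr (Or.inl h')⟩)
    have h5 : ¬ (node b + 1 = P.k + P.l ∧ node c + 3 = P.k + P.l) :=
      fun h' => h (Or.inr ⟨hp, Or.inr (Or.inr (Or.inl h'))⟩)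
    have h6 : ¬ (node c + 1 = P.k + P.l ∧ node b + 3 = P.k + P.l) :=
      fun h' => h (Or.inr ⟨hp, Or.inr (Or.inr (Or.inr h'))⟩)
    clear h
    rcases h1 with ⟨x1, x2 | x2, x3⟩ | ⟨x0, x1, x2 | x2⟩ <;>
    rcases h2 with ⟨y1, y2 | y2, y3⟩ | ⟨y0, y1, y2 | y2⟩ <;> omega
  · have h3 : node b + 1 ≠ node c := fun h' => h (Or.inl ⟨hp, Or.inl h'⟩)
    have h4 : node c + 1 ≠ node b := fun h' => h (Or.inl ⟨hp, Or.inr h'⟩)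
    clear h
    exfalso
    rcases h1 with ⟨x1, x2 | x2, -⟩ | ⟨x0, -⟩ <;>
    rcases h2 with ⟨y1, y2 | y2, -⟩ | ⟨y0, -⟩ <;> omega

theorem Arr.cube {b : Simple P} {d e f a : Idx P} (h1 : Arr b d e)
    (h2 : Arr b e f) (h3 : Arr b f a) : False := by
  have hm := m_eq (P := P)
  have hb := node_lt b
  rw [arr_iff] at h1 h2 h3
  omega

theorem Arr.mu_ne_zero {r : ℂ} (hr : r ≠ 0) {c : Simple P} {d b : Idx P} (h : Arr c d b) :
    mu r c b d ≠ 0 :=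
  mul_ne_zero (mul_ne_zero (sgn_ne_zero _) (zpow_ne_zero _ hr)) h.piE_ne_zero

theorem par_row_col_of_even {c : Simple P} (h : P.k ≤ pos P (row c)) :
    par P (row c) = 0 ∧ par P (col c) = 0 := by
  have hm := m_eq (P := P)
  have hc := node_lt c
  have hl := one_le_l (P := P)
  rw [par_eq, par_eq]
  rcases pos_row_col c with ⟨h1, h2, h3⟩ | ⟨he, rfl, h1, h2⟩
  · rw [if_pos (by omega), if_pos (by omega)]; simp
  · rw [if_pos (by omega), if_pos (by omega)]; simp

theorem xi_of_par {a : Idx P} (h : par P a = 0) : xi P a = 1 := by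
  rcases a with i | j
  · rfl
  · exact absurd h (by simp [par])

theorem piE_bar_of_even {c : Simple P} (h : P.k ≤ pos P (row c)) :
    piE c (bar P (col c)) (bar P (row c)) = -1 := by
  obtain ⟨h1, h2⟩ := par_row_col_of_even h
  rw [piE_bar, h1, h2, xi_of_par h1, xi_of_par h2]
  simp [sgn_zero]

/-- The two ways through the fork of the crystal graph (`m` even) agree. -/
theorem Arr.mu_fork {r : ℂ} {b c : Simple P} (h : ¬ Adj b c) (hbc : b ≠ c)
    {d e a : Idx P} (h1 : Arr c d e) (h2 : Arr b e a) : ∃ e', Arr b d e' ∧ Arr c e' a ∧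
      mu r b a e * mu r c e d = mu r c a e' * mu r b e' d := by
  have hm := m_eq (P := P)
  have hl := node_last (P := P)
  have h2l : P.m % 2 = 0 → 2 ≤ P.l := two_le_l
  obtain ⟨hp, hd, ha, hh⟩ := Arr.fork h hbc h1 h2
  obtain ⟨e', h3, h4⟩ : ∃ e', Arr b d e' ∧ Arr c e' a := by
    rcases hh with ⟨hb, hc, he⟩ | ⟨hc, hb, he⟩
    · obtain ⟨e', he'⟩ := exists_pos (P := P) (p := P.k + P.l - 1) (by omega)
      exact ⟨e', (arr_iff _ _ _).2 (Or.inr ⟨hp, hb, Or.inr ⟨hd, by omega⟩⟩),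
        (arr_iff _ _ _).2 (Or.inl ⟨by omega, Or.inl (by omega), by omega⟩)⟩
    · obtain ⟨e', he'⟩ := exists_pos (P := P) (p := P.k + P.l) (by omega)
      exact ⟨e', (arr_iff _ _ _).2 (Or.inl ⟨by omega, Or.inr (by omega), by omega⟩),
        (arr_iff _ _ _).2 (Or.inr ⟨hp, hc, Or.inl ⟨he', ha⟩⟩)⟩
  refine ⟨e', h3, h4, ?_⟩
  -- Around the diamond, edges into its top have coefficient 1 and edges out of its bottom have
  -- coefficient -1, so both paths collect the same product. The powers of r agree because the two
  -- roots are orthogonal.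
  have key : ∀ {x : Simple P} {y z : Idx P}, P.k + P.l ≤ node x + 2 → Arr x y z →
      (pos P z + 2 = P.k + P.l → piE x z y = 1) ∧
      (pos P y = P.k + P.l + 1 → piE x z y = -1) := by
    intro x y z hx hxyz
    have h5 : pos P (row x) < pos P (col x) ∧ pos P (col x) ≤ P.k + P.l ∧
        P.k + P.l ≤ pos P (row x) + 2 := by
      have h6 := node_lt x
      rcases pos_row_col x with h5 | ⟨h5, rfl, h5'⟩ <;> omega
    have h7 := pos_bar (row x)
    have h8 := pos_bar (col x)
    clear hh h1 h2 h3 h4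
    rcases hxyz with ⟨rfl, rfl⟩ | ⟨rfl, rfl⟩
    · exact ⟨fun _ => piE_row_col x, fun hy => by omega⟩
    · refine ⟨fun hz => by omega, fun _ => piE_bar_of_even (by omega)⟩
  rw [mu, mu, mu, mu, (key (by omega) h2).1 ha, (key (by omega) h1).2 hd, (key (by omega) h4).1 ha,
    (key (by omega) h3).2 hd, h1.wt_eq, h3.wt_eq, form_add_right, form_add_right,
    form_root_of_not_adj h hbc, form_comm, form_comm (root c) (root b),
    form_root_of_not_adj h hbc, form_comm (wt P d)]
  simp only [add_zero]
  ring

end Paths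

/-! ### Serre relations for the vector part and for the whole adjoint action -/

section VecSerre

variable {P : Params} {r : ℂ}

theorem exists_arr_of_vecOp_ne {c : Simple P} {u : Col P r} {a : Idx P} (h : vecOp r c u a ≠ 0) :
    ∃ d, Arr c d a ∧ u d ≠ 0 := by
  by_cases h' : ∃ d, Arr c d a
  · obtain ⟨d, hd⟩ := h'
    refine ⟨d, hd, fun h0 => h ?_⟩
    rw [vecOp_apply_arr hd, h0, map_zero, smul_zero]
  · push Not at h'
    exact absurd (vecOp_apply_zero h' u) h

theorem vecOp_mul_self {b : Simple P} (h : P.m % 2 = 1 → b ≠ Simple.last) :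
    vecOp r b * vecOp r b = 0 := LinearMap.ext fun u => funext fun a => by
  by_contra hne
  obtain ⟨e, h1, h2⟩ := exists_arr_of_vecOp_ne hne
  obtain ⟨d, h3, -⟩ := exists_arr_of_vecOp_ne h2
  obtain ⟨h4, h5⟩ := h3.self_comp h1
  exact h h4 h5

theorem vecOp_cube (b : Simple P) : vecOp r b * (vecOp r b * vecOp r b) = 0 :=
  LinearMap.ext fun u => funext fun a => by
  by_contra hne
  obtain ⟨f, h1, h2⟩ := exists_arr_of_vecOp_ne hne
  obtain ⟨e, h3, h4⟩ := exists_arr_of_vecOp_ne h2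
  obtain ⟨d, h5, -⟩ := exists_arr_of_vecOp_ne h4
  exact h5.cube h3 h1

theorem vecOp_sandwich {b c : Simple P} (h : Adj b c) : vecOp r b * (vecOp r c * vecOp r b) = 0 :=
  LinearMap.ext fun u => funext fun a => by
  by_contra hne
  obtain ⟨f, h1, h2⟩ := exists_arr_of_vecOp_ne hne
  obtain ⟨e, h3, h4⟩ := exists_arr_of_vecOp_ne h2
  obtain ⟨d, h5, -⟩ := exists_arr_of_vecOp_ne h4
  exact Arr.not_sandwich h h5 h3 h1

theorem vecOp_comm_apply {b c : Simple P} (h : ¬ Adj b c) (hbc : b ≠ c) (u : Col P r)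
    (a : Idx P) (hne : vecOp r b (vecOp r c u) a ≠ 0) :
    vecOp r b (vecOp r c u) a = vecOp r c (vecOp r b u) a := by
  obtain ⟨e, h1, h2⟩ := exists_arr_of_vecOp_ne hne
  obtain ⟨d, h3, -⟩ := exists_arr_of_vecOp_ne h2
  obtain ⟨e', h4, h5, h6⟩ := Arr.mu_fork (r := r) h hbc h3 h1
  rw [vecOp_apply_arr h1, vecOp_apply_arr h3, vecOp_apply_arr h5, vecOp_apply_arr h4, map_smul,
    map_smul, smul_smul, smul_smul, h6, parityPow_comm]

theorem vecOp_comm {b c : Simple P} (h : ¬ Adj b c) (hbc : b ≠ c) :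
    vecOp r b * vecOp r c = vecOp r c * vecOp r b := LinearMap.ext fun u => funext fun a => by
  by_cases h1 : vecOp r b (vecOp r c u) a = 0
  · by_cases h2 : vecOp r c (vecOp r b u) a = 0
    · exact h1.trans h2.symm
    · exact (vecOp_comm_apply (fun h' => h h'.symm) hbc.symm u a h2).symm
  · exact vecOp_comm_apply h hbc u a h1

/-- For adjacent labels each word in a relation contains a pattern that is not a path of the crystal
graph, so every term vanishes separately. Non-adjacent labels commute because the only nonzero
products run through the diamond. -/
theorem vecOp_serre :
    SerreFamily r (vecOp r : Simple P → Module.End ℂ (Col P r)) where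
  comm b c h hbc := vecOp_comm h hbc
  cubic b c h hs hl := by
    rw [← mul_assoc, vecOp_mul_self hl, vecOp_sandwich h]; simp
  quartic b c h hm hb := by
    have h1 := vecOp_sandwich (r := r) h
    have h2 := vecOp_cube (r := r) b
    have h3 : vecOp r b * (vecOp r b * (vecOp r b * vecOp r c)) = 0 := by
      rw [← mul_assoc (vecOp r b) (vecOp r b) (vecOp r c), ← mul_assoc, h2, zero_mul]
    have h4 : vecOp r b * (vecOp r c * (vecOp r b * vecOp r b)) = 0 := by
      rw [← mul_assoc (vecOp r c), ← mul_assoc, h1, zero_mul]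
    rw [h1, h2, h3, h4]; simp
  sq := vecOp_mul_self (by simp)
  extra s b c hs hb hc hb' hc' := by
    have h1 := vecOp_sandwich (r := r) hb
    have h2 := vecOp_sandwich (r := r) hc
    obtain ⟨h3, h4⟩ := not_adj_of_sides hs hb' hc'
    have h5 : vecOp r b * (vecOp r c * vecOp r s) = 0 :=
      LinearMap.ext fun u => funext fun a => by
      have hm := m_eq (P := P)
      have hns := node_s (P := P)
      rw [← hs] at hns
      by_contra hne
      obtain ⟨f, h1, h2⟩ := exists_arr_of_vecOp_ne hne
      obtain ⟨e, h5, h6⟩ := exists_arr_of_vecOp_ne h2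
      have := Arr.fork h3 h4 h5 h1
      have : P.m % 2 = 0 → 2 ≤ P.l := two_le_l
      omega
    have h6 : vecOp r s * (vecOp r b * (vecOp r s * vecOp r c)) = 0 := by
      rw [← mul_assoc (vecOp r b), ← mul_assoc, h1, zero_mul]
    have h7 : vecOp r s * (vecOp r c * (vecOp r s * vecOp r b)) = 0 := by
      rw [← mul_assoc (vecOp r c), ← mul_assoc, h2, zero_mul]
    rw [h1, h2, h5, h6, h7]; simp

/-- The vector part is added to left multiplication, then right multiplication to their sum; its
exchange factor with both summands is the same. -/
theorem adOp_serre (hr : r ≠ 0) :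
    SerreFamily r (adOp r : Simple P → Module.End ℂ (Col P r)) :=
  (((lamOp_serre hr).add hr vecOp_serre (vecOp_lamOp hr)).add hr (rhoOp_serre hr)
    fun b c => by
      rw [Pi.add_apply, mul_add, add_mul, rhoOp_lamOp hr, rhoOp_vecOp hr, smul_add])

end VecSerre

/-! ### Modules generated by a lowest weight vector -/

section Steps

variable {P : Params} {M : Type*} [AddCommGroup M] [Module ℂ M] {r : ℂ}
  {E : Simple P → Module.End ℂ M}

theorem SerreFamily.step_comm (hE : SerreFamily r E) {c d : Simple P} (hcd : c ≠ d)
    (h : ¬ Adj c d) {y : M} (hy : E c y = 0) : E c (E d y) = 0 := by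
  have := LinearMap.congr_fun (hE.comm c d h hcd) y
  rw [Module.End.mul_apply, Module.End.mul_apply, hy, map_zero] at this
  exact this

/-- Like its neighbours, this applies one Serre relation to a vector on which all terms but one are
already known to vanish. For the odd root e_s ^ 2 = 0 takes the place of the cubic relation. -/
theorem SerreFamily.step_self (hE : SerreFamily r E) {d c : Simple P} (h : Adj d c)
    (hd : P.m % 2 = 1 → d ≠ Simple.last) {y : M} (hy : E d y = 0) : E d (E d (E c y)) = 0 := by
  by_cases hs : d = Simple.s
  · subst hs
    have := LinearMap.congr_fun hE.sq (E c y)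
    exact this
  · have := LinearMap.congr_fun (hE.cubic d c h hs hd) y
    simpa [Module.End.mul_apply, hy] using this

/-- Only the middle term of the cubic relation survives, so its coefficient has to be invertible. -/
theorem SerreFamily.step_back (hE : SerreFamily r E) (hq : r ^ 2 + (r ^ 2)⁻¹ ≠ 0)
    {d c : Simple P} (h : Adj d c) (hs : d ≠ Simple.s)
    (hd : P.m % 2 = 1 → d ≠ Simple.last) {y : M} (hy : E c y = 0) (hy' : E d (E d y) = 0) :
    E d (E c (E d y)) = 0 := by
  have := LinearMap.congr_fun (hE.cubic d c h hs hd) y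
  simp only [Module.End.mul_apply, LinearMap.add_apply, LinearMap.sub_apply, LinearMap.smul_apply,
    hy, hy', map_zero, add_zero, zero_sub, LinearMap.zero_apply, neg_eq_zero] at this
  exact (smul_eq_zero.1 this).resolve_left hq

theorem SerreFamily.step_self_short (hE : SerreFamily r E) {d c : Simple P} (h : Adj d c)
    (hm : P.m % 2 = 1) (hd : d = Simple.last) {y : M} (hy : E d y = 0) :
    E d (E d (E d (E c y))) = 0 := by
  have := LinearMap.congr_fun (hE.quartic d c h hm hd) y
  simpa [Module.End.mul_apply, hy] using this

theorem SerreFamily.step_back_short (hE : SerreFamily r E) (hq : r ^ 2 + 1 + (r ^ 2)⁻¹ ≠ 0)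
    {d c : Simple P} (h : Adj d c) (hm : P.m % 2 = 1) (hd : d = Simple.last) {y : M}
    (hy : E c y = 0) (hy' : E c (E d y) = 0) (hy'' : E d (E d (E d y)) = 0) :
    E d (E c (E d (E d y))) = 0 := by
  have := LinearMap.congr_fun (hE.quartic d c h hm hd) y
  simp only [Module.End.mul_apply, LinearMap.add_apply, LinearMap.sub_apply, LinearMap.smul_apply,
    hy, hy', hy'', map_zero, zero_add, sub_zero, smul_zero, LinearMap.zero_apply] at this
  exact (smul_eq_zero.1 this).resolve_left hq

/-- Substitute for `SerreFamily.step_back` at the odd node, where no cubic relation is available.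
The extra relation is applied one edge further back, where four of its five terms vanish. -/
theorem SerreFamily.step_extra (hE : SerreFamily r E) {s b c : Simple P} (hs : s = Simple.s)
    (hb : Adj s b) (hc : Adj s c) (h : (node b < node s ∧ node s < node c) ∨
      (node c < node s ∧ node s < node b)) {y : M} (hy : E s y = 0) (hy' : E b y = 0) :
    E s (E b (E s (E c y))) = 0 := by
  rcases h with ⟨h1, h2⟩ | ⟨h1, h2⟩
  · have h3 := hE.step_comm (not_adj_of_sides hs h1 h2).2 (not_adj_of_sides hs h1 h2).1 hy'
    have := LinearMap.congr_fun (hE.extra s b c hs hb hc h1 h2) y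
    simpa [Module.End.mul_apply, hy, hy'] using this
  · have := LinearMap.congr_fun (hE.extra s c b hs hc hb h1 h2) y
    simpa [Module.End.mul_apply, hy, hy'] using this

end Steps

/-! ### The string of vectors above a lowest weight vector -/

section Chain

variable {P : Params}

variable (P) in
/-- The simple root with a given number. -/
def label (p : ℕ) : Simple P :=
  if h : p < P.k + P.l then (exists_node h).choose else Simple.s

theorem label_node (c : Simple P) : label P (node c) = c := by
  rw [label, dif_pos (node_lt c)]
  exact node_inj (exists_node (node_lt c)).choose_spec

variable {M : Type*} [AddCommGroup M] [Module ℂ M] {r : ℂ} (E : Simple P → Module.End ℂ M) (z : M)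

/-- The vectors obtained from a lowest weight vector by following the crystal graph upwards. -/
def chain : ℕ → M
  | 0 => z
  | 1 => E (label P 0) z
  | n + 2 =>
    -- For m even, vector number k + l is the second branch of the fork, so it starts two places
    -- back. Otherwise the labels run up the diagram and back down, which is what the minimum
    -- expresses.
    if P.m % 2 = 0 ∧ n + 2 = P.k + P.l then E Simple.last (chain n)
    else E (label P (min (n + 1) (P.m + 2 * P.k - 2 - (n + 1)))) (chain (n + 1))

/-- The generator `e_c` does not kill the `n`-th vector of the chain. -/
def Out (c : Simple P) (n : ℕ) : Prop :=
  ((node c = n ∨ node c + n + 2 = P.m + 2 * P.k) ∧ (P.m % 2 = 0 → node c + 1 < P.k + P.l)) ∨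
  (P.m % 2 = 0 ∧ node c + 1 = P.k + P.l ∧ (n + 2 = P.k + P.l ∨ n + 1 = P.k + P.l))

theorem chain_succ {d : Simple P} {n : ℕ} (h : node d = n ∨ node d + n + 2 = P.m + 2 * P.k)
    (h' : P.m % 2 = 0 → node d + 1 < P.k + P.l) : chain E z (n + 1) = E d (chain E z n) := by
  have hm := m_eq (P := P)
  have hd := node_lt d
  have hl := one_le_l (P := P)
  have hk := P.k_pos
  rcases n with _ | n
  · have : node d = 0 := by omega
    rw [← label_node d, this]; rfl
  · rw [chain, if_neg (by omega)]
    have : min (n + 1) (P.m + 2 * P.k - 2 - (n + 1)) = node d := by omega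
    rw [this, label_node]

theorem chain_fork (hm2 : P.m % 2 = 0) {d : Simple P} {n : ℕ} (h : node d + 1 = P.k + P.l)
    (h' : n + 2 = P.k + P.l) : chain E z (n + 2) = E d (chain E z n) := by
  have : d = Simple.last := node_inj (by have := node_last (P := P); omega)
  rw [chain, if_pos ⟨hm2, h'⟩, this]

end Chain

/-! ### Generators without an outgoing edge kill the string -/

section ChainKill

variable {P : Params} {M : Type*} [AddCommGroup M] [Module ℂ M] {r : ℂ}
  {E : Simple P → Module.End ℂ M} {z : M}

/-- The condition on a lowest weight vector that it generates a copy of the vector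
representation. -/
structure IsLowest (E : Simple P → Module.End ℂ M) (z : M) : Prop where
  kill (c : Simple P) (h : node c ≠ 0) : E c z = 0
  sq (c : Simple P) (h : node c = 0) (hc : c ≠ Simple.s) : E c (E c z) = 0
  sandwich (s c : Simple P) (hs : s = Simple.s) (hk : P.k = 1) (h : Adj s c) :
    E s (E c (E s z)) = 0

/-- One step up in the chain, away from the short root. -/
theorem SerreFamily.chain_step (hE : SerreFamily r E) (hq : r ^ 2 + (r ^ 2)⁻¹ ≠ 0)
    {c d d' : Simple P} {y : M} (hdd : Adj d d') (hd : P.m % 2 = 1 → c = d → d ≠ Simple.last)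
    (hd' : P.m % 2 = 1 → Adj c d → d' ≠ Simple.last) (hy : E d y = 0)
    (hy' : Adj c d → E d' (E d' y) = 0) (hs : d' = Simple.s → Adj c d → E d' (E d (E d' y)) = 0)
    (hc : c ≠ d → ¬ Adj c d → E c (E d' y) = 0) (hadj : Adj c d → c = d') :
    E c (E d (E d' y)) = 0 := by
  by_cases h1 : c = d
  · subst h1
    exact hE.step_self hdd (fun h => hd h rfl) hy
  · by_cases h2 : Adj c d
    · obtain rfl := hadj h2
      by_cases h3 : c = Simple.s
      · exact hs h3 h2
      · exact hE.step_back hq h2 h3 (fun h => hd' h h2) hy (hy' h2)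
    · exact hE.step_comm h1 h2 (hc h1 h2)

/-- The chain property for `m` odd. -/
theorem SerreFamily.chain_odd (hE : SerreFamily r E) (hq : r ^ 2 + (r ^ 2)⁻¹ ≠ 0)
    (hq3 : r ^ 2 + 1 + (r ^ 2)⁻¹ ≠ 0) (hz : IsLowest E z) (hp : P.m % 2 = 1) (n : ℕ) :
    n < P.m + 2 * P.k → ∀ c : Simple P, ¬ (node c = n ∨ node c + n + 2 = P.m + 2 * P.k) →
      E c (chain E z n) = 0 := by
  have hm := m_eq (P := P)
  have hl := one_le_l (P := P)
  have hk := P.k_pos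
  have hns := node_s (P := P)
  have hnl := node_last (P := P)
  have hadj : ∀ c d : Simple P, Adj c d ↔ (node c + 1 = node d ∨ node d + 1 = node c) := by
    intro c d
    unfold Adj; omega
  have hsucc : ∀ {d : Simple P} {n : ℕ}, (node d = n ∨ node d + n + 2 = P.m + 2 * P.k) →
      chain E z (n + 1) = E d (chain E z n) := fun h => chain_succ E z h (by omega)
  have hlast : ∀ d : Simple P, d ≠ Simple.last → node d + 1 ≠ P.k + P.l :=
    fun d h h' => h (node_inj (by omega))
  induction n using Nat.strong_induction_on with
  | _ n ih =>
  intro hn c hc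
  have hcl := node_lt c
  rcases n with _ | _ | n
  · exact hz.kill c (by omega)
  · obtain ⟨d, hd⟩ := exists_node (P := P) (p := 0) (by omega)
    rw [hsucc (Or.inl hd)]
    change E c (E d z) = 0
    by_cases hcd : c = d
    · subst hcd
      by_cases hs : c = Simple.s
      · subst hs; exact LinearMap.congr_fun hE.sq z
      · exact hz.sq c hd hs
    · have : node c ≠ node d := fun h => hcd (node_inj h)
      exact hE.step_comm hcd (by rw [hadj]; omega) (hz.kill c (by omega))
  · obtain ⟨d', hd'⟩ := exists_node (P := P) (p := min n (P.m + 2 * P.k - 2 - n)) (by omega)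
    obtain ⟨d, hd⟩ := exists_node (P := P) (p := min (n + 1) (P.m + 2 * P.k - 2 - (n + 1)))
      (by omega)
    have ih0 := ih n (by omega) (by omega)
    have ih1 := ih (n + 1) (by omega) (by omega)
    have e1 : chain E z (n + 1) = E d' (chain E z n) := hsucc (by omega)
    have e2 : chain E z (n + 1 + 1) = E d (chain E z (n + 1)) := hsucc (by omega)
    -- In the middle the short label is used twice in a row, so a third application is excluded by
    -- the quartic relation.
    by_cases hmid : n + 1 = P.k + P.l
    · have hdl : d = Simple.last := node_inj (by omega)
      have hdd : d' = d := node_inj (by omega)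
      by_cases hcd : c = d
      · obtain ⟨n, rfl⟩ : ∃ n', n = n' + 1 := ⟨n - 1, by omega⟩
        obtain ⟨d'', hd''⟩ := exists_node (P := P) (p := n) (by omega)
        rw [e2, e1, hdd, hcd, hsucc (Or.inl hd'')]
        exact hE.step_self_short (by rw [hadj]; omega) hp hdl
          (ih n (by omega) (by omega) d (by omega))
      · have hncd : node c ≠ node d := fun h => hcd (node_inj h)
        rw [e2]
        exact hE.step_comm hcd (by rw [hadj]; omega) (ih1 c (by omega))
    · rw [e2, e1]
      -- Just past the middle, going back to the short label again needs the quartic relation,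
      -- applied to the vector before the two short steps.
      by_cases hback : Adj c d ∧ d' = Simple.last
      · obtain ⟨h1, h2⟩ := hback
        have hcd' : c = d' := node_inj (by rw [hadj] at h1; subst h2; omega)
        obtain ⟨n, rfl⟩ : ∃ n', n = n' + 1 := ⟨n - 1, by subst h2; omega⟩
        have hn : n + 1 = P.k + P.l := by subst h2; omega
        have e0 : chain E z (n + 1) = E d' (chain E z n) := hsucc (by omega)
        rw [hcd'] at h1 ⊢
        rw [e0]
        refine hE.step_back_short hq3 h1 hp h2 (ih n (by omega) (by omega) d (by omega)) ?_ ?_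
        · rw [← e0]; exact ih0 d (by omega)
        · rw [← e0, ← e1]; exact ih1 d' (by omega)
      · have hncd : c ≠ d → node c ≠ node d := fun h h' => h (node_inj h')
        refine hE.chain_step hq (by rw [hadj]; omega) ?_ ?_ (ih0 d (by omega)) ?_ ?_ ?_ ?_
        · rintro - rfl rfl; omega
        · intro _ h1 h2; exact hback ⟨h1, h2⟩
        · intro h
          rw [← e1]
          have h2 := hlast d' fun h2 => hback ⟨h, h2⟩
          refine ih1 d' ?_
          omega
        · intro hs hcd
          -- When the string starts with the odd label (k = 1) there is no earlier vector, and the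
          -- condition is part of the lowest weight hypothesis. Otherwise the extra relation is
          -- applied to the preceding vector.
          rcases n with _ | n
          · rw [hs] at hd' ⊢
            exact hz.sandwich _ d rfl (by omega) (by rw [hadj]; omega)
          · obtain ⟨d'', hd''⟩ := exists_node (P := P) (p := min n (P.m + 2 * P.k - 2 - n))
              (by omega)
            have e0 : chain E z (n + 1) = E d'' (chain E z n) := hsucc (by omega)
            rw [e0]
            have ih3 := ih n (by omega) (by omega)
            have hns' := hns
            rw [← hs] at hns'
            exact hE.step_extra hs (by rw [hadj]; omega) (by rw [hadj]; omega) (by omega)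
              (ih3 d' (by omega)) (ih3 d (by omega))
        · intro h1 h2
          have := hncd h1
          rw [hadj] at h2
          rw [← e1]
          exact ih1 c (by omega)
        · intro h
          rw [hadj] at h
          exact node_inj (by omega)

theorem two_mul_of_even (hp : P.m % 2 = 0) {N : ℕ} (hN : N = P.k + P.l) : P.m + 2 * P.k = 2 * N := by
  have := m_eq (P := P)
  omega

theorem adj_iff_of_even (hp : P.m % 2 = 0) {N : ℕ} (hN : N = P.k + P.l) (c d : Simple P) : Adj c d ↔ ((node c + 1 = node d ∧ node d + 1 < N) ∨
    (node d + 1 = node c ∧ node c + 1 < N) ∨ (node c + 1 = N ∧ node d + 3 = N) ∨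
    (node d + 1 = N ∧ node c + 3 = N)) := by
  unfold Adj; omega

theorem out_low (hp : P.m % 2 = 0) {N : ℕ} (hN : N = P.k + P.l) (c : Simple P) {n : ℕ} (hn : n < N) :
    Out c n ↔ node c = n ∨ (n + 2 = N ∧ node c + 1 = N) := by
  have := two_mul_of_even hp hN
  have := node_lt c
  unfold Out; omega

theorem out_high (hp : P.m % 2 = 0) {N : ℕ} (hN : N = P.k + P.l) (c : Simple P) {n : ℕ} (hn : N ≤ n) :
    Out c n ↔ node c + n + 2 = 2 * N := by
  have := two_mul_of_even hp hN
  have := node_lt c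
  unfold Out; omega

theorem chain_up (hp : P.m % 2 = 0) {N : ℕ} (hN : N = P.k + P.l) {d : Simple P} {n : ℕ}
    (h : node d = n) (hn : n + 1 < N) :
    chain E z (n + 1) = E d (chain E z n) := by
  have := two_mul_of_even hp hN
  exact chain_succ E z (by omega) (by omega)

theorem chain_down (hp : P.m % 2 = 0) {N : ℕ} (hN : N = P.k + P.l) {d : Simple P} {n : ℕ}
    (h : node d + n + 2 = 2 * N) (hn : N ≤ n) :
    chain E z (n + 1) = E d (chain E z n) := by
  have := two_mul_of_even hp hN
  exact chain_succ E z (by omega) (by omega)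

theorem node_s_add_two_lt (hp : P.m % 2 = 0) {N : ℕ} (hN : N = P.k + P.l) :
    node (Simple.s : Simple P) + 2 < N := by
  have := two_le_l (P := P) hp
  have := node_s (P := P)
  omega

-- Treats the lower half of the string, up to and including both branches of the fork: the vector in
-- question is number p + 2, or number k + l reached by the last label.
set_option maxHeartbeats 600000 in
theorem SerreFamily.chain_even_up (hp : P.m % 2 = 0) {N : ℕ} (hN : N = P.k + P.l)
    (hE : SerreFamily r E) (hq : r ^ 2 + (r ^ 2)⁻¹ ≠ 0)
    (hz : IsLowest E z) {p : ℕ}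
    (ih : ∀ n, n < p + 2 → ∀ c : Simple P, ¬ Out c n → E c (chain E z n) = 0)
    {c d d' : Simple P} (hd' : node d' = p)
    (hd : (node d = p + 1 ∧ p + 2 < N) ∨ (node d + 1 = N ∧ p + 3 = N))
    (hc : p + 3 ≠ N → node c ≠ p + 2) (hc1 : p + 3 = N → node d = p + 1 → node c ≠ p + 2)
    (hc'' : p + 4 = N → node c + 1 ≠ N) (hc' : p + 3 = N → node c = node d ∨ node c + 2 < N) :
    E c (E d (E d' (chain E z p))) = 0 := by
  have hA := adj_iff_of_even hp hN
  have hks := node_s_add_two_lt hp hN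
  have hcl : node c < N := hN ▸ node_lt c
  have e1 : chain E z (p + 1) = E d' (chain E z p) := chain_up hp hN hd' (by omega)
  have o0 : ∀ c : Simple P, node c ≠ p → E c (chain E z p) = 0 := fun c h =>
    ih p (by omega) c (by rw [out_low hp hN c (by omega)]; omega)
  have o1 : ∀ c : Simple P, node c ≠ p + 1 → (p + 3 = N → node c + 1 ≠ N) →
      E c (chain E z (p + 1)) = 0 := fun c h h' =>
    ih (p + 1) (by omega) c (by rw [out_low hp hN c (by omega)]; omega)
  refine hE.chain_step hq (by rw [hA]; omega) (by omega) (by omega) (o0 d (by omega)) ?_ ?_ ?_ ?_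
  · intro _
    rw [← e1]
    exact o1 d' (by omega) (by omega)
  · intro hs _
    rcases p with _ | p
    · subst hs
      have := node_s (P := P)
      exact hz.sandwich _ d rfl (by omega) (by rw [hA]; omega)
    · obtain ⟨d'', hd''⟩ := exists_node (P := P) (p := p) (by omega)
      have om : ∀ c : Simple P, node c ≠ p → E c (chain E z p) = 0 := fun c h =>
        ih p (by omega) c (by rw [out_low hp hN c (by omega)]; omega)
      rw [chain_up hp hN hd'' (by omega)]
      rw [← hs] at hks
      exact hE.step_extra hs (by rw [hA]; omega) (by rw [hA]; omega) (by omega)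
        (om d' (by omega)) (om d (by omega))
  · intro h1 h2
    have h3 : node c ≠ node d := fun h => h1 (node_inj h)
    rw [hA] at h2
    rw [← e1]
    exact o1 c (by omega) (by omega)
  · intro h
    rw [hA] at h
    exact node_inj (by omega)

/-- Beyond the fork the labels descend through the diagram, and the reasoning of the lower half
applies in the reverse direction. -/
theorem SerreFamily.chain_even_down (hp : P.m % 2 = 0) {N : ℕ} (hN : N = P.k + P.l)
    (hE : SerreFamily r E) (hq : r ^ 2 + (r ^ 2)⁻¹ ≠ 0)
    {p : ℕ}
    (ih : ∀ n, n < p + 2 → ∀ c : Simple P, ¬ Out c n → E c (chain E z n) = 0)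
    (hNp : N ≤ p) {c d d' : Simple P} (hd' : node d' + p + 2 = 2 * N) (hd : node d + p + 3 = 2 * N)
    (hc : node c + p + 4 ≠ 2 * N) (hc' : p = N → node c + 1 < N) :
    E c (E d (E d' (chain E z p))) = 0 := by
  have hA := adj_iff_of_even hp hN
  have hks := node_s_add_two_lt hp hN
  have hcl : node c < N := hN ▸ node_lt c
  have e1 : chain E z (p + 1) = E d' (chain E z p) := chain_down hp hN hd' hNp
  have o0 : ∀ c : Simple P, node c + p + 2 ≠ 2 * N → E c (chain E z p) = 0 := fun c h =>
    ih p (by omega) c (by rw [out_high hp hN c (by omega)]; omega)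
  have o1 : ∀ c : Simple P, node c + p + 3 ≠ 2 * N → E c (chain E z (p + 1)) = 0 := fun c h =>
    ih (p + 1) (by omega) c (by rw [out_high hp hN c (by omega)]; omega)
  refine hE.chain_step hq (by rw [hA]; omega) (by omega) (by omega) (o0 d (by omega)) ?_ ?_ ?_ ?_
  · intro _
    rw [← e1]
    exact o1 d' (by omega)
  · intro hs _
    rw [← hs] at hks
    obtain ⟨p, rfl⟩ : ∃ p', p = p' + 1 := ⟨p - 1, by omega⟩
    obtain ⟨d'', hd''⟩ := exists_node (P := P) (p := node d' + 1) (by omega)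
    have om : ∀ c : Simple P, node c + p + 2 ≠ 2 * N → E c (chain E z p) = 0 := fun c h =>
      ih p (by omega) c (by rw [out_high hp hN c (by omega)]; omega)
    rw [chain_down hp hN (n := p) (d := d'') (by omega) (by omega)]
    exact hE.step_extra hs (by rw [hA]; omega) (by rw [hA]; omega) (by omega)
      (om d' (by omega)) (om d (by omega))
  · intro h1 h2
    have h3 : node c ≠ node d := fun h => h1 (node_inj h)
    rw [hA] at h2
    rw [← e1]
    exact o1 c (by omega)
  · intro h
    rw [hA] at h
    exact node_inj (by omega)

/-- At the vector where the two branches meet again, the two fork labels commute, so it may be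
reached through either branch and the convenient one is chosen according to c. -/
theorem SerreFamily.chain_even_mid (hp : P.m % 2 = 0) {N : ℕ} (hN : N = P.k + P.l)
    (hE : SerreFamily r E) {p : ℕ} (hpN : p + 2 = N)
    (ih : ∀ n, n < N + 1 → ∀ c : Simple P, ¬ Out c n → E c (chain E z n) = 0)
    {a b c : Simple P} (ha : node a + 2 = N) (hb : node b + 1 = N) (hc : node c + 3 ≠ N) :
    E c (E a (E b (chain E z p))) = 0 := by
  have hA := adj_iff_of_even hp hN
  have hcl : node c < N := hN ▸ node_lt c
  have hab : a ≠ b := by rintro rfl; omega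
  have h1 := LinearMap.congr_fun (hE.comm a b (by rw [hA]; omega) hab) (chain E z p)
  rw [Module.End.mul_apply, Module.End.mul_apply] at h1
  have e1 : chain E z (p + 2) = E b (chain E z p) := chain_fork E z hp (by omega) (by omega)
  have e2 : chain E z (p + 1) = E a (chain E z p) := chain_up hp hN (by omega) (by omega)
  by_cases hca : c = a
  · subst hca
    rw [h1]
    exact hE.step_comm hab (by rw [hA]; omega) (by
      rw [← e2]; exact ih _ (by omega) _ (by rw [out_low hp hN _ (by omega)]; omega))
  · have : node c ≠ node a := fun h => hca (node_inj h)
    refine hE.step_comm hca (by rw [hA]; omega) ?_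
    rw [← e1]
    exact ih _ (by omega) _ (by rw [out_high hp hN _ (by omega)]; omega)

/-- The chain property for `m` even. -/
theorem SerreFamily.chain_even (hp : P.m % 2 = 0) {N : ℕ} (hN : N = P.k + P.l)
    (hE : SerreFamily r E) (hq : r ^ 2 + (r ^ 2)⁻¹ ≠ 0)
    (hz : IsLowest E z) (n : ℕ) :
    n < 2 * N → ∀ c : Simple P, ¬ Out c n → E c (chain E z n) = 0 := by
  have hA := adj_iff_of_even hp hN
  have hks := node_s_add_two_lt hp hN
  have hnode : ∀ p, p < N → ∃ c : Simple P, node c = p := fun p h => exists_node (by omega)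
  have hne : ∀ {c d : Simple P}, c ≠ d → node c ≠ node d := fun h h' => h (node_inj h')
  induction n using Nat.strong_induction_on with
  | _ n ih =>
  intro hn c hc
  have ih : ∀ n' < n, ∀ c : Simple P, ¬ Out c n' → E c (chain E z n') = 0 :=
    fun n' h => ih n' h (by omega)
  have hcl : node c < N := hN ▸ node_lt c
  by_cases hlow : n < N
  · rw [out_low hp hN c hlow] at hc
    rcases n with _ | _ | n
    · exact hz.kill c (by omega)
    · obtain ⟨d, hd⟩ := hnode 0 (by omega)
      rw [chain_up hp hN hd (by omega)]
      change E c (E d z) = 0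
      by_cases hcd : c = d
      · subst hcd
        by_cases hs : c = Simple.s
        · subst hs; exact LinearMap.congr_fun hE.sq z
        · exact hz.sq c hd hs
      · have := hne hcd
        exact hE.step_comm hcd (by rw [hA]; omega) (hz.kill c (by omega))
    · obtain ⟨d, hd⟩ := hnode (n + 1) (by omega)
      obtain ⟨d', hd'⟩ := hnode n (by omega)
      rw [chain_up hp hN hd (by omega), chain_up hp hN hd' (by omega)]
      exact hE.chain_even_up hp hN hq hz ih hd' (by omega) (by omega) (by omega)
        (by omega) (by omega)
  · rw [out_high hp hN c (by omega)] at hc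
    obtain ⟨b, hb⟩ := hnode (N - 1) (by omega)
    obtain ⟨a, ha⟩ := hnode (N - 2) (by omega)
    obtain ⟨n, rfl⟩ : ∃ n', n = n' + 3 := ⟨n - 3, by omega⟩
    by_cases h0 : n + 3 = N
    · obtain ⟨d', hd'⟩ := hnode n (by omega)
      rw [chain_fork E z hp (n := n + 1) (d := b) (by omega) (by omega),
        chain_up hp hN hd' (by omega)]
      exact hE.chain_even_up hp hN hq hz (fun n' h => ih n' (by omega)) hd' (by omega) (by omega)
        (by omega) (by omega) (by omega)
    · by_cases h1 : n + 2 = N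
      · rw [chain_down hp hN (n := n + 2) (d := a) (by omega) (by omega),
          chain_fork E z hp (d := b) (by omega) (by omega)]
        exact hE.chain_even_mid hp hN h1 (fun n' h => ih n' (by omega)) (by omega) (by omega)
          (by omega)
      · obtain ⟨d, hd⟩ := hnode (2 * N - 2 - (n + 2)) (by omega)
        obtain ⟨d', hd'⟩ := hnode (2 * N - 2 - (n + 1)) (by omega)
        have hd : node d + n + 4 = 2 * N := by omega
        have hd' : node d' + n + 3 = 2 * N := by omega
        have e1 : chain E z (n + 2) = E d' (chain E z (n + 1)) :=
          chain_down hp hN (by omega) (by omega)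
        rw [chain_down hp hN (n := n + 2) (d := d) (by omega) (by omega)]
        -- The last label just above the diamond: the vector where the branches meet is rewritten as
        -- obtained by c itself, through the other branch, so that the cubic relation applies.
        by_cases hcb : n + 1 = N ∧ node c + 1 = N
        · obtain ⟨hnN, hcN⟩ := hcb
          obtain ⟨n, rfl⟩ : ∃ n', n = n' + 1 := ⟨n - 1, by omega⟩
          have e0 : chain E z (n + 1) = E d' (chain E z n) := chain_up hp hN (by omega) (by omega)
          have hbd : c ≠ d' := by rintro rfl; omega
          have hcc := LinearMap.congr_fun (hE.comm c d' (by rw [hA]; omega) hbd) (chain E z n)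
          rw [Module.End.mul_apply, Module.End.mul_apply] at hcc
          have e3 : chain E z (n + 3) = E c (chain E z (n + 1)) := by
            rw [e1, e0, chain_fork E z hp (d := c) (by omega) (by omega), hcc]
          have h2 := ih (n + 3) (by omega) c (by rw [out_high hp hN _ (by omega)]; omega)
          change E c (E d (chain E z (n + 3))) = 0
          rw [e3] at h2 ⊢
          exact hE.step_back hq (by rw [hA]; omega) (by rintro rfl; omega) (by omega)
            (ih (n + 1) (by omega) d (by rw [out_low hp hN _ (by omega)]; omega)) h2
        · rw [e1]
          exact hE.chain_even_down hp hN hq ih (by omega) (by omega) (by omega) (by omega)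
            (by omega)

end ChainKill

/-! ### The vector representation inside a module -/

section Vector

variable {P : Params} {M : Type*} [AddCommGroup M] [Module ℂ M] {r : ℂ}
  {E : Simple P → Module.End ℂ M} {z : M}

theorem Arr.label_unique {c c' : Simple P} {d b : Idx P} (h : Arr c d b) (h' : Arr c' d b) :
    c = c' := by
  have hm := m_eq (P := P)
  have hc := node_lt c
  have hc' := node_lt c'
  have hl := one_le_l (P := P)
  rw [arr_iff] at h h'
  exact node_inj (by omega)

/-- Only the top of the diamond has two incoming edges; `g` is its bottom. -/
theorem Arr.eq_or_fork {c c' : Simple P} {d d' b : Idx P} (h : Arr c d b) (h' : Arr c' d' b) :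
    (c = c' ∧ d = d') ∨ (¬ Adj c c' ∧ c ≠ c' ∧ ∃ g, Arr c' g d ∧ Arr c g d') := by
  by_cases hd : d = d'
  · subst hd
    exact Or.inl ⟨h.label_unique h', rfl⟩
  · right
    have hm := m_eq (P := P)
    have hl := one_le_l (P := P)
    have hk := P.k_pos
    have hc := node_lt c
    have hc' := node_lt c'
    have hd : pos P d ≠ pos P d' := fun h => hd (pos_inj.1 h)
    rw [arr_iff] at h h'
    obtain ⟨g, hg⟩ := exists_pos (P := P) (p := P.k + P.l + 1) (by omega)
    refine ⟨by unfold Adj; omega, by rintro rfl; omega, g, ?_, ?_⟩ <;> rw [arr_iff] <;> omega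

/-- A rescaling of the basis of the vector representation which turns its structure constants
into those of `mu`. -/
theorem exists_rescaling (hr : r ≠ 0) : ∃ θ : Idx P → ℂ,
    (∀ b, pos P b + 1 = P.m + 2 * P.k → θ b = 1) ∧
    ∀ c d b, Arr c d b → θ d = mu r c b d * θ b := by
  -- The scalars are built upwards from the lowest weight: at stage `p` the equation is imposed only
  -- for targets among the last p + 1 positions.
  have key : ∀ p : ℕ, ∃ θ : Idx P → ℂ, (∀ b, pos P b + 1 = P.m + 2 * P.k → θ b = 1) ∧
      ∀ c d b, Arr c d b → P.m + 2 * P.k ≤ pos P b + 1 + p → θ d = mu r c b d * θ b := by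
    intro p
    induction p with
    | zero =>
      refine ⟨fun _ => 1, fun _ _ => rfl, fun c d b h hp => ?_⟩
      have := h.pos_lt
      have := pos_lt d
      omega
    | succ p ih =>
      obtain ⟨θ, h1, h2⟩ := ih
      by_cases hp : P.m + 2 * P.k ≤ p + 1
      · refine ⟨θ, h1, fun c d b h h3 => ?_⟩
        exact h2 c d b h (by omega)
      obtain ⟨b₀, hb₀⟩ := exists_pos (P := P) (p := P.m + 2 * P.k - (p + 2)) (by omega)
      obtain ⟨c₀, d₀, h₀⟩ := exists_arr_into (b := b₀) (by omega)
      refine ⟨Function.update θ b₀ ((mu r c₀ b₀ d₀)⁻¹ * θ d₀), fun b hb => ?_,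
        fun c d b h h3 => ?_⟩
      · rw [Function.update_of_ne (by rintro rfl; omega), h1 b hb]
      have hdb := h.pos_lt
      rw [Function.update_of_ne (a := d) (by rintro rfl; omega)]
      by_cases hb : b = b₀
      · subst hb
        rw [Function.update_self]
        have hμ := h₀.mu_ne_zero hr
        -- The value at `b` was fixed by one incoming edge. A second one exists only at the top of
        -- the diamond, where `Arr.mu_fork` makes the two conditions agree.
        rcases h₀.eq_or_fork h with ⟨rfl, rfl⟩ | ⟨hA, hne, g, hg, hg'⟩
        · field_simp
        · obtain ⟨e', he1, he2, he⟩ := Arr.mu_fork (r := r) hA hne hg h₀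
          obtain rfl := he2.source_unique h
          have t1 := h2 _ _ _ hg (by have := h₀.pos_lt; omega)
          have t2 := h2 _ _ _ he1 (by omega)
          have hμ' := he1.mu_ne_zero hr
          rw [mul_left_comm, eq_inv_mul_iff_mul_eq₀ hμ]
          refine mul_left_cancel₀ hμ' ?_
          linear_combination -(mu r c₀ b d₀) * t2 + mu r c₀ b d₀ * t1 + θ d₀ * he
      · rw [Function.update_of_ne hb]
        have : pos P b ≠ pos P b₀ := fun h => hb (pos_inj.1 h)
        exact h2 c d b h (by omega)
  obtain ⟨θ, h1, h2⟩ := key (P.m + 2 * P.k)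
  exact ⟨θ, h1, fun c d b h => h2 c d b h (by omega)⟩

theorem Out.exists_arr {c : Simple P} {d : Idx P} {n : ℕ} (h : Out c n)
    (hn : n + pos P d + 1 = P.m + 2 * P.k) : ∃ b, Arr c d b := by
  have hm := m_eq (P := P)
  have hl := one_le_l (P := P)
  have hk := P.k_pos
  have hc := node_lt c
  rcases h with ⟨h1, h2⟩ | ⟨h1, h2, h3 | h3⟩
  · obtain ⟨b, hb⟩ := exists_pos (P := P) (p := pos P d - 1) (by have := pos_lt d; omega)
    exact ⟨b, (arr_iff c d b).2 (Or.inl (by omega))⟩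
  · obtain ⟨b, hb⟩ := exists_pos (P := P) (p := P.k + P.l - 1) (by omega)
    exact ⟨b, (arr_iff c d b).2 (Or.inr (by omega))⟩
  · obtain ⟨b, hb⟩ := exists_pos (P := P) (p := P.k + P.l - 2) (by omega)
    exact ⟨b, (arr_iff c d b).2 (Or.inr (by omega))⟩

/-- A lowest weight vector generates a copy of the vector representation. -/
theorem SerreFamily.exists_vector_family (hE : SerreFamily r E) (hr : r ≠ 0)
    (hq : r ^ 2 + (r ^ 2)⁻¹ ≠ 0) (hq3 : r ^ 2 + 1 + (r ^ 2)⁻¹ ≠ 0) (hz : IsLowest E z) :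
    ∃ w : Idx P → M, (∀ b, pos P b + 1 = P.m + 2 * P.k → w b = z) ∧
      (∀ c d b, Arr c d b → E c (w d) = mu r c b d • w b) ∧
      ∀ c d, (∀ b, ¬ Arr c d b) → E c (w d) = 0 := by
  obtain ⟨θ, h1, h2⟩ := exists_rescaling (P := P) hr
  have hm := m_eq (P := P)
  have hl := one_le_l (P := P)
  have hk := P.k_pos
  refine ⟨fun d => θ d • chain E z (P.m + 2 * P.k - 1 - pos P d), fun b hb => ?_,
    fun c d b h => ?_, fun c d h => ?_⟩
  · beta_reduce
    rw [h1 b hb, one_smul, show P.m + 2 * P.k - 1 - pos P b = 0 by omega]; rfl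
  · beta_reduce
    rw [h2 c d b h, map_smul, mul_smul]
    congr 2
    have h3 := pos_lt d
    have h4 := h.pos_lt
    have hc := node_lt c
    rw [arr_iff] at h
    rcases h with ⟨h5, h6, h7⟩ | ⟨h5, h6, h7 | h7⟩
    · rw [show P.m + 2 * P.k - 1 - pos P b = P.m + 2 * P.k - 1 - pos P d + 1 by omega]
      exact (chain_succ E z (by omega) h7).symm
    -- The edge of the diamond not used in the definition of the string: both paths give the same
    -- vector since the two labels commute.
    · obtain ⟨n, hn⟩ : ∃ n, n + 2 = P.k + P.l := ⟨P.k + P.l - 2, by omega⟩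
      obtain ⟨a, ha⟩ := exists_node (P := P) (p := n) (by omega)
      rw [show P.m + 2 * P.k - 1 - pos P b = n + 2 + 1 by omega,
        show P.m + 2 * P.k - 1 - pos P d = n + 1 by omega,
        chain_succ E z (d := a) (n := n + 2) (by omega) (by omega),
        chain_succ E z (d := a) (n := n) (by omega) (by omega),
        chain_fork E z h5 h6 hn]
      have hne : c ≠ a := by rintro rfl; omega
      exact LinearMap.congr_fun (hE.comm c a (by unfold Adj; omega) hne) (chain E z n)
    · obtain ⟨n, hn⟩ : ∃ n, n + 2 = P.k + P.l := ⟨P.k + P.l - 2, by omega⟩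
      rw [show P.m + 2 * P.k - 1 - pos P b = n + 2 by omega,
        show P.m + 2 * P.k - 1 - pos P d = n by omega, chain_fork E z h5 h6 hn]
  · rw [map_smul]
    have h3 := pos_lt d
    have hlt : P.m + 2 * P.k - 1 - pos P d < P.m + 2 * P.k := by omega
    have ho : ¬ Out c (P.m + 2 * P.k - 1 - pos P d) := fun ho =>
      (ho.exists_arr (d := d) (by omega)).elim h
    rcases Nat.mod_two_eq_zero_or_one P.m with hp | hp
    · rw [hE.chain_even hp rfl hq hz _ (by omega) c ho, smul_zero]
    · rw [hE.chain_odd hq hq3 hz hp _ hlt c fun h => ho (Or.inl ⟨h, by omega⟩), smul_zero]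

end Vector

/-! ### The scalars that must not vanish -/

section RootOfUnity

variable {r : ℂ}

theorem sq_add_inv_sq_ne_zero (hr : r ≠ 0) (hq : ∀ N : ℕ, 0 < N → (r ^ 2) ^ N ≠ 1) :
    r ^ 2 + (r ^ 2)⁻¹ ≠ 0 := by
  intro h
  field_simp at h
  refine hq 4 (by norm_num) ?_
  linear_combination (r ^ 4 - 1) * h

theorem sq_add_one_add_inv_sq_ne_zero (hr : r ≠ 0) (hq : ∀ N : ℕ, 0 < N → (r ^ 2) ^ N ≠ 1) :
    r ^ 2 + 1 + (r ^ 2)⁻¹ ≠ 0 := by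
  intro h
  field_simp at h
  refine hq 3 (by norm_num) ?_
  linear_combination (r ^ 2 - 1) * h

theorem sq_sub_inv_sq_ne_zero (hr : r ≠ 0) (hq : ∀ N : ℕ, 0 < N → (r ^ 2) ^ N ≠ 1) :
    r ^ 2 - (r ^ 2)⁻¹ ≠ 0 := by
  intro h
  field_simp at h
  refine hq 2 (by norm_num) ?_
  linear_combination h

end RootOfUnity

/-! ### The unit column is a lowest weight vector -/

section Lowest

variable {P : Params} {r : ℂ}

/-- X, Y, Z stand for the left, vector and right parts at the first node. With the operators
ordered, the left and right contributions cancel because β = q^((α, α)) = q⁻² and v = q² are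
inverse. -/
theorem lamOp_vecOp_sq {M : Type*} [AddCommGroup M] [Module ℂ M] {X Y Z : Module.End ℂ M} {z : M}
    {β v : ℂ} (h1 : ∀ x, Y (X x) = β • X (Y x)) (h2 : ∀ x, Z (X x) = β • X (Z x))
    (h3 : ∀ x, Z (Y x) = β • Y (Z x)) (h4 : ∀ x, Y (Y x) = 0) (h5 : Z z = -(v • X z))
    (h6 : β * v = 1) : (X + Y + Z) ((X + Y + Z) z) = 0 := by
  simp only [LinearMap.add_apply, map_add, map_neg, map_smul, h1, h2, h3, h4, h5, smul_neg]
  match_scalars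
  · linear_combination (v - 1) * h6
  · linear_combination (-1 - β) * h6

/-- The analogue for k = 1, when the first node is the odd one: primed operators belong to its
neighbour, and the cancellation needs β ^ 2 v = 1 with β = q⁻¹ and v = q². -/
theorem lamOp_vecOp_sandwich {M : Type*} [AddCommGroup M] [Module ℂ M]
    {X Y Z X' Y' Z' : Module.End ℂ M} {z : M} {β v : ℂ}
    (h1 : ∀ x, Y (X x) = -X (Y x)) (h2 : ∀ x, Z (X x) = -X (Z x))
    (h3 : ∀ x, Z (Y x) = -Y (Z x)) (h4 : ∀ x, Y (X' x) = β • X' (Y x))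
    (h5 : ∀ x, Z (X' x) = β • X' (Z x)) (h6 : ∀ x, Z (Y' x) = β • Y' (Z x))
    (h4' : ∀ x, Y' (X x) = β • X (Y' x)) (h5' : ∀ x, Z' (X x) = β • X (Z' x))
    (h6' : ∀ x, Z' (Y x) = β • Y (Z' x)) (hX : ∀ x, X (X x) = 0) (hY : ∀ x, Y (Y x) = 0)
    (hYY : ∀ x, Y (Y' (Y x)) = 0) (hz : Z z = -(v • X z)) (hz' : Z' z = -X' z)
    (hy' : Y' z = 0) (hβ : β * β * v = 1) :
    (X + Y + Z) ((X' + Y' + Z') ((X + Y + Z) z)) = 0 := by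
  simp only [LinearMap.add_apply, map_add, map_neg, map_smul, h1, h2, h3, h4, h5, h6, h4', h5', h6',
    hX, hY, hYY, hz, hz', hy', smul_neg, map_zero, smul_zero, neg_zero]
  match_scalars
  · linear_combination (v - 1) * hβ
  · linear_combination β * hβ
  · linear_combination -hβ
  · linear_combination -hβ

theorem form_root_lowest {b : Idx P} (hb : pos P b + 1 = P.m + 2 * P.k) (c : Simple P) :
    form P (root c) (wt P b) = if node c = 0 then 1 else 0 := by
  have hm := m_eq (P := P)
  have hl := one_le_l (P := P)
  have hk := P.k_pos
  have hc := node_lt c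
  rw [root, form_sub_left]
  by_cases h : node c = 0
  · rw [if_pos h]
    rcases pos_row_col c with ⟨h1, h2, -⟩ | ⟨he, rfl, h1, h2⟩
    · rw [form_wt_of_bar (by omega) (by omega), form_wt_of_ne (by omega) (by omega),
        posSign_odd (by omega)]; norm_num
    · have := node_last (P := P)
      omega
  · rw [if_neg h]
    rcases pos_row_col c with ⟨h1, h2, -⟩ | ⟨he, rfl, h1, h2⟩
    · rw [form_wt_of_ne (by omega) (by omega), form_wt_of_ne (by omega) (by omega), sub_zero]
    · have := two_le_l (P := P) he
      rw [form_wt_of_ne (by omega) (by omega), form_wt_of_ne (by omega) (by omega), sub_zero]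

/-- On a unit column left and right multiplication by e_c q^(h_c/2) agree, so the two parts differ
by a scalar only. -/
theorem rhoOp_lowest (hr : r ≠ 0) {b : Idx P} (c : Simple P) :
    rhoOp r c (Pi.single b 1) =
      -(r ^ (4 * form P (root c) (wt P b)) • lamOp r c (Pi.single b (1 : Uq P r))) := by
  ext a
  rw [rhoOp_apply hr, Pi.neg_apply, Pi.smul_apply, lamOp_apply]
  by_cases h : a = b
  · subst h
    rw [Pi.single_eq_same, map_one, mul_one, uK_mul_neg, one_mul, mul_one, smul_smul,
      ← zpow_add₀ hr]
    congr 3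
    ring
  · rw [Pi.single_eq_of_ne h, map_zero, mul_zero, mul_zero, zero_mul, zero_mul, smul_zero,
      smul_zero, smul_zero]

theorem vecOp_lowest {b : Idx P} (hb : pos P b + 1 = P.m + 2 * P.k) {c : Simple P}
    (hc : node c ≠ 0) : vecOp r c (Pi.single b (1 : Uq P r)) = 0 := by
  ext a
  by_contra h
  obtain ⟨d, h1, h2⟩ := exists_arr_of_vecOp_ne h
  have hd : d = b := by
    by_contra hne
    exact h2 (Pi.single_eq_of_ne hne _)
  subst hd
  have hm := m_eq (P := P)
  have hl := one_le_l (P := P)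
  have := P.k_pos
  have := node_lt c
  have : P.m % 2 = 0 → 2 ≤ P.l := two_le_l
  rw [arr_iff] at h1
  omega

/-- The lowest weight is orthogonal to all simple roots but the first, so for the others the left
and right parts cancel exactly and the vector part is zero. -/
theorem isLowest_adOp (hr : r ≠ 0) {b : Idx P} (hb : pos P b + 1 = P.m + 2 * P.k) :
    IsLowest (adOp r) (Pi.single b (1 : Uq P r)) := by
  have hm := m_eq (P := P)
  have hl := one_le_l (P := P)
  have hVL : ∀ (b c : Simple P) (x : Col P r),
      vecOp r b (lamOp r c x) = braid r b c • lamOp r c (vecOp r b x) :=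
    fun b c x => LinearMap.congr_fun (vecOp_lamOp hr b c) x
  have hRL : ∀ (b c : Simple P) (x : Col P r),
      rhoOp r b (lamOp r c x) = braid r b c • lamOp r c (rhoOp r b x) :=
    fun b c x => LinearMap.congr_fun (rhoOp_lamOp hr b c) x
  have hRV : ∀ (b c : Simple P) (x : Col P r),
      rhoOp r b (vecOp r c x) = braid r b c • vecOp r c (rhoOp r b x) :=
    fun b c x => LinearMap.congr_fun (rhoOp_vecOp hr b c) x
  have hrho : ∀ c : Simple P, node c = 0 → rhoOp r c (Pi.single b (1 : Uq P r)) =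
      -(r ^ 4 • lamOp r c (Pi.single b (1 : Uq P r))) := by
    intro c hc
    rw [rhoOp_lowest hr, form_root_lowest hb, if_pos hc, mul_one]
    rfl
  have hrho0 : ∀ c : Simple P, node c ≠ 0 → rhoOp r c (Pi.single b (1 : Uq P r)) =
      -lamOp r c (Pi.single b (1 : Uq P r)) := by
    intro c hc
    rw [rhoOp_lowest hr, form_root_lowest hb, if_neg hc, mul_zero, zpow_zero, one_smul]
  refine ⟨fun c h => ?_, fun c h hc => ?_, fun s c hs hk h => ?_⟩
  · rw [adOp, LinearMap.add_apply, LinearMap.add_apply, vecOp_lowest hb h, hrho0 c h, add_zero,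
      add_neg_cancel]
  · have hlast : P.m % 2 = 1 → c ≠ Simple.last := by
      rintro - rfl
      have := node_last (P := P)
      have := P.k_pos
      omega
    have hne : node c ≠ node Simple.s := fun h => hc (node_inj h)
    have hs := node_s (P := P)
    refine lamOp_vecOp_sq (hVL c c) (hRL c c) (hRV c c)
      (fun x => LinearMap.congr_fun (vecOp_mul_self hlast) x) (hrho c h) ?_
    rw [braid, spar_of_ne hc, mul_zero, sgn_zero, form_root_self hlast]
    rcases pos_row_col c with ⟨h1, h2, -⟩ | ⟨he, rfl, h1, h2⟩
    · rw [posSign_odd (by omega), posSign_odd (by omega)]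
      norm_num
      field_simp
    · have := node_last (P := P)
      omega
  · subst hs
    have hneg : ∀ x : Col P r, (-1 : ℂ) • x = -x := fun x => neg_one_smul ℂ x
    have hss : braid r (Simple.s : Simple P) Simple.s = -1 := braid_s_s r
    have hs := node_s (P := P)
    have hc : node c ≠ 0 := by
      have : node c ≠ node Simple.s := fun h' => h.ne (node_inj h'.symm)
      omega
    refine lamOp_vecOp_sandwich (β := braid r Simple.s c)
      (fun x => by rw [hVL, hss]; exact hneg _) (fun x => by rw [hRL, hss]; exact hneg _)
      (fun x => by rw [hRV, hss]; exact hneg _) (hVL _ _) (hRL _ _) (hRV _ _)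
      (fun x => by rw [hVL, braid_comm]) (fun x => by rw [hRL, braid_comm])
      (fun x => by rw [hRV, braid_comm]) (fun x => LinearMap.congr_fun (lamOp_serre hr).sq x)
      (fun x => LinearMap.congr_fun vecOp_serre.sq x)
      (fun x => LinearMap.congr_fun (vecOp_sandwich h) x) (hrho _ (by omega)) (hrho0 c hc)
      (vecOp_lowest hb hc) ?_
    rw [braid_of_adj r h, if_neg (by omega)]
    field_simp

end Lowest

/-! ### Coefficients of elements of the graded tensor product -/

section Coefficients

variable {P : Params} {r : ℂ}

theorem neg_one_uzpow_smul {M : Type*} [AddCommGroup M] [Module ℂ M] (i : ZMod 2) (x : M) :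
    ((-1 : ℤˣ) ^ i) • x = sgn i • x := by
  rcases zmod_two_cases i with rfl | rfl
  · rw [uzpow_zero, one_smul, sgn_zero, one_smul]
  · rw [uzpow_one, sgn_one, Units.neg_smul, one_smul, neg_one_smul]

theorem sgn_smul_parity_mem (i j : ZMod 2) (y : Uq P r) :
    parityPow P r i (uqProj P r j y) = sgn (j * i) • uqProj P r j y := by
  have h : parity P r (uqProj P r j y) = sgn j • uqProj P r j y := by
    rw [uqProj_apply, map_smul, map_add, map_smul, parity_parity, smul_comm (sgn j),
      smul_add (sgn j), smul_smul (sgn j), sgn_mul_self, one_smul, add_comm]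
  rcases zmod_two_cases i with rfl | rfl
  · rw [parityPow_zero, mul_zero, sgn_zero, one_smul]
  · rw [parityPow_one, h, mul_one]

theorem uqProj_add (y : Uq P r) : uqProj P r 0 y + uqProj P r 1 y = y := by
  rw [uqProj_apply, uqProj_apply, sgn_zero, sgn_one]
  module

/-- The sign of the graded product is absorbed into a power of the parity automorphism on `y`, so
that `y` need not be homogeneous. -/
theorem tmul_mul_tmul {i : ZMod 2} (M N : EndV P) (y v : Uq P r) (hN : N ∈ endGrading P i) :
    (M ᵍ⊗ₜ[ℂ] y * N ᵍ⊗ₜ[ℂ] v : LaxAlg P r) = (M * N) ᵍ⊗ₜ[ℂ] (parityPow P r i y * v) := by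
  have key : ∀ j, (M ᵍ⊗ₜ[ℂ] (uqProj P r j y) * N ᵍ⊗ₜ[ℂ] v : LaxAlg P r) =
      (M * N) ᵍ⊗ₜ[ℂ] (parityPow P r i (uqProj P r j y) * v) := by
    intro j
    have hj : uqProj P r j y ∈ uqGrading P r j := by
      change parity P r _ = _
      have := sgn_smul_parity_mem 1 j y
      rwa [parityPow_one, mul_one] at this
    have := GradedTensorProduct.tmul_coe_mul_coe_tmul (R := ℂ) (endGrading P) (uqGrading P r) M
      (⟨_, hj⟩ : uqGrading P r j) (⟨N, hN⟩ : endGrading P i) v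
    rw [sgn_smul_parity_mem, smul_mul_assoc]
    refine this.trans ?_
    rw [neg_one_uzpow_smul]
    simp only [GradedTensorProduct.tmul, TensorProduct.tmul_smul, map_smul]
  have h1 := key 0
  have h2 := key 1
  conv_lhs => rw [← uqProj_add y]
  conv_rhs => rw [← uqProj_add y]
  simp only [GradedTensorProduct.tmul, TensorProduct.tmul_add, map_add, add_mul] at h1 h2 ⊢
  rw [h1, h2]

/-- The coefficient of `E^a_b`. -/
def coef (a b : Idx P) : LaxAlg P r →ₗ[ℂ] Uq P r :=
  (TensorProduct.lid ℂ (Uq P r)).toLinearMap ∘ₗ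
    (LinearMap.rTensor (Uq P r) (Matrix.entryLinearMap ℂ ℂ a b)) ∘ₗ
      (GradedTensorProduct.of ℂ (endGrading P) (uqGrading P r)).symm.toLinearMap

theorem coef_tmul (a b : Idx P) (M : EndV P) (u : Uq P r) :
    coef a b (M ᵍ⊗ₜ[ℂ] u : LaxAlg P r) = M a b • u := rfl

/-- The element with given coefficients. -/
def ofEntries (g : Idx P → Idx P → Uq P r) : LaxAlg P r := ∑ a, ∑ b, elem a b ᵍ⊗ₜ[ℂ] g a b

theorem elem_apply (a b i j : Idx P) : elem a b i j = if a = i ∧ b = j then 1 else 0 := by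
  simp [elem, Matrix.single_apply]

theorem coef_ofEntries (g : Idx P → Idx P → Uq P r) (a b : Idx P) :
    coef a b (ofEntries g) = g a b := by
  simp only [ofEntries, map_sum, coef_tmul, elem_apply, ite_smul, one_smul, zero_smul, ite_and]
  simp

theorem eq_ofEntries (X : LaxAlg P r) : X = ofEntries fun a b => coef a b X := by
  have h : (LinearMap.id : LaxAlg P r →ₗ[ℂ] LaxAlg P r) = ∑ a, ∑ b,
      ((GradedTensorProduct.of ℂ (endGrading P) (uqGrading P r)).toLinearMap ∘ₗ
        TensorProduct.mk ℂ (EndV P) (Uq P r) (elem a b)) ∘ₗ coef a b := by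
    refine GradedTensorProduct.hom_ext _ _ (TensorProduct.ext' fun M u => ?_)
    simp only [LinearMap.comp_apply, LinearMap.id_apply, LinearMap.sum_apply]
    change M ᵍ⊗ₜ[ℂ] u = ∑ a, ∑ b, elem a b ᵍ⊗ₜ[ℂ] (coef a b (M ᵍ⊗ₜ[ℂ] u : LaxAlg P r))
    conv_lhs => rw [Matrix.matrix_eq_sum_single M]
    simp only [coef_tmul, GradedTensorProduct.tmul, TensorProduct.sum_tmul, map_sum]
    refine Finset.sum_congr rfl fun a _ => Finset.sum_congr rfl fun b _ => ?_
    rw [← TensorProduct.smul_tmul, elem, Matrix.smul_single, smul_eq_mul, mul_one]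
  have := LinearMap.congr_fun h X
  simp only [LinearMap.sum_apply, LinearMap.comp_apply, LinearMap.id_apply] at this
  exact this

theorem ext_coef {X Y : LaxAlg P r} (h : ∀ a b, coef a b X = coef a b Y) : X = Y := by
  rw [eq_ofEntries X, eq_ofEntries Y]
  simp only [h]

theorem elem_mem (a b : Idx P) : elem a b ∈ endGrading P (par P a + par P b) := by
  intro i j h
  rw [elem_apply, if_neg]
  rintro ⟨rfl, rfl⟩
  exact h rfl

theorem diagonal_mem (f : Idx P → ℂ) : Matrix.diagonal f ∈ endGrading P 0 := by
  intro i j h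
  refine Matrix.diagonal_apply_ne _ ?_
  rintro rfl
  exact h (CharTwo.add_self_eq_zero _)

theorem piE_mem (c : Simple P) : piE c ∈ endGrading P (spar c) := by
  intro i j h
  exact piE_eq_zero fun h' => h h'.par_add

theorem coef_ofEntries_mul {i : ZMod 2} (g : Idx P → Idx P → Uq P r) (N : EndV P) (v : Uq P r)
    (hN : N ∈ endGrading P i) (a b : Idx P) :
    coef a b (ofEntries g * N ᵍ⊗ₜ[ℂ] v : LaxAlg P r) =
      ∑ d, N d b • (parityPow P r i (g a d) * v) := by
  simp only [ofEntries, Finset.sum_mul, map_sum, tmul_mul_tmul _ _ _ _ hN, coef_tmul]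
  rw [Finset.sum_eq_single a]
  · refine Finset.sum_congr rfl fun d _ => ?_
    simp [elem, Matrix.single_mul_apply_same]
  · intro a' _ ha
    refine Finset.sum_eq_zero fun d _ => ?_
    simp [elem, Matrix.single_mul_apply_of_ne _ _ _ _ _ ha.symm]
  · simp

theorem coef_mul_ofEntries (g : Idx P → Idx P → Uq P r) (N : EndV P) (v : Uq P r)
    (a b : Idx P) :
    coef a b (N ᵍ⊗ₜ[ℂ] v * ofEntries g : LaxAlg P r) =
      ∑ d, N a d • (parityPow P r (par P d + par P b) v * g d b) := by
  simp only [ofEntries, Finset.mul_sum, map_sum, tmul_mul_tmul _ _ _ _ (elem_mem _ _), coef_tmul]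
  refine Finset.sum_congr rfl fun d _ => ?_
  rw [Finset.sum_eq_single b]
  · simp [elem, Matrix.mul_single_apply_same]
  · intro b' _ hb
    simp [elem, Matrix.mul_single_apply_of_ne _ _ _ _ _ hb.symm]
  · simp

/-- The intertwining property in terms of coefficients. -/
theorem intertwines_ofEntries (g : Idx P → Idx P → Uq P r) :
    Intertwines (ofEntries g) ↔ ∀ (c : Simple P) (a b : Idx P),
      r ^ form P (root c) (wt P b) • (g a b * ue r c) +
          ∑ d, piE c d b • (parityPow P r (spar c) (g a d) * uK r (-root c)) =
        ∑ d, piE c a d • (uK r (root c) * g d b) +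
          (r ^ (-form P (root c) (wt P a)) * sgn ((par P a + par P b) * spar c)) •
            (ue r c * g a b) := by
  have h1 : ∀ (c : Simple P) (a b : Idx P), coef a b (ofEntries g * deltaE r c) =
      r ^ form P (root c) (wt P b) • (g a b * ue r c) +
          ∑ d, piE c d b • (parityPow P r (spar c) (g a d) * uK r (-root c)) := by
    intro c a b
    rw [deltaE, mul_add, map_add, piK, coef_ofEntries_mul _ _ _ (diagonal_mem _),
      coef_ofEntries_mul _ _ _ (piE_mem c)]
    congr 1
    rw [Finset.sum_eq_single b]
    · rw [Matrix.diagonal_apply_eq, parityPow_zero]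
    · intro d _ hd
      rw [Matrix.diagonal_apply_ne _ hd, zero_smul]
    · simp
  have h2 : ∀ (c : Simple P) (a b : Idx P), coef a b (deltaTE r c * ofEntries g) =
      ∑ d, piE c a d • (uK r (root c) * g d b) +
          (r ^ (-form P (root c) (wt P a)) * sgn ((par P a + par P b) * spar c)) •
            (ue r c * g a b) := by
    intro c a b
    rw [deltaTE, add_mul, map_add, piK, coef_mul_ofEntries, coef_mul_ofEntries]
    congr 1
    · simp only [parityPow_uK]
    · rw [Finset.sum_eq_single a]
      · rw [Matrix.diagonal_apply_eq, parityPow_ue, smul_mul_assoc, smul_smul, form_neg_left]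
      · intro d _ hd
        rw [Matrix.diagonal_apply_ne _ hd.symm, zero_smul]
      · simp
  constructor
  · intro h c a b
    rw [← h1, ← h2, h c]
  · intro h c
    refine ext_coef fun a b => ?_
    rw [h1, h2, h c a b]

/-- The entries of the second factor of the ansatz. -/
def entries (σ : Idx P → Idx P → Uq P r) (a b : Idx P) : Uq P r :=
  if a = b then 1 else
    if WtLT P a b then ((r ^ 2 - (r ^ 2)⁻¹) * sgn (par P b)) • σ b a else 0

/-- The sign in h^b compensates the sign of the form on the odd basis vectors. -/
theorem cartan_weight (a : Idx P) :
    ∑ b, (form P (wt P a) (eps P b) * (if epsPar P b = 0 then 1 else -1)) • eps P b =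
      wt P a := by
  funext x
  rw [Finset.sum_apply, Finset.sum_eq_single x]
  · rcases x with i | j <;> simp [form, eps, epsPar, Pi.single_apply]
  · intro b _ hb
    simp [eps, hb.symm]
  · simp

/-- The Cartan factor is diagonal, so it multiplies row a by q^(h_{ε_a}); the doubled weight appears
because `uK` stands for q^(h/2). -/
theorem lax_eq_ofEntries (σ : Idx P → Idx P → Uq P r) :
    lax r σ = ofEntries fun a b => uK r (2 • wt P a) * entries σ a b := by
  have h1 : (1 : LaxAlg P r) + (r ^ 2 - (r ^ 2)⁻¹) • ∑ a : Idx P, ∑ b : Idx P,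
      (if WtLT P a b then sgn (par P b) • (elem a b ᵍ⊗ₜ[ℂ] σ b a) else 0) =
      ofEntries (entries σ) := by
    refine ext_coef fun a b => ?_
    have h1 : coef a b (1 : LaxAlg P r) = (1 : EndV P) a b • (1 : Uq P r) := coef_tmul a b 1 1
    rw [coef_ofEntries, map_add, h1, map_smul, map_sum]
    have h2 : ∑ a', coef a b (∑ b' : Idx P, if WtLT P a' b' then
        sgn (par P b') • (elem a' b' ᵍ⊗ₜ[ℂ] σ b' a' : LaxAlg P r) else 0) =
        if WtLT P a b then sgn (par P b) • σ b a else 0 := by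
      rw [Finset.sum_eq_single a, map_sum, Finset.sum_eq_single b]
      · split_ifs
        · rw [map_smul, coef_tmul, elem_apply, if_pos ⟨rfl, rfl⟩, one_smul]
        · rw [map_zero]
      · intro b' _ hb
        split_ifs
        · rw [map_smul, coef_tmul, elem_apply, if_neg (fun h => hb h.2), zero_smul, smul_zero]
        · rw [map_zero]
      · simp
      · intro a' _ ha
        rw [map_sum]
        refine Finset.sum_eq_zero fun b' _ => ?_
        split_ifs
        · rw [map_smul, coef_tmul, elem_apply, if_neg (fun h => ha h.1), zero_smul, smul_zero]
        · rw [map_zero]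
      · simp
    rw [h2, entries]
    by_cases hab : a = b
    · subst hab
      rw [Matrix.one_apply_eq, one_smul, if_pos rfl, if_neg (show ¬ WtLT P a a from lt_irrefl _),
        smul_zero, add_zero]
    · rw [Matrix.one_apply_ne hab, zero_smul, if_neg hab, zero_add]
      split_ifs
      · rw [smul_smul]
      · rw [smul_zero]
  rw [lax, h1]
  refine ext_coef fun a b => ?_
  rw [coef_ofEntries, cartanFactor, Finset.sum_mul, map_sum, Finset.sum_eq_single a]
  · rw [coef_mul_ofEntries, Finset.sum_eq_single a]
    · rw [elem_apply, if_pos ⟨rfl, rfl⟩, one_smul, parityPow_uK, cartan_weight]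
    · intro d _ hd
      rw [elem_apply, if_neg (fun h => hd h.2.symm), zero_smul]
    · simp
  · intro a' _ ha
    rw [coef_mul_ofEntries]
    refine Finset.sum_eq_zero fun d _ => ?_
    rw [elem_apply, if_neg (fun h => ha h.1), zero_smul]
  · simp

end Coefficients

/-! ### Existence and uniqueness of the Lax operator -/

section Existence

variable {P : Params} {r : ℂ}

theorem arr_induction {Q : Idx P → Prop} (h0 : ∀ b, pos P b + 1 = P.m + 2 * P.k → Q b)
    (h1 : ∀ c d b, Arr c d b → Q d → Q b) (b : Idx P) : Q b := by
  obtain ⟨n, hn⟩ : ∃ n, n = P.m + 2 * P.k - 1 - pos P b := ⟨_, rfl⟩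
  induction n using Nat.strong_induction_on generalizing b with
  | _ n ih =>
    by_cases hb : pos P b + 1 = P.m + 2 * P.k
    · exact h0 b hb
    · have h2 := pos_lt b
      obtain ⟨c, d, h⟩ := exists_arr_into (b := b) (by omega)
      have h3 := h.pos_lt
      have h4 := pos_lt d
      exact h1 c d b h (ih _ (by omega) d rfl)

/-- Edges with a common label preserve the order of weights; hence the vector action respects
triangularity. -/
theorem Arr.pos_mono {c : Simple P} {d b d' a : Idx P} (h : Arr c d b) (h' : Arr c d' a)
    (hab : pos P a < pos P b) : pos P d' < pos P d := by
  have hm := m_eq (P := P)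
  have hl := one_le_l (P := P)
  have hc := node_lt c
  rw [arr_iff] at h h'
  omega

/-- The properties of the columns of a Lax operator. -/
structure IsLaxColumn (b : Idx P) (u : Col P r) : Prop where
  tri (a : Idx P) (h : pos P a < pos P b) : u a = 0
  diag : u b = 1
  weight (x : Weight P) (a : Idx P) :
    uK r x * u a = r ^ (form P x (wt P b) - form P x (wt P a)) • (u a * uK r x)
  par_eq (i : ZMod 2) (a : Idx P) :
    parityPow P r i (u a) = sgn (i * (par P a + par P b)) • u a
  mem (a : Idx P) : u a ∈ Uplus P r

theorem eK_mem (c : Simple P) : eK r c ∈ Uplus P r :=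
  mul_mem (Algebra.subset_adjoin (Or.inl ⟨c, rfl⟩)) (Algebra.subset_adjoin (Or.inr ⟨_, rfl⟩))

theorem uK_mem (x : Weight P) : uK r x ∈ Uplus P r := Algebra.subset_adjoin (Or.inr ⟨x, rfl⟩)

theorem uK_mul_eK (x : Weight P) (c : Simple P) :
    uK r x * eK r c = r ^ form P x (root c) • (eK r c * uK r x) := by
  rw [eK, ← mul_assoc, uK_mul_ue, smul_mul_assoc, mul_assoc, mul_assoc, uK_mul_comm]

theorem parityPow_eK (i : ZMod 2) (c : Simple P) :
    parityPow P r i (eK r c) = sgn (i * spar c) • eK r c := by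
  rw [eK, map_mul, parityPow_ue, parityPow_uK, smul_mul_assoc]

theorem isLaxColumn_lowest {b : Idx P} (hb : pos P b + 1 = P.m + 2 * P.k) :
    IsLaxColumn b (Pi.single b (1 : Uq P r)) where
  tri a h := Pi.single_eq_of_ne (by rintro rfl; exact lt_irrefl _ h) _
  diag := Pi.single_eq_same _ _
  weight x a := by
    by_cases h : a = b
    · subst h; rw [Pi.single_eq_same, sub_self, zpow_zero, one_smul, mul_one, one_mul]
    · rw [Pi.single_eq_of_ne h, mul_zero, zero_mul, smul_zero]
  par_eq i a := by
    by_cases h : a = b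
    · subst h
      rw [Pi.single_eq_same, map_one, CharTwo.add_self_eq_zero, mul_zero, sgn_zero, one_smul]
    · rw [Pi.single_eq_of_ne h, map_zero, smul_zero]
  mem a := by
    by_cases h : a = b
    · subst h; rw [Pi.single_eq_same]; exact one_mem _
    · rw [Pi.single_eq_of_ne h]; exact zero_mem _

/-- On entries of definite weight and parity the conjugation and the parity twist are scalars, so
ordinary right multiplication remains. -/
theorem IsLaxColumn.rhoOp_apply (hr : r ≠ 0) {b : Idx P} {u : Col P r} (hu : IsLaxColumn b u)
    (c : Simple P) (a : Idx P) : rhoOp r c u a =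
      (-(r ^ (2 * form P (root c) (wt P b)) * sgn (spar c * (par P a + par P b)))) •
        (u a * eK r c) := by
  have hn : ∀ (x : ℂ) (y : Uq P r), -x • y = -(x • y) := fun x y => neg_smul x y
  rw [Osp.rhoOp_apply hr, hu.par_eq, mul_smul_comm, hu.weight, smul_smul, smul_mul_assoc,
    smul_mul_assoc, mul_assoc (u a), uK_mul_neg, mul_one, smul_smul, form_add_left, form_add_left,
    hn]
  congr 2
  rw [mul_comm (sgn _), ← mul_assoc, ← zpow_add₀ hr]
  congr 2
  ring

/-- All three parts of `adOp` shift weight and parity by those of e_c. At the new diagonal place `u`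
itself vanishes by triangularity, so only the vector part contributes, with value `mu`; this fixes
the normalisation. -/
theorem IsLaxColumn.step (hr : r ≠ 0) {c : Simple P} {d b : Idx P} (h : Arr c d b) {u : Col P r}
    (hu : IsLaxColumn d u) : IsLaxColumn b ((mu r c b d)⁻¹ • adOp r c u) := by
  have hpos := h.pos_lt
  have hwt := h.wt_eq
  have hpar : par P b = par P d + spar c := by
    rw [h.par_eq]
    generalize par P b = x, par P d = y
    revert x y; decide
  have key : ∀ a, adOp r c u a = r ^ (-(2 * form P (root c) (wt P a))) • (eK r c * u a) +
      vecOp r c u a + (-(r ^ (2 * form P (root c) (wt P d)) *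
        sgn (spar c * (par P a + par P d)))) • (u a * eK r c) := by
    intro a
    rw [← hu.rhoOp_apply hr, ← lamOp_apply]; rfl
  constructor
  · intro a ha
    have hv : vecOp r c u a = 0 := by
      by_contra hne
      obtain ⟨d', h1, h2⟩ := exists_arr_of_vecOp_ne hne
      exact h2 (hu.tri d' (h.pos_mono h1 ha))
    rw [Pi.smul_apply, key, hv, hu.tri a (by omega)]
    simp
  · rw [Pi.smul_apply, key, hu.tri b hpos, vecOp_apply_arr h, hu.diag, map_one, mul_zero, zero_mul,
      smul_zero, smul_zero, zero_add, add_zero, smul_smul, inv_mul_cancel₀ (h.mu_ne_zero hr),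
      one_smul]
  · intro x a
    have h1 : uK r x * (eK r c * u a) = r ^ (form P x (wt P b) - form P x (wt P a)) •
        (eK r c * u a * uK r x) := by
      rw [← mul_assoc, uK_mul_eK, smul_mul_assoc, mul_assoc, hu.weight, mul_smul_comm, smul_smul,
        ← zpow_add₀ hr, ← mul_assoc, hwt, form_add_right]
      congr 2; ring
    have h2 : uK r x * (u a * eK r c) = r ^ (form P x (wt P b) - form P x (wt P a)) •
        (u a * eK r c * uK r x) := by
      rw [← mul_assoc, hu.weight, smul_mul_assoc, mul_assoc, uK_mul_eK, mul_smul_comm, smul_smul,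
        ← zpow_add₀ hr, ← mul_assoc, hwt, form_add_right]
      congr 2; ring
    have h3 : uK r x * vecOp r c u a = r ^ (form P x (wt P b) - form P x (wt P a)) •
        (vecOp r c u a * uK r x) := by
      by_cases h' : ∃ d', Arr c d' a
      · obtain ⟨d', h'⟩ := h'
        rw [vecOp_apply_arr h', hu.par_eq, smul_smul, mul_smul_comm, hu.weight, smul_mul_assoc,
          smul_comm, hwt, h'.wt_eq, form_add_right, form_add_right, add_sub_add_right_eq_sub]
      · push Not at h'
        rw [vecOp_apply_zero h', mul_zero, zero_mul, smul_zero]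
    rw [Pi.smul_apply, key, mul_smul_comm, smul_mul_assoc, smul_comm _ (mu r c b d)⁻¹]
    congr 1
    rw [mul_add, mul_add, add_mul, add_mul, mul_smul_comm, mul_smul_comm, h1, h2, h3,
      smul_mul_assoc, smul_mul_assoc, smul_add, smul_add, smul_comm (r ^ _) (r ^ _),
      smul_comm (r ^ _) (-_)]
  · intro i a
    have hs : sgn (i * (par P a + par P b)) = sgn (i * spar c) * sgn (i * (par P a + par P d)) := by
      rw [hpar, ← sgn_add]; congr 1; ring
    have h3 : parityPow P r i (vecOp r c u a) = sgn (i * (par P a + par P b)) • vecOp r c u a := by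
      by_cases h' : ∃ d', Arr c d' a
      · obtain ⟨d', h'⟩ := h'
        rw [vecOp_apply_arr h', hu.par_eq, smul_smul, map_smul, hu.par_eq, smul_comm]
        congr 3
        rw [hpar, h'.par_eq]
        exact (by decide : ∀ x y z : ZMod 2, z + y = x + (y + (x + z))) _ _ _
      · push Not at h'
        rw [vecOp_apply_zero h', map_zero, smul_zero]
    rw [Pi.smul_apply, key, map_smul, map_add, map_add, map_smul, map_smul, map_mul, map_mul, h3,
      parityPow_eK, hu.par_eq, smul_comm _ (mu r c b d)⁻¹]
    congr 1
    rw [hs]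
    simp only [smul_add, smul_mul_assoc, mul_smul_comm, smul_smul]
    congr 2
    · ring_nf
    · ring_nf
  · intro a
    have h3 : vecOp r c u a ∈ Uplus P r := by
      by_cases h' : ∃ d', Arr c d' a
      · obtain ⟨d', h'⟩ := h'
        rw [vecOp_apply_arr h', hu.par_eq]
        exact Subalgebra.smul_mem _ (Subalgebra.smul_mem _ (hu.mem _) _) _
      · push Not at h'
        rw [vecOp_apply_zero h']; exact zero_mem _
    rw [Pi.smul_apply, key]
    exact Subalgebra.smul_mem _ (add_mem (add_mem
      (Subalgebra.smul_mem _ (mul_mem (eK_mem c) (hu.mem a)) _) h3)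
      (Subalgebra.smul_mem _ (mul_mem (hu.mem a) (eK_mem c)) _)) _

/-- The characteristic properties of the second factor of the Lax operator. -/
structure IsLaxMatrix (t : Idx P → Idx P → Uq P r) : Prop where
  column (b : Idx P) : IsLaxColumn b fun a => t a b
  eq (c : Simple P) (a b : Idx P) :
    r ^ form P (root c) (wt P b) • (t a b * eK r c) +
        ∑ d, piE c d b • (sgn (spar c * (par P a + par P d)) • t a d) =
      ∑ d, piE c a d • (r ^ (form P (root c) (wt P d) - form P (root c) (wt P b)) • t d b) +
        (r ^ (-(2 * form P (root c) (wt P a)) - form P (root c) (wt P b)) *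
          sgn (spar c * (par P a + par P b))) • (eK r c * t a b)

/-- The columns are the vectors of the copy of V generated by the unit column. Triangularity,
weight, parity and membership in U⁺ spread along the edges, and the action of each generator, read
entrywise, is the required equation. -/
theorem exists_isLaxMatrix (hr : r ≠ 0) (hq : ∀ N : ℕ, 0 < N → (r ^ 2) ^ N ≠ 1) :
    ∃ t : Idx P → Idx P → Uq P r, IsLaxMatrix t := by
  have hk := P.k_pos
  obtain ⟨b₀, hb₀⟩ := exists_pos (P := P) (p := P.m + 2 * P.k - 1) (by omega)
  have hb₀' : pos P b₀ + 1 = P.m + 2 * P.k := by omega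
  obtain ⟨w, hw0, hw1, hw2⟩ := (adOp_serre (P := P) hr).exists_vector_family hr
    (sq_add_inv_sq_ne_zero hr hq) (sq_add_one_add_inv_sq_ne_zero hr hq) (isLowest_adOp hr hb₀')
  have hcol : ∀ b, IsLaxColumn b (w b) := by
    refine arr_induction (fun b hb => ?_) fun c d b h hd => ?_
    · obtain rfl : b = b₀ := pos_inj.1 (by omega)
      rw [hw0 b hb]
      exact isLaxColumn_lowest hb
    · have := hd.step hr h
      rwa [hw1 c d b h, smul_smul, inv_mul_cancel₀ (h.mu_ne_zero hr), one_smul] at this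
  refine ⟨fun a b => w b a, hcol, fun c a b => ?_⟩
  have key : adOp r c (w b) a = ∑ d, piE c d b •
      ((sgn (spar c) * r ^ form P (root c) (wt P b)) • w d a) := by
    by_cases h : ∃ b', Arr c b b'
    · obtain ⟨b', h⟩ := h
      rw [hw1 c b b' h, sum_piE_col h fun d => (sgn (spar c) * r ^ form P (root c) (wt P b)) • w d a,
        smul_smul, Pi.smul_apply, mu, mul_comm]
    · push Not at h
      rw [hw2 c b h]
      exact (sum_piE_col_zero h fun d =>
        (sgn (spar c) * r ^ form P (root c) (wt P b)) • w d a).symm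
  have key2 : adOp r c (w b) a = r ^ (-(2 * form P (root c) (wt P a))) • (eK r c * w b a) +
      vecOp r c (w b) a + (-(r ^ (2 * form P (root c) (wt P b)) *
        sgn (spar c * (par P a + par P b)))) • (w b a * eK r c) := by
    rw [← (hcol b).rhoOp_apply hr, ← lamOp_apply]; rfl
  -- Equating `key` and `key2` and multiplying by r^(-(α_c, ε_b)) and the sign (-1)^([c]([a]+[b]))
  -- gives the claim; `e1`, `e2`, `e4` and `e5` match the four terms.
  have e1 : ∑ d, piE c d b • (sgn (spar c * (par P a + par P d)) • w d a) =
      (r ^ (-form P (root c) (wt P b)) * sgn (spar c * (par P a + par P b))) •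
        ∑ d, piE c d b • ((sgn (spar c) * r ^ form P (root c) (wt P b)) • w d a) := by
    by_cases h : ∃ b', Arr c b b'
    · obtain ⟨b', h⟩ := h
      rw [sum_piE_col h fun d => sgn (spar c * (par P a + par P d)) • w d a,
        sum_piE_col h fun d => (sgn (spar c) * r ^ form P (root c) (wt P b)) • w d a, smul_smul,
        smul_smul, smul_smul]
      congr 1
      have : sgn (spar c * (par P a + par P b')) =
          sgn (spar c * (par P a + par P b)) * sgn (spar c) := by
        rw [← sgn_add, h.par_eq]
        congr 1
        generalize par P a = x, par P b = y, par P b' = z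
        revert x y z; decide
      have hf := zpow_ne_zero (form P (root c) (wt P b)) hr
      rw [this, zpow_neg]
      field_simp
    · push Not at h
      rw [sum_piE_col_zero h fun d => sgn (spar c * (par P a + par P d)) • w d a,
        sum_piE_col_zero h fun d => (sgn (spar c) * r ^ form P (root c) (wt P b)) • w d a,
        smul_zero]
  have e2 : ∑ d, piE c a d • (r ^ (form P (root c) (wt P d) - form P (root c) (wt P b)) • w b d) =
      (r ^ (-form P (root c) (wt P b)) * sgn (spar c * (par P a + par P b))) •
        vecOp r c (w b) a := by
    by_cases h : ∃ d', Arr c d' a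
    · obtain ⟨d', h⟩ := h
      rw [sum_piE_row h fun d =>
        r ^ (form P (root c) (wt P d) - form P (root c) (wt P b)) • w b d, vecOp_apply_arr h,
        (hcol b).par_eq, smul_smul, smul_smul, smul_smul, mu, zpow_sub₀ hr, zpow_neg]
      congr 1
      have : sgn (spar c * (par P a + par P b)) * sgn (spar c) *
          sgn (spar c * (par P d' + par P b)) = 1 := by
        rw [← sgn_add, ← sgn_add, h.par_eq]
        generalize par P a = x, par P b = y, par P d' = z
        revert x y z
        intro x y z
        rw [show (x + z) * (x + y) + (x + z) + (x + z) * (z + y) = 0 by revert x y z; decide,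
          sgn_zero]
      rw [div_eq_mul_inv]
      linear_combination (-(piE c a d' * r ^ form P (root c) (wt P d') *
        (r ^ form P (root c) (wt P b))⁻¹)) * this
    · push Not at h
      rw [vecOp_apply_zero h, smul_zero]
      exact sum_piE_row_zero h fun d =>
        r ^ (form P (root c) (wt P d) - form P (root c) (wt P b)) • w b d
  have e4 : r ^ (-form P (root c) (wt P b)) * sgn (spar c * (par P a + par P b)) *
      -(r ^ (2 * form P (root c) (wt P b)) * sgn (spar c * (par P a + par P b))) =
      -r ^ form P (root c) (wt P b) := by
    have : r ^ (2 * form P (root c) (wt P b)) = r ^ form P (root c) (wt P b) *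
      r ^ form P (root c) (wt P b) := by rw [← zpow_add₀ hr]; congr 1; ring
    rw [this, zpow_neg]
    have h1 := sgn_mul_self (spar c * (par P a + par P b))
    field_simp
    linear_combination -h1
  have e5 : r ^ (-form P (root c) (wt P b)) * sgn (spar c * (par P a + par P b)) *
      r ^ (-(2 * form P (root c) (wt P a))) =
      r ^ (-(2 * form P (root c) (wt P a)) - form P (root c) (wt P b)) *
          sgn (spar c * (par P a + par P b)) := by
    rw [sub_eq_add_neg, zpow_add₀ hr]; ring
  rw [e1, e2, ← key, key2]
  simp only [smul_add, smul_smul]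
  rw [e4, e5]
  module

/-- The intertwiner attached to a solution. -/
theorem IsLaxMatrix.intertwines (hr : r ≠ 0) {t : Idx P → Idx P → Uq P r} (ht : IsLaxMatrix t) :
    Intertwines (ofEntries fun a b => uK r (2 • wt P a) * t a b) := by
  rw [intertwines_ofEntries]
  intro c a b
  -- Each of the four terms is brought to the form q^(h_{ε_a}) · (…) · q^(-h_c/2); stripping the
  -- outer factors leaves the equation of `IsLaxMatrix`.
  have hx : ue r c = eK r c * uK r (-root c) := by
    rw [eK, mul_assoc, uK_mul_neg, mul_one]
  have h1 : r ^ form P (root c) (wt P b) • (uK r (2 • wt P a) * t a b * ue r c) =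
      uK r (2 • wt P a) * (r ^ form P (root c) (wt P b) • (t a b * eK r c)) * uK r (-root c) := by
    rw [hx, mul_smul_comm, smul_mul_assoc]
    simp only [mul_assoc]
  have h2 : ∑ d, piE c d b • (parityPow P r (spar c) (uK r (2 • wt P a) * t a d) *
      uK r (-root c)) = uK r (2 • wt P a) *
      (∑ d, piE c d b • (sgn (spar c * (par P a + par P d)) • t a d)) * uK r (-root c) := by
    rw [Finset.mul_sum, Finset.sum_mul]
    refine Finset.sum_congr rfl fun d _ => ?_
    rw [map_mul, parityPow_uK, (ht.column d).par_eq]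
    simp only [mul_smul_comm, smul_mul_assoc]
  have h3 : ∑ d, piE c a d • (uK r (root c) * (uK r (2 • wt P d) * t d b)) =
      uK r (2 • wt P a) * (∑ d, piE c a d •
        (r ^ (form P (root c) (wt P d) - form P (root c) (wt P b)) • t d b)) *
        uK r (-root c) := by
    by_cases h : ∃ d, Arr c d a
    · obtain ⟨d, h⟩ := h
      have h5 : ∑ d, piE c a d •
          (r ^ (form P (root c) (wt P d) - form P (root c) (wt P b)) • t d b) = _ :=
        sum_piE_row h _
      refine (sum_piE_row h _).trans ?_
      rw [h5, mul_smul_comm, smul_mul_assoc]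
      congr 1
      have h4 : r ^ (form P (root c) (wt P d) - form P (root c) (wt P b)) •
          (t d b * uK r (-root c)) = uK r (-root c) * t d b := by
        rw [(ht.column b).weight, form_neg_left, form_neg_left]
        congr 2; ring
      rw [mul_smul_comm, smul_mul_assoc, mul_assoc (uK r (2 • wt P a)), ← mul_smul_comm, h4,
        ← mul_assoc, ← mul_assoc, ← uK_add, ← uK_add, h.wt_eq]
      congr 2
      abel
    · push Not at h
      have h5 : ∑ d, piE c a d •
          (r ^ (form P (root c) (wt P d) - form P (root c) (wt P b)) • t d b) = 0 :=
        sum_piE_row_zero h _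
      refine (sum_piE_row_zero h _).trans ?_
      rw [h5, mul_zero, zero_mul]
  have h4 : (r ^ (-form P (root c) (wt P a)) * sgn ((par P a + par P b) * spar c)) •
      (ue r c * (uK r (2 • wt P a) * t a b)) = uK r (2 • wt P a) *
      ((r ^ (-(2 * form P (root c) (wt P a)) - form P (root c) (wt P b)) *
          sgn (spar c * (par P a + par P b))) • (eK r c * t a b)) * uK r (-root c) := by
    have h5 : uK r (-root c) * (uK r (2 • wt P a) * t a b) =
        r ^ (form P (root c) (wt P a) - form P (root c) (wt P b)) •
          (uK r (2 • wt P a) * (t a b * uK r (-root c))) := by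
      rw [← mul_assoc, uK_mul_comm, mul_assoc, (ht.column b).weight, mul_smul_comm,
        form_neg_left, form_neg_left]
      congr 2; ring
    have h6 : eK r c * uK r (2 • wt P a) = r ^ (-(2 * form P (root c) (wt P a))) •
        (uK r (2 • wt P a) * eK r c) := by
      rw [uK_mul_eK, smul_smul, ← zpow_add₀ hr, two_nsmul, form_add_left, form_comm (wt P a)]
      rw [show -(2 * form P (root c) (wt P a)) +
        (form P (root c) (wt P a) + form P (root c) (wt P a)) = 0 by ring, zpow_zero, one_smul]
    rw [hx, mul_assoc, h5, mul_smul_comm, ← mul_assoc (eK r c), h6, smul_mul_assoc, smul_smul,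
      smul_smul, mul_smul_comm, smul_mul_assoc]
    simp only [mul_assoc]
    congr 1
    rw [mul_comm (spar c), mul_comm (sgn _), ← mul_assoc, ← mul_assoc, ← zpow_add₀ hr,
      ← zpow_add₀ hr]
    congr 2
    ring
  rw [h1, h2, h3, h4, ← add_mul, ← mul_add, ht.eq, mul_add, add_mul]

/-- Two intertwiners of the form of the ansatz are equal. -/
theorem Intertwines.unique {g g' : Idx P → Idx P → Uq P r}
    (h : Intertwines (ofEntries g)) (h' : Intertwines (ofEntries g'))
    (h0 : ∀ a b, pos P b + 1 = P.m + 2 * P.k → g a b = g' a b) : g = g' := by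
  rw [intertwines_ofEntries] at h h'
  suffices ∀ b a, g a b = g' a b by ext a b; exact this b a
  refine arr_induction (fun b hb a => h0 a b hb) fun c d b hdb ih a => ?_
  -- In the equation at (a, d) everything except the entry in column b comes from column d, where
  -- both solutions agree.
  have e1 := h c a d
  have e2 := h' c a d
  simp only [ih] at e1
  rw [← e2] at e1
  have e3 := add_left_cancel e1
  rw [sum_piE_col hdb fun x => parityPow P r (spar c) (g a x) * uK r (-root c),
    sum_piE_col hdb fun x => parityPow P r (spar c) (g' a x) * uK r (-root c)] at e3
  have e4 := smul_right_injective _ hdb.piE_ne_zero e3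
  have e5 := congrArg (fun x => parityPow P r (spar c) (x * uK r (root c))) e4
  simpa only [mul_assoc, uK_neg_mul, mul_one, parityPow_self] using e5

end Existence

/-! ### Relations between the entries of the Lax operator -/

section Relations

variable {P : Params} {r : ℂ} {σ : Idx P → Idx P → Uq P r}

theorem entries_of_lt {a b : Idx P} (h : WtLT P a b) :
    entries σ a b = ((r ^ 2 - (r ^ 2)⁻¹) * sgn (par P b)) • σ b a := by
  rw [entries, if_neg, if_pos h]
  rintro rfl
  exact lt_irrefl _ h

theorem entries_self (a : Idx P) : entries σ a a = 1 := if_pos rfl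

theorem entries_of_not_lt {a b : Idx P} (h : ¬ WtLT P a b) (hab : a ≠ b) : entries σ a b = 0 := by
  rw [entries, if_neg hab, if_neg h]

/-- An arbitrary σ in U comes without weights or parities. By uniqueness its matrix is the
constructed one, from which it inherits them. -/
theorem isLaxMatrix_entries (hr : r ≠ 0) (hq : ∀ N : ℕ, 0 < N → (r ^ 2) ^ N ≠ 1)
    (h : Intertwines (lax r σ)) : IsLaxMatrix (entries σ) := by
  obtain ⟨t, ht⟩ := exists_isLaxMatrix (P := P) hr hq
  rw [lax_eq_ofEntries] at h
  have key := h.unique (ht.intertwines hr) fun a b hb => by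
    congr 1
    by_cases hab : a = b
    · subst hab; rw [entries_self, (ht.column a).diag]
    · have h1 : pos P a ≠ pos P b := fun h => hab (pos_inj.1 h)
      have h2 := pos_lt a
      rw [entries_of_not_lt (by unfold WtLT; omega) hab, (ht.column b).tri a (by omega)]
  have : entries σ = t := by
    ext a b
    have h1 := congrFun (congrFun key a) b
    have h2 := congrArg (fun x => uK r (-(2 • wt P a)) * x) h1
    simpa only [← mul_assoc, uK_neg_mul, one_mul] using h2
  rwa [this]

theorem exists_entries_eq (hH : r ^ 2 - (r ^ 2)⁻¹ ≠ 0) {t : Idx P → Idx P → Uq P r}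
    (ht : IsLaxMatrix t) : ∃ σ : Idx P → Idx P → Uq P r, entries σ = t := by
  refine ⟨fun b a => ((r ^ 2 - (r ^ 2)⁻¹) * sgn (par P b))⁻¹ • t a b, ?_⟩
  ext a b
  by_cases hab : a = b
  · subst hab; rw [entries_self, (ht.column a).diag]
  · by_cases h : WtLT P a b
    · rw [entries_of_lt h, smul_smul, mul_inv_cancel₀ (mul_ne_zero hH (sgn_ne_zero _)), one_smul]
    · have h1 : pos P a ≠ pos P b := fun h => hab (pos_inj.1 h)
      unfold WtLT at h
      rw [entries_of_not_lt h hab, (ht.column b).tri a (by omega)]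

/-- The commutation relations of the entries with the raising generators. -/
theorem IsLaxMatrix.star (hr : r ≠ 0) (hH : r ^ 2 - (r ^ 2)⁻¹ ≠ 0)
    (ht : IsLaxMatrix (entries σ)) (c : Simple P) {a b : Idx P} (hab : WtLT P a b) :
    r ^ (2 * form P (root c) (wt P b)) • (σ b a * eK r c) -
        (sgn (spar c * (par P a + par P b)) * r ^ (-(2 * form P (root c) (wt P a)))) •
          (eK r c * σ b a) =
      ∑ d, piE c a d • (r ^ form P (root c) (wt P d) • σ b d) -
        (sgn (spar c * (par P a + par P b)) * r ^ form P (root c) (wt P b)) •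
          ∑ d, piE c d b • σ d a := by
  have h := ht.eq c a b
  have e1 : ∑ d, piE c d b • (sgn (spar c * (par P a + par P d)) • entries σ a d) =
      ((r ^ 2 - (r ^ 2)⁻¹) * sgn (par P b) * sgn (spar c * (par P a + par P b))) •
        ∑ d, piE c d b • σ d a := by
    by_cases h : ∃ d, Arr c b d
    · obtain ⟨d, h⟩ := h
      refine (sum_piE_col h _).trans ?_
      have h5 : ∑ d, piE c d b • σ d a = _ := sum_piE_col h _
      rw [h5, entries_of_lt (lt_trans h.pos_lt hab)]
      simp only [smul_smul]
      congr 1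
      have : sgn (spar c * (par P a + par P d)) * sgn (par P d) =
          sgn (par P b) * sgn (spar c * (par P a + par P b)) := by
        rw [← sgn_add, ← sgn_add, h.par_eq]
        congr 1
        exact (by decide : ∀ x y z : ZMod 2,
          (y + z) * (x + y) + y = z + (y + z) * (x + z)) _ _ _
      linear_combination piE c d b * (r ^ 2 - (r ^ 2)⁻¹) * this
    · push Not at h
      refine (sum_piE_col_zero h _).trans ?_
      have h5 : ∑ d, piE c d b • σ d a = 0 := sum_piE_col_zero h _
      rw [h5, smul_zero]
  have e2 : ∑ d, piE c a d • (r ^ (form P (root c) (wt P d) - form P (root c) (wt P b)) •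
      entries σ d b) = ((r ^ 2 - (r ^ 2)⁻¹) * sgn (par P b) * r ^ (-form P (root c) (wt P b))) •
        ∑ d, piE c a d • (r ^ form P (root c) (wt P d) • σ b d) := by
    by_cases h : ∃ d, Arr c d a
    · obtain ⟨d, h⟩ := h
      refine (sum_piE_row h _).trans ?_
      have h5 : ∑ d, piE c a d • (r ^ form P (root c) (wt P d) • σ b d) = _ := sum_piE_row h _
      rw [h5, entries_of_lt (lt_trans hab h.pos_lt), sub_eq_add_neg (form _ _ _), zpow_add₀ hr]
      simp only [smul_smul]
      congr 1
      ring
    · push Not at h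
      refine (sum_piE_row_zero h _).trans ?_
      have h5 : ∑ d, piE c a d • (r ^ form P (root c) (wt P d) • σ b d) = 0 :=
        sum_piE_row_zero h _
      rw [h5, smul_zero]
  rw [e1, e2, entries_of_lt hab, smul_mul_assoc, mul_smul_comm] at h
  generalize ∑ d, piE c d b • σ d a = S at h ⊢
  generalize ∑ d, piE c a d • (r ^ form P (root c) (wt P d) • σ b d) = T at h ⊢
  have h3 := congrArg (fun x => ((r ^ 2 - (r ^ 2)⁻¹)⁻¹ * sgn (par P b) *
    r ^ form P (root c) (wt P b)) • x) h
  simp only [smul_add, smul_smul] at h3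
  have hb := sgn_mul_self (par P b)
  have hn : r ^ form P (root c) (wt P b) * r ^ (-form P (root c) (wt P b)) = 1 := by
    rw [← zpow_add₀ hr, add_neg_cancel, zpow_zero]
  have hi := inv_mul_cancel₀ hH
  generalize hHH : r ^ 2 - (r ^ 2)⁻¹ = H at *
  have e0 : H⁻¹ * sgn (par P b) * (H * sgn (par P b)) = 1 := by
    rw [mul_mul_mul_comm, hi, hb, one_mul]
  have e3 : H⁻¹ * sgn (par P b) * r ^ form P (root c) (wt P b) *
      (r ^ form P (root c) (wt P b) * (H * sgn (par P b))) =
      r ^ (2 * form P (root c) (wt P b)) := by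
    rw [two_mul, zpow_add₀ hr]
    linear_combination r ^ form P (root c) (wt P b) * r ^ form P (root c) (wt P b) * e0
  have e4 : H⁻¹ * sgn (par P b) * r ^ form P (root c) (wt P b) *
      (H * sgn (par P b) * sgn (spar c * (par P a + par P b))) =
      sgn (spar c * (par P a + par P b)) * r ^ form P (root c) (wt P b) := by
    linear_combination sgn (spar c * (par P a + par P b)) * r ^ form P (root c) (wt P b) * e0
  have e5 : H⁻¹ * sgn (par P b) * r ^ form P (root c) (wt P b) *
      (H * sgn (par P b) * r ^ (-form P (root c) (wt P b))) = 1 := by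
    linear_combination
      r ^ form P (root c) (wt P b) * r ^ (-form P (root c) (wt P b)) * e0 + hn
  have e6 : H⁻¹ * sgn (par P b) * r ^ form P (root c) (wt P b) *
      (r ^ (-(2 * form P (root c) (wt P a)) - form P (root c) (wt P b)) *
          sgn (spar c * (par P a + par P b)) * (H * sgn (par P b))) =
      sgn (spar c * (par P a + par P b)) * r ^ (-(2 * form P (root c) (wt P a))) := by
    rw [sub_eq_add_neg, zpow_add₀ hr]
    linear_combination sgn (spar c * (par P a + par P b)) * r ^ (-(2 * form P (root c) (wt P a))) *
      (r ^ form P (root c) (wt P b) * r ^ (-form P (root c) (wt P b)) * e0 + hn)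
  rw [e3, e4, e5, e6, one_smul] at h3
  rw [sub_eq_sub_iff_add_eq_add]
  exact h3

/-- At most one edge labelled c enters a and at most one leaves b. The four cases of
`IsLaxMatrix.star` are separated here and in the next three lemmas. -/
theorem IsLaxMatrix.star_none (hr : r ≠ 0) (hH : r ^ 2 - (r ^ 2)⁻¹ ≠ 0)
    (ht : IsLaxMatrix (entries σ)) {c : Simple P} {a b : Idx P} (hab : WtLT P a b)
    (ha : ∀ d, ¬ Arr c d a) (hb : ∀ d, ¬ Arr c b d) :
    r ^ (2 * form P (root c) (wt P b)) • (σ b a * eK r c) -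
        (sgn (spar c * (par P a + par P b)) * r ^ (-(2 * form P (root c) (wt P a)))) •
          (eK r c * σ b a) = 0 := by
  rw [ht.star hr hH c hab]
  have h5 : ∑ d, piE c d b • σ d a = 0 := sum_piE_col_zero hb _
  rw [h5, smul_zero, sub_zero]
  exact sum_piE_row_zero ha _

theorem IsLaxMatrix.star_out (hr : r ≠ 0) (hH : r ^ 2 - (r ^ 2)⁻¹ ≠ 0)
    (ht : IsLaxMatrix (entries σ)) {c : Simple P} {a b b' : Idx P} (hab : WtLT P a b)
    (ha : ∀ d, ¬ Arr c d a) (hb : Arr c b b') :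
    r ^ (2 * form P (root c) (wt P b)) • (σ b a * eK r c) -
        (sgn (spar c * (par P a + par P b)) * r ^ (-(2 * form P (root c) (wt P a)))) •
          (eK r c * σ b a) =
      -((sgn (spar c * (par P a + par P b)) * r ^ form P (root c) (wt P b) * piE c b' b) •
        σ b' a) := by
  rw [ht.star hr hH c hab]
  have h5 : ∑ d, piE c d b • σ d a = _ := sum_piE_col hb _
  have h6 : ∑ d, piE c a d • (r ^ form P (root c) (wt P d) • σ b d) = 0 := sum_piE_row_zero ha _
  rw [h5, h6, zero_sub, smul_smul]

theorem IsLaxMatrix.star_in (hr : r ≠ 0) (hH : r ^ 2 - (r ^ 2)⁻¹ ≠ 0)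
    (ht : IsLaxMatrix (entries σ)) {c : Simple P} {a a' b : Idx P} (hab : WtLT P a b)
    (ha : Arr c a' a) (hb : ∀ d, ¬ Arr c b d) :
    r ^ (2 * form P (root c) (wt P b)) • (σ b a * eK r c) -
        (sgn (spar c * (par P a + par P b)) * r ^ (-(2 * form P (root c) (wt P a)))) •
          (eK r c * σ b a) = (piE c a a' * r ^ form P (root c) (wt P a')) • σ b a' := by
  rw [ht.star hr hH c hab]
  have h5 : ∑ d, piE c d b • σ d a = 0 := sum_piE_col_zero hb _
  have h6 : ∑ d, piE c a d • (r ^ form P (root c) (wt P d) • σ b d) = _ := sum_piE_row ha _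
  rw [h5, h6, smul_zero, sub_zero, smul_smul]

theorem IsLaxMatrix.star_both (hr : r ≠ 0) (hH : r ^ 2 - (r ^ 2)⁻¹ ≠ 0)
    (ht : IsLaxMatrix (entries σ)) {c : Simple P} {a a' b b' : Idx P} (hab : WtLT P a b)
    (ha : Arr c a' a) (hb : Arr c b b') :
    r ^ (2 * form P (root c) (wt P b)) • (σ b a * eK r c) -
        (sgn (spar c * (par P a + par P b)) * r ^ (-(2 * form P (root c) (wt P a)))) •
          (eK r c * σ b a) = (piE c a a' * r ^ form P (root c) (wt P a')) • σ b a' -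
      (sgn (spar c * (par P a + par P b)) * r ^ form P (root c) (wt P b) * piE c b' b) •
        σ b' a := by
  rw [ht.star hr hH c hab]
  have h5 : ∑ d, piE c d b • σ d a = _ := sum_piE_col hb _
  have h6 : ∑ d, piE c a d • (r ^ form P (root c) (wt P d) • σ b d) = _ := sum_piE_row ha _
  rw [h5, h6, smul_smul, smul_smul]

/-- An edge labelled c changes the weight by α_c, so the condition on weights excludes the relevant
edges. -/
theorem IsLaxMatrix.qCommutation (hr : r ≠ 0) (hH : r ^ 2 - (r ^ 2)⁻¹ ≠ 0)
    (ht : IsLaxMatrix (entries σ)) : QCommutation σ := by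
  intro c a b hab ha hb
  have := ht.star_none hr hH (c := c) hab
    (fun d h => ha d (by rw [h.wt_eq, add_sub_cancel_right])) (fun d h => hb d h.wt_eq.symm)
  have hz : ∀ n : ℤ, (r ^ 2) ^ n = r ^ (2 * n) := fun n => by
    rw [zpow_mul]; rfl
  rw [hz, hz, mul_comm (par P a + par P b), mul_neg]
  exact this

theorem eq_smul_of_add_eq {M : Type*} [AddCommGroup M] [Module ℂ M] {x y : M} {A B C k : ℂ}
    (h : A • x + B • y = C • x) (hB : B ≠ 0) (hk : B * k = C - A) : y = k • x := by
  refine smul_right_injective M hB ?_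
  simp only
  rw [smul_smul, hk, sub_smul, ← h, add_sub_cancel_left]

theorem eq_smul_of_eq_add {M : Type*} [AddCommGroup M] [Module ℂ M] {x y : M} {A B C k : ℂ}
    (h : A • x = B • y + C • x) (hB : B ≠ 0) (hk : B * k = A - C) : y = k • x := by
  refine smul_right_injective M hB ?_
  simp only
  rw [smul_smul, hk, sub_smul, h, add_sub_cancel_right]

theorem neg_neg_smul {M : Type*} [AddCommGroup M] [Module ℂ M] (t : ℂ) (x : M) :
    -(-t • x) = t • x := by
  rw [neg_smul, neg_neg]

/-- The entries along the edges of the crystal graph. -/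
theorem IsLaxMatrix.edge (hr : r ≠ 0) (hH : r ^ 2 - (r ^ 2)⁻¹ ≠ 0)
    (ht : IsLaxMatrix (entries σ)) {c : Simple P} {d b : Idx P} (h : Arr c d b) :
    σ b d = (r ^ form P (wt P d) (wt P d) * (piE c b d)⁻¹) • eK r c := by
  have hm := m_eq (P := P)
  have hl := one_le_l (P := P)
  have hk := P.k_pos
  have hc := node_lt c
  have hlast := node_last (P := P)
  have hne := h.ne_bar
  rw [Ne, eq_bar_iff] at hne
  have hpos := h.pos_lt
  have hbd : form P (wt P b) (wt P d) = 0 := form_wt_of_ne (by omega) (by omega)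
  have hroot : root c = wt P b - wt P d := by rw [h.wt_eq, add_sub_cancel_left]
  have hπ := h.piE_ne_zero
  -- If another edge with label c enters d, then m is odd and d has weight zero. The diagonal
  -- equation at d would then contain two unknown entries, so the one at b is used.
  by_cases he : ∃ e, Arr c e d
  · obtain ⟨e, he⟩ := he
    obtain ⟨hp, hcl⟩ := he.self_comp h
    rw [← hcl] at hlast
    have hd : pos P d = P.k + P.l ∧ pos P b + 1 = P.k + P.l := by
      rw [arr_iff] at he h
      omega
    have hdd : form P (wt P d) (wt P d) = 0 := form_wt_of_mid rfl (by omega)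
    have hbb : form P (wt P b) (wt P b) = 1 := by
      rw [form_wt_of_eq rfl (by omega), posSign_even (by omega) (by omega)]
    have hnb : form P (root c) (wt P b) = 1 := by
      rw [hroot, form_sub_left, form_comm (wt P d), hbb, hbd, sub_zero]
    have hnd : form P (root c) (wt P d) = 0 := by
      rw [hroot, form_sub_left, hbd, hdd, sub_zero]
    have hbpar : sgn (par P b) = 1 := by
      rw [par_eq, if_pos (by omega), sgn_zero]
    have h1 := ht.eq c b b
    have h5 : ∑ d, piE c d b •
        (sgn (spar c * (par P b + par P d)) • entries σ b d) = 0 :=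
      sum_piE_col_zero (fun x hx => he.cube h hx) _
    have h6 : ∑ d, piE c b d • (r ^ (form P (root c) (wt P d) -
      form P (root c) (wt P b)) • entries σ d b) = _ := sum_piE_row h _
    rw [h5, h6, entries_self, entries_of_lt hpos, hnb, hnd, one_mul, mul_one (eK r c), add_zero, hbpar,
      CharTwo.add_self_eq_zero, mul_zero, sgn_zero, smul_smul, smul_smul] at h1
    rw [hdd]
    refine eq_smul_of_eq_add (M := Uq P r) h1 (mul_ne_zero (mul_ne_zero hπ (zpow_ne_zero _ hr))
      (mul_ne_zero hH one_ne_zero)) ?_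
    norm_num
    field_simp
  · push Not at he
    have hdm : pos P d + pos P d + 1 ≠ P.m + 2 * P.k := by
      intro hd
      obtain ⟨e, he'⟩ := exists_pos (P := P) (p := pos P d + 1) (by omega)
      refine he e ?_
      rw [arr_iff] at h ⊢
      omega
    have hdd : form P (wt P d) (wt P d) = posSign P (pos P d) := form_wt_of_eq rfl hdm
    have hn : form P (root c) (wt P d) = -posSign P (pos P d) := by
      rw [hroot, form_sub_left, hbd, hdd, zero_sub]
    -- Since the diagonal entries are 1, the diagonal equation at d involves only e_c q^(h_c/2) and
    -- the entry along the edge.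
    have h1 := ht.eq c d d
    have h5 : ∑ x, piE c x d • (sgn (spar c * (par P d + par P x)) • entries σ d x) = _ :=
      sum_piE_col h _
    have h6 : ∑ x, piE c d x • (r ^ (form P (root c) (wt P x) - form P (root c) (wt P d)) •
      entries σ x d) = 0 := sum_piE_row_zero he _
    have hs : sgn (spar c * (par P d + par P b)) * sgn (par P b) = sgn (par P d) := by
      rw [← sgn_add, h.par_eq]
      congr 1
      exact (by decide : ∀ x y : ZMod 2, (x + y) * (y + x) + x = y) _ _
    rw [h5, h6, entries_self, entries_of_lt hpos, hn, one_mul, mul_one, zero_add,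
      CharTwo.add_self_eq_zero, mul_zero, sgn_zero, smul_smul, smul_smul] at h1
    rw [hdd]
    have hs' : piE c b d * sgn (spar c * (par P d + par P b)) *
        ((r ^ 2 - (r ^ 2)⁻¹) * sgn (par P b)) =
        piE c b d * ((r ^ 2 - (r ^ 2)⁻¹) * sgn (par P d)) := by
      rw [← hs]; ring
    rw [hs'] at h1
    refine eq_smul_of_add_eq h1 (mul_ne_zero hπ (mul_ne_zero hH (sgn_ne_zero _))) ?_
    rw [par_eq, posSign]
    split_ifs
    · rw [sgn_zero]
      norm_num
      field_simp
    · rw [sgn_one]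
      norm_num
      field_simp

theorem IsLaxMatrix.fundamentalValues (hr : r ≠ 0) (hH : r ^ 2 - (r ^ 2)⁻¹ ≠ 0)
    (ht : IsLaxMatrix (entries σ)) : FundamentalValues σ := by
  have hm := m_eq (P := P)
  have hl := one_le_l (P := P)
  have hk := P.k_pos
  have h1 : ∀ c : Simple P, σ (row c) (col c) =
      r ^ form P (wt P (col c)) (wt P (col c)) • eK r c := by
    intro c
    rw [ht.edge hr hH (Or.inl ⟨rfl, rfl⟩), piE_row_col, inv_one, mul_one]
  have h2 : ∀ c : Simple P, σ (bar P (col c)) (bar P (row c)) =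
      (r ^ form P (wt P (row c)) (wt P (row c)) *
        (-(sgn (par P (row c) * (par P (row c) + par P (col c))) * xi P (row c) *
          xi P (col c)))⁻¹) • eK r c := by
    intro c
    rw [ht.edge hr hH (Or.inr ⟨rfl, rfl⟩), piE_bar, wt_bar, form_neg_left, form_neg_right, neg_neg]
  have hsq : ∀ a : Idx P, pos P a + pos P a + 1 ≠ P.m + 2 * P.k →
      form P (wt P a) (wt P a) = if par P a = 0 then 1 else -1 := by
    intro a ha
    rw [form_wt_of_eq rfl ha, posSign, par_eq]
    by_cases h : P.k ≤ pos P a ∧ pos P a < P.k + P.m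
    · rw [if_pos h, if_pos h, if_pos rfl]
    · rw [if_neg h, if_neg h, if_neg one_ne_zero]
  have hrow : ∀ c : Simple P, pos P (row c) + pos P (row c) + 1 ≠ P.m + 2 * P.k := by
    intro c
    have := node_lt c
    rcases pos_row_col c with ⟨h1, h2, -⟩ | ⟨he, rfl, h1, h2⟩ <;> omega
  have hcol : ∀ c : Simple P, (P.m % 2 = 1 → c ≠ Simple.last) →
      pos P (col c) + pos P (col c) + 1 ≠ P.m + 2 * P.k := by
    intro c hc
    have := node_lt c
    have := node_last (P := P)
    have hc' : P.m % 2 = 1 → node c ≠ node Simple.last := fun h h' => hc h (node_inj h')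
    rcases pos_row_col c with ⟨h1, h2, -⟩ | ⟨he, rfl, h1, h2⟩ <;> omega
  refine ⟨fun i => ?_, fun hp => ?_, fun hp => ?_, fun hp => ?_, fun j => ?_, ?_⟩
  · have e1 : par P (row (Simple.even i)) = 0 := rfl
    have e2 : par P (col (Simple.even i)) = 0 := rfl
    have e3 : xi P (row (Simple.even i)) = 1 := rfl
    have e4 : xi P (col (Simple.even i)) = 1 := rfl
    rw [h1, h2, hsq _ (hrow _), hsq _ (hcol _ (by simp)), e1, e2, e3, e4]
    simp only [add_zero, mul_zero, sgn_zero, mul_one, if_true, zpow_one, inv_neg, inv_one, mul_neg,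
      true_and]
    exact neg_neg_smul r _
  · have hc := par_row_col_of_even (P := P) (c := Simple.last) (by
      have := node_last (P := P)
      have := two_le_l (P := P) (Nat.even_iff.1 hp)
      rcases pos_row_col (Simple.last : Simple P) with ⟨h1, h2, -⟩ | ⟨he, -, h1, h2⟩ <;> omega)
    rw [h1, h2, hsq _ (hrow _), hsq _ (hcol _ (by rw [Nat.even_iff] at hp; omega)), xi_of_par hc.1,
      xi_of_par hc.2, hc.1, hc.2]
    simp only [add_zero, mul_zero, sgn_zero, mul_one, if_true, zpow_one, inv_neg, inv_one, mul_neg,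
      true_and]
    exact neg_neg_smul r _
  · obtain ⟨b, hb⟩ := exists_pos (P := P) (p := P.k + P.l + 1) (by
      have := two_le_l (P := P) (Nat.even_iff.1 hp); omega)
    obtain ⟨d, hd⟩ : ∃ d, d = ev P (P.l - 1) (lt_m_of_le (by omega)) := ⟨_, rfl⟩
    rw [← hd]
    rw [Nat.even_iff] at hp
    have hdp : pos P d + 1 = P.k + P.l := by
      rw [hd]
      change P.k + (P.l - 1) + 1 = _
      omega
    have hbar := pos_bar d
    have hlast := node_last (P := P)
    -- Here `b` lies one position below `bar P d`, so the entry in that row and in column `b` is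
    -- zero by triangularity. The last label has an edge from `b` to `d`, and the equation reduces
    -- to a nonzero multiple of the desired entry.
    have h3 := ht.eq Simple.last (bar P d) b
    have h4 : Arr Simple.last b d := (arr_iff _ _ _).2 (by omega)
    have h5 : ∑ x, piE Simple.last x b • (sgn (spar (Simple.last : Simple P) *
      (par P (bar P d) + par P x)) • entries σ (bar P d) x) = _ := sum_piE_col h4 _
    have h6 : ∑ x, piE Simple.last (bar P d) x • (r ^ (form P (root Simple.last) (wt P x) -
        form P (root Simple.last) (wt P b)) • entries σ x b) = 0 :=
      sum_piE_row_zero (fun x hx => by rw [arr_iff] at hx; omega) _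
    rw [h5, h6, entries_of_not_lt (by unfold WtLT; omega) (by rintro rfl; omega), zero_mul,
      mul_zero, smul_zero, smul_zero, zero_add, add_zero,
      entries_of_lt (by unfold WtLT; omega)] at h3
    have h7 := smul_right_injective _ h4.piE_ne_zero (h3.trans (smul_zero _).symm)
    have h8 := smul_right_injective _ (sgn_ne_zero _) (h7.trans (smul_zero _).symm)
    exact smul_right_injective _ (mul_ne_zero hH (sgn_ne_zero _)) (h8.trans (smul_zero _).symm)
  · have hc := par_row_col_of_even (P := P) (c := Simple.last) (by
      have := node_last (P := P)
      rw [Nat.even_iff] at hp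
      rcases pos_row_col (Simple.last : Simple P) with ⟨h1, h2, -⟩ | ⟨he, -, h1, h2⟩ <;> omega)
    have hmid : form P (wt P (col (Simple.last : Simple P))) (wt P (col Simple.last)) = 0 := by
      have := node_last (P := P)
      rw [Nat.even_iff] at hp
      refine form_wt_of_mid rfl ?_
      rcases pos_row_col (Simple.last : Simple P) with ⟨h1, h2, -⟩ | ⟨he, -, h1, h2⟩ <;> omega
    rw [h1, h2, hsq _ (hrow _), hmid, xi_of_par hc.1, xi_of_par hc.2, hc.1, hc.2]
    simp [sgn_zero, smul_smul, hr]
  · have e1 : par P (row (Simple.odd j)) = 1 := rfl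
    have e2 : par P (col (Simple.odd j)) = 1 := rfl
    have e3 : xi P (row (Simple.odd j)) = (-1) ^ (j.val + 1) := rfl
    have e4 : xi P (col (Simple.odd j)) = (-1) ^ (j.val + 1 + 1) := rfl
    have e5 : (-1 : ℂ) ^ (j.val + 1) * (-1) ^ (j.val + 1 + 1) = -1 := by
      rw [pow_succ (-1 : ℂ) (j.val + 1), ← mul_assoc, ← mul_pow]; simp
    rw [h1, h2, hsq _ (hrow _), hsq _ (hcol _ (by simp)), e1, e2, e3, e4,
      CharTwo.add_self_eq_zero, mul_zero, sgn_zero, one_mul, e5]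
    simp
  · have e1 : par P (row (Simple.s : Simple P)) = 1 := rfl
    have e2 : par P (col (Simple.s : Simple P)) = 0 := rfl
    have e3 : xi P (row (Simple.s : Simple P)) = (-1) ^ P.k := by
      change (-1 : ℂ) ^ (P.k - 1 + 1) = _
      rw [Nat.sub_add_cancel hk]
    have e4 : xi P (col (Simple.s : Simple P)) = 1 := rfl
    rw [h1, h2, hsq _ (hrow _), hsq _ (hcol _ (by simp)), e1, e2, e3, e4, add_zero, mul_one (1 : ZMod 2),
      sgn_one, smul_smul]
    refine ⟨by simp, ?_⟩
    congr 1
    simp only [one_ne_zero, if_false, zpow_neg, zpow_one, mul_one, neg_mul, one_mul, neg_neg]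
    field_simp

end Relations

/-! ### The induction relations -/

/-! ### Bracket identities of Jacobi type -/

section Algebra

variable {A : Type*} [Ring A] [Algebra ℂ A]

/-- A q-Jacobi identity: [X, [Y, Z]] = [[X, Y], Z] for suitable q-brackets when X and Z q-commute.
In the mirrored version that follows, [[X, Y], Z] is rebracketed as [X, [Y, Z]]. -/
theorem induction_step_left {X Y Z U V W : A} {Q D C ε₁ ε₄ S : ℂ}
    (hW : W = Q • (X * V) - (D * ε₁) • (V * X)) (hV : V = Y * Z - (C * (ε₄ * S)) • (Z * Y))
    (hU : U = X * Y - (D * (ε₁ * S)) • (Y * X)) (hZX : Z * X = (S * Q) • (X * Z)) :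
    W = Q • (U * Z) - (C * ε₄) • (Z * U) := by
  have h1 : Z * (X * Y) = (S * Q) • (X * (Z * Y)) := by
    rw [← mul_assoc, hZX, smul_mul_assoc, mul_assoc]
  subst hW hV hU
  simp only [mul_sub, sub_mul, mul_smul_comm, smul_mul_assoc, mul_assoc, h1, hZX]
  module

theorem induction_step_right {X Y Z U V W : A} {Q D C ε₁ ε₄ S : ℂ}
    (hW : W = Q • (V * Z) - (D * ε₁) • (Z * V)) (hV : V = X * Y - (C * (ε₄ * S)) • (Y * X))
    (hU : U = Y * Z - (D * (ε₁ * S)) • (Z * Y)) (hXZ : Z * X = (S * Q) • (X * Z)) :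
    W = Q • (X * U) - (C * ε₄) • (U * X) := by
  have h1 : Z * (X * Y) = (S * Q) • (X * (Z * Y)) := by
    rw [← mul_assoc, hXZ, smul_mul_assoc, mul_assoc]
  subst hW hV hU
  simp only [mul_sub, sub_mul, mul_smul_comm, smul_mul_assoc, mul_assoc, h1, hXZ]
  module

/-- At the fold W and Y no longer q-commute: their bracket is V, and the bracket of V with Z is T.
The same T occurs as the second term in the bracket of E with Y, and the two contributions cancel.
-/
theorem induction_fold_left {X Y Z U V W T E : A} {Δ Γ v s₃ s₄ : ℂ} (hs : s₄ * s₄ = 1)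
    (h1 : Δ • E = Z * W - (Δ * Γ * (s₃ * s₄)) • (W * Z)) (hU : U = Y * Z - (Δ * s₃) • (Z * Y))
    (h3 : W * Y - (s₃ * Δ) • (Y * W) = v • V) (h4 : Γ • (V * Z) - s₄ • (Z * V) = -(s₄ • T))
    (h2 : Δ • (E * Y) - Δ • (Y * E) = v • T - X) : X = U * W - (Γ * s₄) • (W * U) := by
  have h1a : Δ • (E * Y) = (Δ • E) * Y := (smul_mul_assoc _ _ _).symm
  have h1b : Δ • (Y * E) = Y * (Δ • E) := (mul_smul_comm _ _ _).symm
  have h4' : T = Z * V - (s₄ * Γ) • (V * Z) := by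
    have := congrArg (fun x => s₄ • x) h4
    simp only [smul_sub, smul_neg, smul_smul, hs, one_smul] at this
    rw [← neg_eq_iff_eq_neg.2 this]; abel
  have h3' : W * Y = (s₃ * Δ) • (Y * W) + v • V := by rw [← h3]; abel
  have h3a : W * (Y * Z) = (s₃ * Δ) • (Y * (W * Z)) + v • (V * Z) := by
    rw [← mul_assoc, h3', add_mul, smul_mul_assoc, smul_mul_assoc, mul_assoc]
  have hX : X = v • T - (Δ • (E * Y) - Δ • (Y * E)) := by rw [h2]; abel
  rw [hX, h1a, h1b, h1, hU, h4']
  simp only [mul_sub, sub_mul, mul_smul_comm, smul_mul_assoc, mul_assoc, h3', h3a, mul_add]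
  module

theorem induction_fold_right {X Y Z U V W T E : A} {Δ Γ v s₃ s₄ : ℂ} (hs : s₃ * s₃ = 1)
    (h1 : Δ • E = W * Z - (Δ * Γ * (s₃ * s₄)) • (Z * W)) (hU : U = Z * Y - (Δ * s₃) • (Y * Z))
    (h3 : Δ • (W * Y) - s₃ • (Y * W) = -((s₃ * v) • V)) (h4 : V * Z - (s₄ * Γ) • (Z * V) = T)
    (h2 : Δ • (E * Y) - Δ • (Y * E) = X - v • T) : X = W * U - (Γ * s₄) • (U * W) := by
  have h1a : Δ • (E * Y) = (Δ • E) * Y := (smul_mul_assoc _ _ _).symm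
  have h1b : Δ • (Y * E) = Y * (Δ • E) := (mul_smul_comm _ _ _).symm
  have h3' : Y * W = (s₃ * Δ) • (W * Y) + v • V := by
    have := congrArg (fun x => s₃ • x) h3
    simp only [smul_sub, smul_neg, smul_smul, hs, one_smul, ← mul_assoc, one_mul] at this
    rw [sub_eq_iff_eq_add] at this
    rw [this]; abel
  have h3a : Y * (W * Z) = (s₃ * Δ) • (W * (Y * Z)) + v • (V * Z) := by
    rw [← mul_assoc, h3', add_mul, smul_mul_assoc, smul_mul_assoc, mul_assoc]
  have hX : X = v • T + (Δ • (E * Y) - Δ • (Y * E)) := by rw [h2]; abel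
  rw [hX, h1a, h1b, h1, hU, ← h4]
  simp only [mul_sub, sub_mul, mul_smul_comm, smul_mul_assoc, mul_assoc, h3', h3a, mul_add]
  module

theorem induction_edge_left {X V W x : A} {p q S u κ : ℂ} (hS : S * S = 1)
    (h : p • (V * x) - (S * q) • (x * V) = -((S * u) • W)) (hX : X = κ • x) (hκ : κ * u = 1) :
    W = q • (X * V) - (p * S) • (V * X) := by
  have h1 := congrArg (fun y => (-(κ * S)) • y) h
  simp only [smul_neg, smul_smul, smul_sub] at h1
  rw [← neg_smul, show -(-(κ * S) * (S * u)) = 1 by linear_combination κ * u * hS + hκ,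
    one_smul] at h1
  rw [← h1, hX, smul_mul_assoc, mul_smul_comm]
  match_scalars
  · ring
  · linear_combination κ * q * hS

theorem induction_edge_right {X V W x : A} {p q S u κ : ℂ}
    (h : p • (V * x) - (S * q) • (x * V) = u • W) (hX : X = κ • x) (hκ : κ * u = 1) :
    W = p • (V * X) - (q * S) • (X * V) := by
  have h1 := congrArg (fun y => κ • y) h
  simp only [smul_smul, smul_sub, hκ, one_smul] at h1
  rw [← h1, hX, smul_mul_assoc, mul_smul_comm]
  module

end Algebra

section Algebra

variable {A : Type*} [Ring A] [Algebra ℂ A]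

/-- The commutation rules are stated for e_c q^(h_c/2), the induction relations for the entries
along edges; the two differ by the scalars κ and lam. -/
theorem induction_fold_left_of_edges {X Y Z U V W T E x y : A} {Δ Γ s₃ s₄ κ u w lam p : ℂ}
    (hs : s₄ * s₄ = 1) (hx : Y = κ • x) (hy : Z = lam • y) (hu : κ * u = 1) (hw : lam * w = 1)
    (h1 : Δ • E = Z * W - (Δ * (Γ * (s₃ * s₄))) • (W * Z)) (hU : U = Y * Z - (Δ * s₃) • (Z * Y))
    (h3 : W * x - (s₃ * Δ) • (x * W) = p • V) (h4 : Γ • (V * y) - s₄ • (y * V) = -((s₄ * w) • T))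
    (h2 : Δ • (E * x) - Δ • (x * E) = p • T - u • X) : X = U * W - (Γ * s₄) • (W * U) := by
  refine induction_fold_left (v := κ * p) (V := V) (T := T) (E := E) (Δ := Δ) (s₃ := s₃) hs ?_ hU
    ?_ ?_ ?_
  · rw [h1, mul_assoc]
  · rw [hx, mul_smul κ, ← h3]
    simp only [mul_smul_comm, smul_mul_assoc]
    module
  · have := congrArg (fun z => lam • z) h4
    simp only [smul_sub, smul_neg, smul_smul] at this
    rw [mul_left_comm, hw, mul_one] at this
    rw [hy, mul_smul_comm, smul_mul_assoc, smul_smul, smul_smul, mul_comm Γ, mul_comm s₄, this]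
  · have := congrArg (fun z => κ • z) h2
    simp only [smul_sub, smul_smul, hu, one_smul] at this
    rw [← this, hx]
    simp only [mul_smul_comm, smul_mul_assoc, smul_smul, mul_comm]

theorem induction_fold_right_of_edges {X Y Z U V W T E x y : A} {Δ Γ s₃ s₄ κ u w lam p : ℂ}
    (hs : s₃ * s₃ = 1) (hx : Y = κ • x) (hy : Z = lam • y) (hu : κ * u = 1) (hw : lam * w = 1)
    (h1 : Δ • E = W * Z - (Δ * (Γ * (s₃ * s₄))) • (Z * W)) (hU : U = Z * Y - (Δ * s₃) • (Y * Z))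
    (h3 : Δ • (W * x) - s₃ • (x * W) = -((s₃ * p) • V))
    (h4 : V * y - (s₄ * Γ) • (y * V) = w • T)
    (h2 : Δ • (E * x) - Δ • (x * E) = u • X - p • T) : X = W * U - (Γ * s₄) • (U * W) := by
  refine induction_fold_right (v := κ * p) (V := V) (T := T) (E := E) (Δ := Δ) (s₃ := s₃) hs ?_ hU
    ?_ ?_ ?_
  · rw [h1, mul_assoc]
  · have := congrArg (fun z => κ • z) h3
    simp only [smul_sub, smul_neg, smul_smul] at this
    rw [hx, mul_smul_comm, smul_mul_assoc, smul_smul, smul_smul, mul_comm Δ, mul_comm s₃, this,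
      mul_left_comm]
  · have := congrArg (fun z => lam • z) h4
    simp only [smul_sub, smul_smul, hw, one_smul] at this
    rw [← this, hy]
    simp only [mul_smul_comm, smul_mul_assoc, smul_smul, mul_comm]
  · have := congrArg (fun z => κ • z) h2
    simp only [smul_sub, smul_smul, hu, one_smul] at this
    rw [← this, hx]
    simp only [mul_smul_comm, smul_mul_assoc, smul_smul, mul_comm]

end Algebra

/-! ### Induction relations along edges and across the fold -/

section InductionAt

variable {P : Params} {r : ℂ} {σ : Idx P → Idx P → Uq P r}

/-- The induction relation for the triple `b, c, a`. -/
def InductionAt (σ : Idx P → Idx P → Uq P r) (b c a : Idx P) : Prop :=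
  σ b a = r ^ (-(2 * form P (wt P b) (wt P a))) • (σ b c * σ c a) -
    (r ^ (-(2 * form P (wt P c) (wt P c))) *
      sgn ((par P b + par P c) * (par P a + par P c))) • (σ c a * σ b c)

theorem InductionAt.of_form_eq_zero {b c a : Idx P} (h : InductionAt σ b c a)
    (h0 : form P (wt P b) (wt P a) = 0) :
    σ b a = σ b c * σ c a - (r ^ (-(2 * form P (wt P c) (wt P c))) *
      sgn ((par P b + par P c) * (par P a + par P c))) • (σ c a * σ b c) := by
  unfold InductionAt at h
  rwa [h0, mul_zero, neg_zero, zpow_zero, one_smul] at h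

/-- A label has just two edges, interchanged by the involution. With the companion for sources this
shows which edges can occur in an application of `IsLaxMatrix.star`. -/
theorem Arr.eq_or_eq_bar {e : Simple P} {d b x a : Idx P} (h : Arr e d b) (h' : Arr e x a) :
    a = b ∨ a = Osp.bar P d := by
  rcases h with ⟨rfl, rfl⟩ | ⟨rfl, rfl⟩ <;> rcases h' with ⟨rfl, rfl⟩ | ⟨rfl, rfl⟩ <;>
    simp [bar_bar]

theorem Arr.source_eq_or_eq_bar {e : Simple P} {d b x a : Idx P} (h : Arr e d b)
    (h' : Arr e a x) : a = d ∨ a = Osp.bar P b := by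
  rcases h with ⟨rfl, rfl⟩ | ⟨rfl, rfl⟩ <;> rcases h' with ⟨rfl, rfl⟩ | ⟨rfl, rfl⟩ <;>
    simp [bar_bar]

theorem Arr.form_eq {e : Simple P} {d b : Idx P} (h : Arr e d b) (x : Idx P) :
    form P (root e) (wt P x) = form P (wt P b) (wt P x) - form P (wt P d) (wt P x) := by
  rw [h.wt_eq, form_add_left, add_sub_cancel_left]

theorem form_wt_eq_zero {a b : Idx P} (h : a ≠ b) (h' : a ≠ bar P b) :
    form P (wt P a) (wt P b) = 0 :=
  form_wt_of_ne (fun h1 => h (pos_inj.1 h1)) (fun h1 => h' (eq_bar_iff.2 h1))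

theorem ne_of_wtLT {a b : Idx P} (h : WtLT P a b) : b ≠ a := by
  rintro rfl
  exact lt_irrefl _ h

/-- Commuting the entry for (d, a) with e, where e leads from d up to b, produces the entry for (b,
a). No edge labelled e enters a, since its only targets are b and the opposite of d. -/
theorem IsLaxMatrix.induction_base_left (hr : r ≠ 0) (hH : r ^ 2 - (r ^ 2)⁻¹ ≠ 0)
    (ht : IsLaxMatrix (entries σ)) {e : Simple P} {d b a : Idx P} (h : Arr e d b)
    (hda : WtLT P a d) (hne : d ≠ bar P a) : InductionAt σ b d a := by
  have hba : WtLT P a b := lt_trans h.pos_lt hda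
  have hbd : form P (wt P b) (wt P d) = 0 := form_wt_eq_zero h.ne h.ne_bar
  have hda0 : form P (wt P d) (wt P a) = 0 := form_wt_eq_zero (ne_of_wtLT hda) hne
  have hne' : a ≠ bar P d := fun h1 => hne (by rw [h1, bar_bar])
  have key := ht.star_out hr hH hda
    (fun x hx => (h.eq_or_eq_bar hx).elim (ne_of_wtLT hba).symm hne') h
  rw [h.form_eq, h.form_eq, hbd, hda0, sub_zero, zero_sub, h.par_eq, mul_neg, mul_assoc] at key
  have hX := ht.edge hr hH h
  refine (induction_edge_left (sgn_mul_self _) key hX ?_)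
  rw [zpow_neg]
  have := zpow_ne_zero (form P (wt P d) (wt P d)) hr
  have := h.piE_ne_zero
  field_simp

theorem IsLaxMatrix.induction_base_right (hr : r ≠ 0) (hH : r ^ 2 - (r ^ 2)⁻¹ ≠ 0)
    (ht : IsLaxMatrix (entries σ)) {e : Simple P} {d b a : Idx P} (h : Arr e a d)
    (hdb : WtLT P d b) (hne : d ≠ bar P b) : InductionAt σ b d a := by
  have hba : WtLT P a b := lt_trans hdb h.pos_lt
  have had : form P (wt P d) (wt P a) = 0 := form_wt_eq_zero h.ne h.ne_bar
  have hdb0 : form P (wt P d) (wt P b) = 0 := form_wt_eq_zero (ne_of_wtLT hdb).symm hne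
  have hne' : b ≠ bar P d := fun h1 => hne (by rw [h1, bar_bar])
  have key := ht.star_in hr hH hdb h
    (fun x hx => (h.source_eq_or_eq_bar hx).elim (ne_of_wtLT hba) hne')
  rw [h.form_eq, h.form_eq, h.form_eq, had, form_comm (wt P a) (wt P d), had, hdb0,
    form_comm (wt P a) (wt P b), sub_zero, zero_sub, zero_sub, h.par_eq, mul_neg] at key
  have hX := ht.edge hr hH h
  have hs : sgn ((par P d + par P a) * (par P d + par P b)) =
      sgn ((par P b + par P d) * (par P a + par P d)) := by
    congr 1; ring
  rw [hs] at key
  have := induction_edge_right key hX (by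
    rw [zpow_neg]
    have := zpow_ne_zero (form P (wt P a) (wt P a)) hr
    have := h.piE_ne_zero
    field_simp)
  exact this

/-- The entries for (b, d) and (c, a) q-commute by `IsLaxMatrix.star_none`, so the nested brackets
through d and c can be regrouped by the q-Jacobi identity. The conditions on opposites keep the
forms involved equal to zero. -/
theorem IsLaxMatrix.induction_up (hr : r ≠ 0) (hH : r ^ 2 - (r ^ 2)⁻¹ ≠ 0)
    (ht : IsLaxMatrix (entries σ)) {e : Simple P} {b d c a : Idx P} (h : Arr e d b)
    (hcd : WtLT P c d) (hac : WtLT P a c) (hda : d ≠ bar P a) (hdc : d ≠ bar P c)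
    (hcb : c ≠ bar P b) (ih : InductionAt σ d c a) : InductionAt σ b c a := by
  have had : WtLT P a d := lt_trans hcd hac
  have hab : WtLT P a b := lt_trans h.pos_lt had
  have hbc : WtLT P c b := lt_trans h.pos_lt hcd
  have fda : form P (wt P d) (wt P a) = 0 := form_wt_eq_zero (ne_of_wtLT had) hda
  have fdc : form P (wt P d) (wt P c) = 0 := form_wt_eq_zero (ne_of_wtLT hcd) hdc
  have fbc : form P (wt P b) (wt P c) = 0 := by
    rw [form_comm]; exact form_wt_eq_zero (ne_of_wtLT hbc).symm hcb
  have hda' : a ≠ bar P d := fun h1 => hda (by rw [h1, bar_bar])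
  have hN := ht.star_none hr hH hac
    (fun x hx => (h.eq_or_eq_bar hx).elim (ne_of_wtLT hab).symm hda')
    (fun x hx => (h.source_eq_or_eq_bar hx).elim (ne_of_wtLT hcd).symm hcb)
  rw [h.form_eq, h.form_eq, fbc, fdc, fda, sub_zero, sub_zero, mul_zero, zpow_zero, one_smul,
    h.par_eq, sub_eq_zero] at hN
  have hX := ht.edge hr hH h
  have h1 := (ht.induction_base_left hr hH h hcd hdc).of_form_eq_zero fbc
  have h2 := ih.of_form_eq_zero fda
  refine induction_step_left (Y := σ d c) (S := sgn ((par P b + par P d) * (par P a + par P c)))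
    (ht.induction_base_left hr hH h had hda) (h2.trans ?_) (h1.trans ?_) ?_
  · rw [← sgn_add]
    congr 4
    exact (by decide : ∀ x y z w : ZMod 2, (y + z) * (w + z) = (x + z) * (w + z) + (x + y) * (w + z)) _ _ _ _
  · rw [← sgn_add]
    congr 4
    exact (by decide : ∀ x y z w : ZMod 2, (x + y) * (z + y) = (x + y) * (w + y) + (x + y) * (w + z)) _ _ _ _
  · rw [hX, mul_smul_comm, smul_mul_assoc, hN, smul_comm]

theorem IsLaxMatrix.induction_down (hr : r ≠ 0) (hH : r ^ 2 - (r ^ 2)⁻¹ ≠ 0)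
    (ht : IsLaxMatrix (entries σ)) {e : Simple P} {b d c a : Idx P} (h : Arr e a d)
    (hdc : WtLT P d c) (hcb : WtLT P c b) (hdb : d ≠ bar P b) (hdc' : d ≠ bar P c)
    (hca : c ≠ bar P a) (ih : InductionAt σ b c d) : InductionAt σ b c a := by
  have hd : WtLT P d b := lt_trans hcb hdc
  have hab : WtLT P a b := lt_trans hd h.pos_lt
  have hac : WtLT P a c := lt_trans hdc h.pos_lt
  have fbd : form P (wt P d) (wt P b) = 0 := form_wt_eq_zero (ne_of_wtLT hd).symm hdb
  have fdc : form P (wt P d) (wt P c) = 0 := form_wt_eq_zero (ne_of_wtLT hdc).symm hdc'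
  have fca : form P (wt P c) (wt P a) = 0 := form_wt_eq_zero (ne_of_wtLT hac) hca
  have hdb' : b ≠ bar P d := fun h1 => hdb (by rw [h1, bar_bar])
  have hN := ht.star_none hr hH hcb
    (fun x hx => (h.eq_or_eq_bar hx).elim (ne_of_wtLT hdc) hca)
    (fun x hx => (h.source_eq_or_eq_bar hx).elim (ne_of_wtLT hab) hdb')
  rw [h.form_eq, h.form_eq, fbd, fdc, form_comm (wt P a) (wt P c), fca,
    form_comm (wt P a) (wt P b), sub_zero, zero_sub, mul_zero, neg_zero, zpow_zero, mul_one,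
    h.par_eq, sub_eq_zero, mul_neg] at hN
  have hX := ht.edge hr hH h
  have h1 := (ht.induction_base_right hr hH h hdc hdc').of_form_eq_zero fca
  have h2 := ih.of_form_eq_zero (by rw [form_comm, fbd])
  refine induction_step_right (Y := σ c d) (S := sgn ((par P d + par P a) * (par P c + par P b)))
    (ht.induction_base_right hr hH h hd hdb) (h2.trans ?_) (h1.trans ?_) ?_
  · rw [← sgn_add]
    congr 4
    exact (by decide : ∀ b c d a : ZMod 2,
      (b + c) * (d + c) = (b + c) * (a + c) + (d + a) * (c + b)) _ _ _ _
  · rw [← sgn_add]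
    congr 4
    exact (by decide : ∀ b c d a : ZMod 2,
      (c + d) * (a + d) = (b + d) * (a + d) + (d + a) * (c + b)) _ _ _ _
  · have hs := sgn_mul_self ((par P d + par P a) * (par P c + par P b))
    generalize r ^ form P (wt P a) (wt P a) * (piE e d a)⁻¹ = κ at hX
    rw [hX, mul_smul_comm, smul_mul_assoc, smul_comm (_ * _) κ, mul_smul (sgn _) (r ^ _), hN,
      smul_smul (sgn _), hs, one_smul]

/-- When a is the opposite of d, label e enters a and also leaves d, so `IsLaxMatrix.star_both` for
(d, a) has two terms on its right side. The unwanted one is the entry for d and the opposite of b,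
which plays the role of T in `induction_fold_left`. -/
theorem IsLaxMatrix.induction_fold_up (hr : r ≠ 0) (hH : r ^ 2 - (r ^ 2)⁻¹ ≠ 0)
    (ht : IsLaxMatrix (entries σ)) {e f : Simple P} {b d c : Idx P} (h : Arr e d b)
    (h' : Arr f c d) (hc : 2 * pos P c + 1 < P.m + 2 * P.k) : InductionAt σ b c (bar P d) := by
  have hN := pos_bar d
  have hB := pos_bar b
  have hp := h.pos_lt
  have hp' := h'.pos_lt
  have fbd : form P (wt P b) (wt P d) = 0 := form_wt_eq_zero h.ne h.ne_bar
  have fbc : form P (wt P b) (wt P c) = 0 := form_wt_of_ne (by omega) (by omega)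
  have fdc : form P (wt P d) (wt P c) = 0 := form_wt_eq_zero h'.ne h'.ne_bar
  have hca : WtLT P (bar P d) c := by unfold WtLT; omega
  have hcb : WtLT P (bar P b) c := by unfold WtLT; omega
  have hda : WtLT P (bar P d) d := by unfold WtLT; omega
  have R1 := ht.induction_base_left hr hH h' hca (by rw [bar_bar]; exact h'.ne.symm)
  have R2 := ht.induction_base_left hr hH h h'.pos_lt h'.ne_bar
  have S3 := ht.star_in hr hH hca h.bar (fun x hx => by
    rcases h.source_eq_or_eq_bar hx with h1 | h1
    · exact h'.ne h1.symm
    · rw [eq_bar_iff] at h1; omega)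
  have S4 := ht.star_out hr hH hcb (fun x hx => by
    rcases h'.eq_or_eq_bar hx with h1 | h1
    · rw [← pos_inj] at h1; omega
    · rw [← pos_inj] at h1; have := pos_bar c; omega) h'
  have S2 := ht.star_both hr hH hda h.bar h
  have hX := ht.edge hr hH h
  have hY := ht.edge hr hH h'
  unfold InductionAt at R1
  have R2 := R2.of_form_eq_zero fbc
  simp only [h.form_eq, h'.form_eq, wt_bar, form_neg_right, par_bar, fbd, fbc, fdc,
    form_comm (wt P d) (wt P b), form_comm (wt P c) (wt P b), h.par_eq, h'.par_eq,
    add_comm (par P c) (par P d), sub_zero,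
    zero_sub, neg_neg, mul_zero, mul_neg, neg_zero, zpow_zero, one_smul, CharTwo.add_self_eq_zero,
    sgn_zero, one_mul, mul_one, mul_assoc (sgn _)] at R1 R2 S2 S3 S4
  have hu := zpow_ne_zero (form P (wt P d) (wt P d)) hr
  have hw := zpow_ne_zero (form P (wt P c) (wt P c)) hr
  have hπ := h.piE_ne_zero
  have hπ' := h'.piE_ne_zero
  have key := induction_fold_left_of_edges (sgn_mul_self _) hX hY
    (by rw [zpow_neg]; field_simp) (by rw [zpow_neg]; field_simp)
    (h1 := ?_) (hU := R2) S3 S4 S2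
  · unfold InductionAt
    rw [wt_bar, form_neg_right, fbd, par_bar, neg_zero, mul_zero, neg_zero, zpow_zero, one_smul,
      key]
    congr 4
    ring
  · rw [R1, smul_sub, smul_smul, smul_smul, ← zpow_add₀ hr, neg_add_cancel, zpow_zero, one_smul,
      ← sgn_add]
    congr 5
    exact (by decide : ∀ b c d : ZMod 2,
      (d + c) * (d + c) = (b + d) * (d + c) + (d + c) * (b + c)) _ _ _

theorem IsLaxMatrix.induction_fold_down (hr : r ≠ 0) (hH : r ^ 2 - (r ^ 2)⁻¹ ≠ 0)
    (ht : IsLaxMatrix (entries σ)) {e f : Simple P} {a d c : Idx P} (h : Arr e a d)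
    (h' : Arr f d c) (hc : P.m + 2 * P.k < 2 * pos P c + 1) : InductionAt σ (bar P d) c a := by
  have hN := pos_bar d
  have hB := pos_bar a
  have hp := h.pos_lt
  have hp' := h'.pos_lt
  have fda : form P (wt P d) (wt P a) = 0 := form_wt_eq_zero h.ne h.ne_bar
  have fca : form P (wt P c) (wt P a) = 0 := form_wt_of_ne (by omega) (by omega)
  have fcd : form P (wt P c) (wt P d) = 0 := form_wt_eq_zero h'.ne h'.ne_bar
  have hbc : WtLT P c (bar P d) := by unfold WtLT; omega
  have hac : WtLT P c (bar P a) := by unfold WtLT; omega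
  have hbd : WtLT P d (bar P d) := by unfold WtLT; omega
  have R1 := ht.induction_base_right hr hH h' hbc (by rw [bar_bar]; exact h'.ne)
  have R2 := ht.induction_base_right hr hH h h'.pos_lt (fun h1 => by
    rw [eq_bar_iff] at h1; omega)
  have S3 := ht.star_out hr hH hbc (fun x hx => by
    rcases h.eq_or_eq_bar hx with h1 | h1
    · exact h'.ne h1
    · rw [eq_bar_iff] at h1; omega) h.bar
  have S4 := ht.star_in hr hH hac h' (fun x hx => by
    rcases h'.source_eq_or_eq_bar hx with h1 | h1
    · rw [← pos_inj] at h1; omega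
    · rw [← pos_inj] at h1; have := pos_bar c; omega)
  have S2 := ht.star_both hr hH hbd h h.bar
  have hX := ht.edge hr hH h
  have hY := ht.edge hr hH h'
  unfold InductionAt at R1
  have R2 := R2.of_form_eq_zero fca
  simp only [h.form_eq, h'.form_eq, wt_bar, form_neg_right, form_neg_left, par_bar, fda, fca, fcd,
    form_comm (wt P a) (wt P d), form_comm (wt P a) (wt P c), form_comm (wt P d) (wt P c),
    h.par_eq, h'.par_eq,
    add_comm (par P c) (par P d), add_comm (par P c) (par P a), add_comm (par P a) (par P d),
    mul_comm (par P d + par P c) (par P d + par P a), sub_zero,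
    zero_sub, neg_neg, mul_zero, mul_neg, neg_zero, zpow_zero, one_smul, CharTwo.add_self_eq_zero,
    sgn_zero, one_mul, mul_one, mul_assoc (sgn _)] at R1 R2 S2 S3 S4
  have hu := zpow_ne_zero (form P (wt P a) (wt P a)) hr
  have hw := zpow_ne_zero (form P (wt P d) (wt P d)) hr
  have hπ := h.piE_ne_zero
  have hπ' := h'.piE_ne_zero
  have key := induction_fold_right_of_edges (sgn_mul_self _) hX hY
    (by rw [zpow_neg]; field_simp) (by rw [zpow_neg]; field_simp)
    (h1 := ?_) (hU := R2) S3 S4 S2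
  · unfold InductionAt
    rw [wt_bar, form_neg_left, fda, par_bar, neg_zero, mul_zero, neg_zero, zpow_zero, one_smul,
      key]
  · rw [R1, smul_sub, smul_smul, smul_smul, ← zpow_add₀ hr, neg_add_cancel, zpow_zero, one_smul,
      ← sgn_add]
    congr 5
    exact (by decide : ∀ a c d : ZMod 2,
      (d + c) * (d + c) = (d + a) * (d + c) + (d + c) * (a + c)) _ _ _

end InductionAt

/-! ### The combinatorics of triples of positions -/

/-- Positions `D` and `B` joined by an edge of the crystal graph, for `K = k + l`. -/
def PosArr (m K D B : ℕ) : Prop :=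
  (D = B + 1 ∧ ¬(m % 2 = 0 ∧ B + 1 = K)) ∨
    (m % 2 = 0 ∧ ((D = K ∧ B + 2 = K) ∨ (D = K + 1 ∧ B + 1 = K)))

/-- Every triple of positions is reached by the recursion for the induction relations. -/
theorem posArr_cases {m K N A B C : ℕ} {p : Prop} (hN : N = 2 * K + m % 2) (hA : A < N)
    (hBC : B < C) (hCA : C < A) (hb : C + B + 1 ≠ N) (ha : C + A + 1 ≠ N)
    (h1 : ¬ PosArr m K C B) (h2 : ¬ PosArr m K A C)
    (h3 : ∀ D, PosArr m K D B → D < C → D + A + 1 ≠ N → D + C + 1 ≠ N → p)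
    (h4 : ∀ D, PosArr m K A D → C < D → D + B + 1 ≠ N → D + C + 1 ≠ N → p)
    (h5 : ∀ D, PosArr m K D B → PosArr m K C D → D + A + 1 = N → 2 * C + 1 < N → p)
    (h6 : ∀ D, PosArr m K A D → PosArr m K D C → D + B + 1 = N → N < 2 * C + 1 → p) : p := by
  by_contra hp
  have hm := Nat.mod_lt m (show 2 > 0 by norm_num)
  have h3' : ∀ D, PosArr m K D B → D < C → D + A + 1 ≠ N → D + C + 1 = N := fun D a b c => by
    by_contra d; exact hp (h3 D a b c d)
  have h4' : ∀ D, PosArr m K A D → C < D → D + B + 1 ≠ N → D + C + 1 = N := fun D a b c => by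
    by_contra d; exact hp (h4 D a b c d)
  have h5' : ∀ D, PosArr m K D B → PosArr m K C D → D + A + 1 = N → ¬ 2 * C + 1 < N :=
    fun D a b c d => hp (h5 D a b c d)
  have h6' : ∀ D, PosArr m K A D → PosArr m K D C → D + B + 1 = N → ¬ N < 2 * C + 1 :=
    fun D a b c d => hp (h6 D a b c d)
  clear h3 h4 h5 h6 hp
  unfold PosArr at *
  rcases (show m % 2 = 0 ∨ m % 2 = 1 by omega) with h | h
  · simp only [h, true_and] at *
    have s1 : B + 1 ≠ K → C ≠ B + 1 := by omega
    have s2 : B + 2 = K ∨ B + 1 = K → C ≠ B + 2 := by omega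
    have s3 : A ≠ K → A ≠ C + 1 := by omega
    have s4 : A = K ∨ A = K + 1 → A ≠ C + 2 := by omega
    -- An edge moves a position by one, or by two around the diamond. The quantified hypotheses are
    -- instantiated at these few values, which leaves a problem in linear arithmetic.
    have a1 : B + 1 ≠ K → B + 1 < C → B + 1 + A + 1 ≠ N → B + 1 + C + 1 = N :=
      fun e => h3' (B + 1) (by omega)
    have a2 : B + 2 = K ∨ B + 1 = K → B + 2 < C → B + 2 + A + 1 ≠ N → B + 2 + C + 1 = N :=
      fun e => h3' (B + 2) (by omega)
    have b1 : A ≠ K → C < A - 1 → A - 1 + B + 1 ≠ N → A - 1 + C + 1 = N :=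
      fun e => h4' (A - 1) (by omega)
    have b2 : A = K ∨ A = K + 1 → C < A - 2 → A - 2 + B + 1 ≠ N → A - 2 + C + 1 = N :=
      fun e => h4' (A - 2) (by omega)
    have c1 : B + 1 ≠ K → B + 2 ≠ K → C = B + 2 → B + 1 + A + 1 = N → ¬ 2 * C + 1 < N :=
      fun e e' e'' => h5' (B + 1) (by omega) (by omega)
    have c2 : A ≠ K → A ≠ K + 1 → A = C + 2 → A - 1 + B + 1 = N → ¬ N < 2 * C + 1 :=
      fun e e' e'' => h6' (A - 1) (by omega) (by omega)
    clear h3' h4' h5' h6' h1 h2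
    by_cases e1 : B + 2 = K ∨ B + 1 = K <;> by_cases e2 : A = K ∨ A = K + 1
    · have e3 : C = B + 1 ∨ C = B + 2 := by clear * - e1 e2 hBC hCA; omega
      clear b1 b2 c1 c2 a1 a2
      rcases e1 with e1 | e1 <;> rcases e2 with e2 | e2 <;> rcases e3 with e3 | e3 <;>
        subst e2 e3 <;> omega
    · have b1 := b1 (fun h => e2 (Or.inl h))
      have c2 := c2 (fun h => e2 (Or.inl h)) (fun h => e2 (Or.inr h))
      have s3 := s3 (fun h => e2 (Or.inl h))
      have a2 := a2 e1
      have s2 := s2 e1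
      clear c1 s4 b2 a1
      rcases e1 with e1 | e1
      · have s1 := s1 (by clear * - e1; omega)
        omega
      · clear s1
        omega
    · have a1 := a1 (fun h => e1 (Or.inr h))
      have c1 := c1 (fun h => e1 (Or.inr h)) (fun h => e1 (Or.inl h))
      have s1 := s1 (fun h => e1 (Or.inr h))
      have b2 := b2 e2
      have s4 := s4 e2
      clear c2 s2 a2 b1
      rcases e2 with e2 | e2
      · clear s3
        omega
      · have s3 := s3 (by clear * - e2; omega)
        omega
    · have a1 := a1 (fun h => e1 (Or.inr h))
      have b1 := b1 (fun h => e2 (Or.inl h))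
      have c1 := c1 (fun h => e1 (Or.inr h)) (fun h => e1 (Or.inl h))
      have c2 := c2 (fun h => e2 (Or.inl h)) (fun h => e2 (Or.inr h))
      have s1 := s1 (fun h => e1 (Or.inr h))
      have s3 := s3 (fun h => e2 (Or.inl h))
      clear s2 s4 a2 b2 e1 e2
      omega
  · have a1 := h3' (B + 1) (by omega)
    have b1 := h4' (A - 1) (by omega)
    have c1 : C = B + 2 → B + 1 + A + 1 = N → ¬ 2 * C + 1 < N :=
      fun e => h5' (B + 1) (by omega) (by omega)
    have c2 : A = C + 2 → A - 1 + B + 1 = N → ¬ N < 2 * C + 1 :=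
      fun e => h6' (A - 1) (by omega) (by omega)
    have s1 : C ≠ B + 1 := by omega
    have s3 : A ≠ C + 1 := by omega
    clear h3' h4' h5' h6' h1 h2
    omega

/-! ### The general induction relation and the determination of all entries -/

section Determined

variable {P : Params} {r : ℂ} {σ τ : Idx P → Idx P → Uq P r}

theorem PosArr.exists_arr {b d : Idx P} (h : PosArr P.m (P.k + P.l) (pos P d) (pos P b)) :
    ∃ e, Arr e d b := by
  have hm := m_eq (P := P)
  have hl := one_le_l (P := P)
  have hk := P.k_pos
  have hd := pos_lt d
  unfold PosArr at h
  by_cases h1 : P.m % 2 = 0 ∧ ¬ pos P d = pos P b + 1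
  · obtain ⟨c, hc⟩ := exists_node (P := P) (p := P.k + P.l - 1) (by omega)
    exact ⟨c, by rw [arr_iff]; omega⟩
  · by_cases h2 : pos P b < P.k + P.l
    · obtain ⟨c, hc⟩ := exists_node (P := P) h2
      exact ⟨c, by rw [arr_iff]; omega⟩
    · obtain ⟨c, hc⟩ := exists_node (P := P) (p := P.m + 2 * P.k - 2 - pos P b) (by omega)
      exact ⟨c, by rw [arr_iff]; omega⟩

theorem PosArr.lt {m K D B : ℕ} (h : PosArr m K D B) : B < D := by
  unfold PosArr at h; omega

/-- Strong induction on the distance `n` from b to a. If c is not joined by an edge to b or a, one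
end of the interval is moved inwards along an edge; `posArr_cases` guarantees that some regular or
folding step is available. -/
theorem IsLaxMatrix.inductionAt (hr : r ≠ 0) (hH : r ^ 2 - (r ^ 2)⁻¹ ≠ 0)
    (ht : IsLaxMatrix (entries σ)) (n : ℕ) : ∀ {b c a : Idx P}, pos P a = pos P b + n →
    WtLT P c b → WtLT P a c → c ≠ bar P b → c ≠ bar P a → InductionAt σ b c a := by
  induction n using Nat.strong_induction_on with
  | _ n ih =>
  intro b c a hn hbc hca hb ha
  have hm := m_eq (P := P)
  have hA := pos_lt a
  have hb' := hb
  have ha' := ha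
  rw [Ne, eq_bar_iff] at hb' ha'
  by_cases h1 : PosArr P.m (P.k + P.l) (pos P c) (pos P b)
  · obtain ⟨e, he⟩ := h1.exists_arr
    exact ht.induction_base_left hr hH he hca ha
  by_cases h2 : PosArr P.m (P.k + P.l) (pos P a) (pos P c)
  · obtain ⟨e, he⟩ := h2.exists_arr
    exact ht.induction_base_right hr hH he hbc hb
  refine posArr_cases (N := P.m + 2 * P.k) (by omega) hA hbc hca hb' ha' h1 h2 ?_ ?_ ?_ ?_
  · intro D hD hDc hDa hDc'
    obtain ⟨d, rfl⟩ := exists_pos (P := P) (p := D) (by have := pos_lt c; omega)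
    obtain ⟨e, he⟩ := hD.exists_arr
    have hp := he.pos_lt
    have hda : d ≠ bar P a := fun h => hDa (eq_bar_iff.1 h)
    have hdc : d ≠ bar P c := fun h => hDc' (eq_bar_iff.1 h)
    exact ht.induction_up hr hH he hDc hca hda hdc hb
      (ih (pos P a - pos P d) (by unfold WtLT at *; omega) (by unfold WtLT at *; omega) hDc hca
        (fun h => hdc (by rw [h, bar_bar])) ha)
  · intro D hD hDc hDb hDc'
    obtain ⟨d, rfl⟩ := exists_pos (P := P) (p := D) (by have := hD.lt; omega)
    obtain ⟨e, he⟩ := hD.exists_arr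
    have hp := he.pos_lt
    have hdb : d ≠ bar P b := fun h => hDb (eq_bar_iff.1 h)
    have hdc : d ≠ bar P c := fun h => hDc' (eq_bar_iff.1 h)
    exact ht.induction_down hr hH he hDc hbc hdb hdc ha
      (ih (pos P d - pos P b) (by unfold WtLT at *; omega) (by unfold WtLT at *; omega) hbc hDc hb
        (fun h => hdc (by rw [h, bar_bar])))
  · intro D hD hC hDa hlt
    obtain ⟨d, rfl⟩ := exists_pos (P := P) (p := D) (by have := hC.lt; omega)
    obtain ⟨e, he⟩ := hD.exists_arr
    obtain ⟨f, hf⟩ := hC.exists_arr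
    obtain rfl : a = bar P d := eq_bar_iff.2 (by omega)
    exact ht.induction_fold_up hr hH he hf hlt
  · intro D hD hC hDb hlt
    obtain ⟨d, rfl⟩ := exists_pos (P := P) (p := D) (by have := hD.lt; omega)
    obtain ⟨e, he⟩ := hD.exists_arr
    obtain ⟨f, hf⟩ := hC.exists_arr
    obtain rfl : b = bar P d := eq_bar_iff.2 (by omega)
    exact ht.induction_fold_down hr hH he hf hlt

theorem sq_zpow (r : ℂ) (n : ℤ) : (r ^ 2) ^ n = r ^ (2 * n) := by
  rw [zpow_mul]; rfl

theorem IsLaxMatrix.induction (hr : r ≠ 0) (hH : r ^ 2 - (r ^ 2)⁻¹ ≠ 0)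
    (ht : IsLaxMatrix (entries σ)) : Induction σ := by
  intro a b c hcb hac hb ha
  have h := ht.inductionAt hr hH (pos P a - pos P b) (b := b) (c := c) (a := a)
    (by unfold WtLT at *; omega) hcb hac hb ha
  rw [sq_zpow, sq_zpow, mul_neg, mul_neg]
  exact h

theorem FundamentalValues.eq_of_arr (hr : r ≠ 0) (h : FundamentalValues σ)
    (h' : FundamentalValues τ) {c : Simple P} {d b : Idx P} (hc : Arr c d b) : τ b d = σ b d := by
  have hneg : ∀ {x y z : Uq P r}, -x = z → -y = z → x = y := fun e e' => neg_inj.1 (e.trans e'.symm)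
  have hsmul : ∀ {t : ℂ} {x y z : Uq P r}, t ≠ 0 → t • x = z → t • y = z → x = y :=
    fun ht e e' => smul_right_injective _ ht (e.trans e'.symm)
  have hs : ((-1) ^ P.k * r ^ 2 : ℂ) ≠ 0 :=
    mul_ne_zero (pow_ne_zero _ (by norm_num)) (pow_ne_zero _ hr)
  rcases hc with ⟨rfl, rfl⟩ | ⟨rfl, rfl⟩
  · cases c with
    | even i => exact (h'.even i).1.trans (h.even i).1.symm
    | last =>
      by_cases hm : Even P.m
      · exact (h'.last_of_even hm).1.trans (h.last_of_even hm).1.symm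
      · exact (h'.last_of_odd hm).1.trans (h.last_of_odd hm).1.symm
    | odd j => exact (h'.odd j).1.trans (h.odd j).1.symm
    | s => exact h'.s.1.trans h.s.1.symm
  · cases c with
    | even i => exact hneg (h'.even i).2 (h.even i).2
    | last =>
      by_cases hm : Even P.m
      · exact hneg (h'.last_of_even hm).2 (h.last_of_even hm).2
      · exact smul_right_injective _ (inv_ne_zero hr)
          (hneg (h'.last_of_odd hm).2 (h.last_of_odd hm).2)
    | odd j => exact (h'.odd j).2.trans (h.odd j).2.symm
    | s => exact hsmul hs h'.s.2 h.s.2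

theorem FundamentalValues.eq_of_middle (h : FundamentalValues σ) (h' : FundamentalValues τ)
    {a b : Idx P} (hm : P.m % 2 = 0) (hb : pos P b + 1 = P.k + P.l) (ha : pos P a = P.k + P.l) :
    τ b a = σ b a := by
  have hm' := m_eq (P := P)
  have hl := one_le_l (P := P)
  have e1 : b = ev P (P.l - 1) (lt_m_of_le (by omega)) := by
    rw [← pos_inj]
    change pos P b = P.k + (P.l - 1)
    omega
  have e2 : a = bar P b := eq_bar_iff.2 (by omega)
  rw [e2, e1]
  exact (h'.zero_of_even (Nat.even_iff.2 hm)).trans (h.zero_of_even (Nat.even_iff.2 hm)).symm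

/-- The fundamental values and the induction relations determine all entries. -/
theorem Induction.eq_of_fundamentalValues (hr : r ≠ 0) (hσ : FundamentalValues σ)
    (hσ' : Induction σ) (hτ : FundamentalValues τ) (hτ' : Induction τ) (n : ℕ) :
    ∀ {a b : Idx P}, pos P a = pos P b + n → 0 < n → τ b a = σ b a := by
  induction n using Nat.strong_induction_on with
  | _ n ih =>
  intro a b hn hpos
  have hm := m_eq (P := P)
  have hA := pos_lt a
  by_cases h1 : PosArr P.m (P.k + P.l) (pos P a) (pos P b)
  · obtain ⟨e, he⟩ := h1.exists_arr
    exact hσ.eq_of_arr hr hτ he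
  by_cases h2 : P.m % 2 = 0 ∧ pos P b + 1 = P.k + P.l ∧ pos P a = P.k + P.l
  · exact hσ.eq_of_middle hτ h2.1 h2.2.1 h2.2.2
  -- One of the two positions directly after b lies strictly before a and is opposite to neither
  -- end; failing this, (b, a) would be an edge or the middle pair.
  obtain ⟨C, hC1, hC2, hC3, hC4⟩ : ∃ C, pos P b < C ∧ C < pos P a ∧
      C + pos P b + 1 ≠ P.m + 2 * P.k ∧ C + pos P a + 1 ≠ P.m + 2 * P.k := by
    by_contra! hC
    have c1 := hC (pos P b + 1)
    have c2 := hC (pos P b + 2)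
    clear hC
    unfold PosArr at h1
    omega
  obtain ⟨c, rfl⟩ := exists_pos (P := P) (p := C) (by omega)
  have hb : c ≠ bar P b := fun h => hC3 (eq_bar_iff.1 h)
  have ha : c ≠ bar P a := fun h => hC4 (eq_bar_iff.1 h)
  rw [hσ' a b c hC1 hC2 hb ha, hτ' a b c hC1 hC2 hb ha,
    ih (pos P c - pos P b) (by omega) (a := c) (b := b) (by omega) (by omega),
    ih (pos P a - pos P c) (by omega) (a := a) (b := c) (by omega) (by omega)]

theorem ofEntries_mem_endTensorUplus {g : Idx P → Idx P → Uq P r}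
    (hg : ∀ a b, g a b ∈ Uplus P r) : ofEntries g ∈ endTensorUplus P r :=
  Submodule.sum_mem _ fun a _ => Submodule.sum_mem _ fun b _ =>
    Submodule.subset_span ⟨elem a b, g a b, hg a b, rfl⟩

end Determined

end Osp

end

/-! ### The main theorem -/

theorem mainTheorem1 (P : Osp.Params) (r : ℂ) (hr : r ≠ 0)
    (hq : ∀ N : ℕ, 0 < N → (r ^ 2) ^ N ≠ 1) :
    (∃! R : Osp.LaxAlg P r, R ∈ Osp.endTensorUplus P r ∧
      (∃ σ : Osp.Idx P → Osp.Idx P → Osp.Uq P r, R = Osp.lax r σ) ∧ Osp.Intertwines R) ∧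
    ∀ σ : Osp.Idx P → Osp.Idx P → Osp.Uq P r,
      Osp.lax r σ ∈ Osp.endTensorUplus P r → Osp.Intertwines (Osp.lax r σ) →
        Osp.FundamentalValues σ ∧ Osp.QCommutation σ ∧ Osp.Induction σ ∧
        ∀ τ : Osp.Idx P → Osp.Idx P → Osp.Uq P r,
          Osp.FundamentalValues τ → Osp.QCommutation τ → Osp.Induction τ →
            ∀ a b : Osp.Idx P, Osp.WtLT P a b → τ b a = σ b a := by
  have hH := Osp.sq_sub_inv_sq_ne_zero hr hq
  refine ⟨?_, fun σ _ hσ => ?_⟩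
  · obtain ⟨t, ht⟩ := Osp.exists_isLaxMatrix (P := P) hr hq
    obtain ⟨σ, rfl⟩ := Osp.exists_entries_eq hH ht
    refine ⟨Osp.lax r σ, ⟨?_, ⟨σ, rfl⟩, ?_⟩, ?_⟩
    · rw [Osp.lax_eq_ofEntries]
      exact Osp.ofEntries_mem_endTensorUplus fun a b =>
        mul_mem (Osp.uK_mem _) ((ht.column b).mem a)
    · rw [Osp.lax_eq_ofEntries]
      exact ht.intertwines hr
    · rintro _ ⟨-, ⟨σ', rfl⟩, h⟩
      rw [Osp.lax_eq_ofEntries] at h ⊢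
      -- It remains to compare the lowest weight columns. There the ansatz leaves no freedom: no
      -- index is lower, so the second factor has 1 on the diagonal and 0 elsewhere.
      rw [Osp.lax_eq_ofEntries, h.unique (ht.intertwines hr) fun a b hb => ?_]
      congr 1
      by_cases hab : a = b
      · rw [hab, Osp.entries_self, Osp.entries_self]
      · have h2 := Osp.pos_lt a
        have h3 : ¬ Osp.WtLT P a b := by unfold Osp.WtLT; omega
        rw [Osp.entries_of_not_lt h3 hab, Osp.entries_of_not_lt h3 hab]
  · have ht := Osp.isLaxMatrix_entries hr hq hσ
    have hF := ht.fundamentalValues hr hH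
    have hI := ht.induction hr hH
    refine ⟨hF, ht.qCommutation hr hH, hI, fun τ hτ _ hτ' a b hab => ?_⟩
    have hab' : Osp.pos P b < Osp.pos P a := hab
    exact hI.eq_of_fundamentalValues hr hF hτ hτ' (Osp.pos P a - Osp.pos P b) (by omega) (by omega)
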